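/- Let $X$ and $Y$ be smooth Riemannian manifolds without boundary (Hausdorff, second countable), let $d$ be the geodesic distance of $Y$ (assumed finite), put $c(x,y)=\tfrac12 d(x,y)^2$, let $T:X\to Y$ be a smooth diffeomorphism and let $\varepsilon>0$. Let $\nu$ be a compactly supported probability measure on $Y$ and $\mu$ a compactly supported probability measure on $X$ that is absolutely continuous with respect to the Riemannian volume. (Compact supports are automatic if $X$ and $Y$ are compact.) For probability measures $\rho$ on $Y$ let $$\tfrac12\mathcal W_{2,\varepsilon}^2(\nu,\rho)=\inf_{\gamma}\Big\{\int c\,d\gamma+\varepsilon\,\mathrm{KL}(\gamma\,|\,\nu\otimes\rho)\Big\},$$ the infimum being over the couplings $\gamma$ of $\nu$ and $\rho$, and let $F_\varepsilon(\chi)=\tfrac12\mathcal W_{2,\varepsilon}^2(\nu,T_\#\chi)$ for probability measures $\chi$ on $X$. Put $\rho=T_\#\mu$. Then: 1. There are continuous functions $f,g:Y\to\mathbb R$ (the Sinkhorn dual potentials) such that for all $x,y\in Y$ $$f(x)=-\varepsilon\log\int e^{(g(y')-c(x,y'))/\varepsilon}\,d\rho(y'),\qquad g(y)=-\varepsilon\log\int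 e^{(f(x')-c(x',y))/\varepsilon}\,d\nu(x'),$$ and any other such pair is $(f+a,\,g-a)$ for a constant $a\in\mathbb R$. Every such pair attains $$F_\varepsilon(\mu)=\max_{f',g'\in C(Y)}\Big\{\int f'\,d\nu+\int g'\,d\rho-\varepsilon\iint e^{(f'(x)+g'(y)-c(x,y))/\varepsilon}\,d\nu(x)\,d\rho(y)+\varepsilon\Big\}.$$ 2. For every such pair, $g\circ T$ is the first variation $\frac{\delta F_\varepsilon}{\delta\mu}$ of $F_\varepsilon$ at $\mu$: for every compactly supported probability measure $\chi$ on $X$, $$\frac{d}{ds}\Big|_{s=0^+}F_\varepsilon\big((1-s)\mu+s\chi\big)=\int g\circ T\,d(\chi-\mu),$$ and any other function on $X$ with this property (integrable with respect to $\mu$ and all such $\chi$) differs from $g\circ T$ by a constant. 3. For every such pair, $g\circ T$ is differentiable $\mu$-almost everywhere, and the Wasserstein gradient of $F_\varepsilon$ at $\mu$ is $$\mathrm{grad}_{\mathcal W_2}F_\varepsilon(\mu)=\nabla\Big(\frac{\delta F_\varepsilon}{\delta\mu}\Big)=\nabla(g\circ T).$$ That is, $\nabla(g\circ T)$ lies in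 the $L^2(\mu)$-closure of $\{\nabla\psi:\psi\in C_c^\infty(X)\}$, and $$\frac{d}{dt}\Big|_{t=0}F_\varepsilon\big((\varphi_t)_\#\mu\big)=\int_X\langle\nabla(g\circ T),\xi\rangle\,d\mu$$ for every smooth family of maps $\varphi_t:X\to X$, $t\in\mathbb R$, with $\varphi_0=\mathrm{id}$, $\varphi_t=\mathrm{id}$ for all $t$ off some compact set, and $\xi=\partial_t\varphi_t|_{t=0}$. -/

import Mathlib

open MeasureTheory Set Filter Topology Bundle
open scoped ENNReal ContDiff Manifold

noncomputable section

section Transport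

variable {Y : Type*} [MetricSpace Y] [MeasurableSpace Y]

/-- A measure carried by a compact set. -/
def CompactlySupported {Z : Type*} [TopologicalSpace Z] [MeasurableSpace Z]
    (μ : Measure Z) : Prop :=
  ∃ K : Set Z, IsCompact K ∧ μ Kᶜ = 0

/-- The quadratic ground cost `c(x, y) = d(x, y)² / 2`. -/
def quadCost (x y : Y) : ℝ := dist x y ^ 2 / 2

/-- The couplings (transport plans) of `ν` and `ρ`. -/
def couplings (ν ρ : Measure Y) : Set (Measure (Y × Y)) :=
  {γ | γ.map Prod.fst = ν ∧ γ.map Prod.snd = ρ}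

/-- The entropic optimal transport cost
`W²_{2,ε}(ν, ρ) = inf_γ { ∫ d(x, y)² dγ + 2 ε KL(γ | ν ⊗ ρ) }`, normalised so that half of it is
`inf_γ { ∫ c dγ + ε KL(γ | ν ⊗ ρ) }` with `c = d² / 2`. -/
def entropicW2Sq (ε : ℝ) (ν ρ : Measure Y) : ℝ :=
  (⨅ γ ∈ couplings ν ρ,
    (∫⁻ p, ENNReal.ofReal (dist p.1 p.2 ^ 2) ∂γ) +
      ENNReal.ofReal (2 * ε) * InformationTheory.klDiv γ (ν.prod ρ)).toReal

/-- The functional `F_ε(μ) = ½ W²_{2,ε}(ν, T_# μ)`. -/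
def pushforwardEnergy {X : Type*} [MeasurableSpace X] (ε : ℝ) (ν : Measure Y) (T : X → Y)
    (μ : Measure X) : ℝ :=
  1 / 2 * entropicW2Sq ε ν (μ.map T)

/-- The objective of the dual entropic transport problem, for the cost `c = d² / 2`. -/
def entropicDual (ε : ℝ) (ν ρ : Measure Y) (f g : Y → ℝ) : ℝ :=
  (∫ x, f x ∂ν) + (∫ y, g y ∂ρ)
    - ε * (∫ p, Real.exp ((f p.1 + g p.2 - quadCost p.1 p.2) / ε) ∂(ν.prod ρ)) + ε

/-- `(f, g)` are Sinkhorn dual potentials from `ν` to `ρ`: continuous functions that solve the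
Sinkhorn equations at every point of the space. -/
structure IsSinkhornPair (ε : ℝ) (ν ρ : Measure Y) (f g : Y → ℝ) : Prop where
  continuous_left : Continuous f
  continuous_right : Continuous g
  left_eq : ∀ x, f x = -ε * Real.log (∫ y, Real.exp ((g y - quadCost x y) / ε) ∂ρ)
  right_eq : ∀ y, g y = -ε * Real.log (∫ x, Real.exp ((f x - quadCost x y) / ε) ∂ν)

end Transport

section Otto

variable {n : ℕ} {X : Type*} [TopologicalSpace X] [ChartedSpace (EuclideanSpace ℝ (Fin n)) X]

/-- Absolute continuity with respect to the Riemannian volume: in every chart, the measure is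
absolutely continuous with respect to Lebesgue measure. -/
def ACInCharts [MeasurableSpace X] (μ : Measure X) : Prop :=
  ∀ e ∈ atlas (EuclideanSpace ℝ (Fin n)) X, (μ.restrict e.source).map e ≪ volume

/-- `h` is a first variation of `F` at `μ`: along each segment from `μ` to a compactly supported
probability measure `χ`, the right derivative of `F` at `μ` is `∫ h d(χ - μ)`. -/
def IsFirstVariation [MeasurableSpace X] (F : Measure X → ℝ) (μ : Measure X) (h : X → ℝ) : Prop :=
  ∀ χ : Measure X, IsProbabilityMeasure χ → CompactlySupported χ →
    Integrable h μ ∧ Integrable h χ ∧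
    HasDerivWithinAt (fun s : ℝ => F (ENNReal.ofReal (1 - s) • μ + ENNReal.ofReal s • χ))
      ((∫ x, h x ∂χ) - ∫ x, h x ∂μ) (Ici 0) 0

/-- A smooth deformation `φ_t` of the identity of `X`, equal to the identity off a compact set;
for instance `φ_t = id + t ξ` on a Euclidean space, or the flow of `ξ`, where `ξ` is a compactly
supported smooth vector field. -/
structure IsDeformation (φ : ℝ → X → X) : Prop where
  contMDiff : ContMDiff (𝓘(ℝ, ℝ).prod (𝓡 n)) (𝓡 n) ∞ (fun p : ℝ × X => φ p.1 p.2)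
  map_zero : ∀ x, φ 0 x = x
  compact : ∃ K : Set X, IsCompact K ∧ ∀ t, ∀ x ∉ K, φ t x = x

/-- The initial velocity field `d/dt φ_t(x)` at `t = 0` of a deformation; note `φ 0 x = x`. -/
def initialVelocity (φ : ℝ → X → X) (x : X) : TangentSpace (𝓡 n) x :=
  (mfderiv 𝓘(ℝ, ℝ) (𝓡 n) (fun t => φ t x) 0 : ℝ → EuclideanSpace ℝ (Fin n)) (1 : ℝ)

variable [RiemannianBundle (fun x : X => TangentSpace (𝓡 n) x)]

/-- The Riemannian gradient of a function, the Riesz representative of its differential. -/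
def riemGrad (h : X → ℝ) (x : X) : TangentSpace (𝓡 n) x :=
  haveI : FiniteDimensional ℝ (TangentSpace (𝓡 n) x) :=
    inferInstanceAs (FiniteDimensional ℝ (EuclideanSpace ℝ (Fin n)))
  haveI : CompleteSpace (TangentSpace (𝓡 n) x) := FiniteDimensional.complete ℝ _
  (InnerProductSpace.toDual ℝ (TangentSpace (𝓡 n) x)).symm
    ((NormedSpace.fromTangentSpace (𝕜 := ℝ) (h x)).toContinuousLinearMap.comp
      (mfderiv (𝓡 n) 𝓘(ℝ, ℝ) h x))

variable [IsManifold (𝓡 n) ∞ X] [MeasurableSpace X]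

/-- `v` belongs to the tangent space at `μ`: the closure in `L²(μ)` of the gradients of compactly
supported smooth functions. -/
structure InWassersteinTangent (μ : Measure X) (v : ∀ x : X, TangentSpace (𝓡 n) x) : Prop where
  aemeasurable :
    @AEMeasurable X (TangentBundle (𝓡 n) X) (borel _) _ (fun x => ⟨x, v x⟩) μ
  approx : ∀ δ : ℝ≥0∞, 0 < δ → ∃ ψ : X → ℝ, ContMDiff (𝓡 n) 𝓘(ℝ, ℝ) ∞ ψ ∧
    HasCompactSupport ψ ∧ ∫⁻ x, ‖v x - riemGrad ψ x‖ₑ ^ 2 ∂μ < δ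

/-- `v` is the Wasserstein gradient of `F` at `μ`: a tangent vector at `μ` that represents in the
`L²(μ)` inner product the derivatives of `F` along deformations `t ↦ (φ_t)_# μ`. -/
structure IsWassersteinGradient (F : Measure X → ℝ) (μ : Measure X)
    (v : ∀ x : X, TangentSpace (𝓡 n) x) : Prop where
  tangent : InWassersteinTangent μ v
  hasDerivAt : ∀ φ : ℝ → X → X, IsDeformation (n := n) φ →
    HasDerivAt (fun t => F (μ.map (φ t)))
      (∫ x, inner ℝ (v x) (initialVelocity (n := n) φ x) ∂μ) 0

end Otto

end

/-! Everything about the potentials comes from one estimate on a Sinkhorn half step u ↦ -ε log ∫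
exp((u - c(·, y))/ε) dm. Perturbing u by d changes the value at y by -ε log of the mean of exp(d/ε)
under a Gibbs measure. The Gibbs measures at y and y' have densities comparable up to the factor
exp(2η/ε), where η bounds c(·, y) - c(·, y'). Concavity of the logarithm then gives that the two
changes differ by at most (1 - exp(-2η/ε)) osc d (`freeEnergy_osc_le`). With η bounded this is a
strict contraction of the oscillation, so the Sinkhorn iteration, normalised at a point, has a fixed
point; conservation of mass removes the leftover constant. With η = R d(y, y') the same estimate is
a Lipschitz bound on the change of the transform.

Duality has no gap: Donsker–Varadhan bounds every plan from below by every dual pair, and the plan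
with density exp((f + g - c)/ε) attains equality. The right Sinkhorn equation does not involve ρ, so
the exponential term of the dual equals 1 against every ρ'. Hence g is a subgradient of the entropic
cost at ρ. Exchanging ρ and ρ' bounds the remainder of the first-order expansion by ∫ (g' - g) d(ρ'
- ρ). If η is now the error that (f, g) makes in the Sinkhorn equation for ρ', then g' - g has
oscillation and Lipschitz constant O(η) (`IsSinkhornPair.exists_remainder`). On a segment η = O(s),
on a push-forward by maps at distance D it is O(D); in both cases the remainder is quadratic. So F_ε
has the same derivatives as the linear functional χ ↦ ∫ g ∘ T dχ. Dirac masses show that the first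
variation is determined up to a constant.

The potential g is locally Lipschitz because the cost is, so g ∘ T is locally Lipschitz in charts
and Rademacher makes it differentiable μ-almost everywhere. Dominated convergence then
differentiates ∫ g ∘ T ∘ φ_t dμ. The gradient is a limit of smooth gradients by a partition of unity
and mollification in charts: the derivative of a mollified Lipschitz function is the mollified
derivative, which converges almost everywhere and is bounded
(`LocallyLipschitzInCharts.gradApproximable`). -/

/-! ### Log-integral-exp functionals and contraction of oscillations -/

section FreeEnergy

variable {A : Type*} [MeasurableSpace A] {m : Measure A} {ε : ℝ}

/-- The free energy `-ε log ∫ exp (a / ε) dm`, a smoothed version of `-sup a`. -/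
noncomputable def freeEnergy (ε : ℝ) (m : Measure A) (a : A → ℝ) : ℝ :=
  -ε * Real.log (∫ x, Real.exp (a x / ε) ∂m)

theorem integral_exp_div_pos [NeZero m] {a : A → ℝ}
    (ha : Integrable (fun x => Real.exp (a x / ε)) m) : 0 < ∫ x, Real.exp (a x / ε) ∂m :=
  integral_exp_pos ha

theorem freeEnergy_congr {a b : A → ℝ} (h : a =ᵐ[m] b) : freeEnergy ε m a = freeEnergy ε m b := by
  unfold freeEnergy
  have : (fun x => Real.exp (a x / ε)) =ᵐ[m] fun x => Real.exp (b x / ε) :=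
    h.mono fun x hx => by simp only [hx]
  rw [integral_congr_ae this]

theorem freeEnergy_add_const [NeZero m] (hε : 0 < ε) {a : A → ℝ}
    (ha : Integrable (fun x => Real.exp (a x / ε)) m) (r : ℝ) :
    freeEnergy ε m (fun x => a x + r) = freeEnergy ε m a - r := by
  unfold freeEnergy
  have : ∀ x, Real.exp ((a x + r) / ε) = Real.exp (r / ε) * Real.exp (a x / ε) := fun x => by
    rw [← Real.exp_add]; ring_nf
  simp_rw [this]
  rw [integral_const_mul, Real.log_mul (Real.exp_pos _).ne' (integral_exp_div_pos ha).ne',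
    Real.log_exp]
  field_simp
  ring

theorem freeEnergy_le_add [NeZero m] (hε : 0 < ε) {a b : A → ℝ} {η : ℝ}
    (ha : Integrable (fun x => Real.exp (a x / ε)) m)
    (hb : Integrable (fun x => Real.exp (b x / ε)) m) (h : ∀ᵐ x ∂m, a x ≤ b x + η) :
    freeEnergy ε m b ≤ freeEnergy ε m a + η := by
  have hb' : Integrable (fun x => Real.exp ((b x + η) / ε)) m := by
    have : ∀ x, Real.exp ((b x + η) / ε) = Real.exp (η / ε) * Real.exp (b x / ε) := fun x => by
      rw [← Real.exp_add]; ring_nf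
    simp_rw [this]
    exact hb.const_mul _
  have key : freeEnergy ε m (fun x => b x + η) ≤ freeEnergy ε m a := by
    unfold freeEnergy
    have h1 : ∫ x, Real.exp (a x / ε) ∂m ≤ ∫ x, Real.exp ((b x + η) / ε) ∂m := by
      refine integral_mono_ae ha hb' (h.mono fun x hx => ?_)
      dsimp only
      gcongr
    have h2 := Real.log_le_log (integral_exp_div_pos ha) h1
    nlinarith
  rw [freeEnergy_add_const hε hb] at key
  linarith

theorem abs_freeEnergy_sub_le [NeZero m] (hε : 0 < ε) {a b : A → ℝ} {η : ℝ}
    (ha : Integrable (fun x => Real.exp (a x / ε)) m)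
    (hb : Integrable (fun x => Real.exp (b x / ε)) m) (h : ∀ᵐ x ∂m, |a x - b x| ≤ η) :
    |freeEnergy ε m a - freeEnergy ε m b| ≤ η := by
  rw [abs_le]
  constructor
  · have := freeEnergy_le_add hε ha hb (η := η)
      (h.mono fun x hx => by have := (abs_le.1 hx).2; linarith)
    linarith
  · have := freeEnergy_le_add hε hb ha (η := η)
      (h.mono fun x hx => by have := (abs_le.1 hx).1; linarith)
    linarith

/-- The free energy contracts oscillations: perturbing the exponents `p` and `p'`, which differ by
at most `η`, by a common function of oscillation at most `δ` changes the two free energies by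
amounts which differ by at most `(1 - exp (-2 η / ε)) δ`. -/
theorem freeEnergy_osc_le [IsProbabilityMeasure m] (hε : 0 < ε) {p p' d : A → ℝ} {η l δ : ℝ}
    (hp : Integrable (fun x => Real.exp (p x / ε)) m)
    (hp' : Integrable (fun x => Real.exp (p' x / ε)) m)
    (hpd : Integrable (fun x => Real.exp ((p x + d x) / ε)) m)
    (hpd' : Integrable (fun x => Real.exp ((p' x + d x) / ε)) m)
    (hη : ∀ᵐ x ∂m, |p x - p' x| ≤ η) (hd : ∀ᵐ x ∂m, l ≤ d x ∧ d x ≤ l + δ) :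
    (freeEnergy ε m (fun x => p x + d x) - freeEnergy ε m p)
      - (freeEnergy ε m (fun x => p' x + d x) - freeEnergy ε m p')
      ≤ (1 - Real.exp (-2 * η / ε)) * δ := by
  set q := Real.exp (-η / ε) with hq
  set a := Real.exp (l / ε) with ha
  set Z := ∫ x, Real.exp (p x / ε) ∂m with hZ
  set Z' := ∫ x, Real.exp (p' x / ε) ∂m with hZ'
  set W := ∫ x, Real.exp ((p x + d x) / ε) ∂m with hW
  set W' := ∫ x, Real.exp ((p' x + d x) / ε) ∂m with hW'
  have Zpos : 0 < Z := integral_exp_div_pos hp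
  have Zpos' : 0 < Z' := integral_exp_div_pos hp'
  have Wpos : 0 < W := integral_exp_pos hpd
  have Wpos' : 0 < W' := integral_exp_pos hpd'
  have apos : 0 < a := Real.exp_pos _
  have qpos : 0 < q := Real.exp_pos _
  have hκ : Real.exp (-2 * η / ε) = q ^ 2 := by
    rw [hq, sq, ← Real.exp_add]; congr 1; ring
  obtain ⟨x0, hx0⟩ := hη.exists
  have η0 : 0 ≤ η := (abs_nonneg _).trans hx0
  have q1 : q ≤ 1 := by
    rw [hq]; apply Real.exp_le_one_iff.2
    exact div_nonpos_of_nonpos_of_nonneg (by linarith) hε.le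
  -- Since d ≥ l, the integrand (exp(d/ε) - a) exp(p/ε) is nonnegative, so the pointwise comparison
  -- of exp(p/ε) with q exp(p'/ε) survives multiplication.
  have comp1 : q * (W' - a * Z') ≤ W - a * Z := by
    rw [hW, hW', hZ, hZ', ← integral_const_mul, ← integral_const_mul, ← integral_sub hpd' (hp'.const_mul _),
      ← integral_sub hpd (hp.const_mul _), ← integral_const_mul]
    refine integral_mono_ae ((hpd'.sub (hp'.const_mul _)).const_mul _)
      (hpd.sub (hp.const_mul _)) ?_
    filter_upwards [hη, hd] with x hx hdx
    have e1 : ∀ t, Real.exp ((t + d x) / ε) - a * Real.exp (t / ε)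
        = (Real.exp (d x / ε) - a) * Real.exp (t / ε) := fun t => by
      rw [sub_mul, add_div, Real.exp_add, mul_comm (Real.exp (t / ε)) (Real.exp (d x / ε))]
    simp only [e1]
    have h1 : a ≤ Real.exp (d x / ε) := by
      rw [ha]; have := hdx.1; gcongr
    have h2 : q * Real.exp (p' x / ε) ≤ Real.exp (p x / ε) := by
      rw [hq, ← Real.exp_add, ← add_div]
      have := (abs_le.1 hx).1
      gcongr; linarith
    nlinarith
  have comp2 : q * Z ≤ Z' := by
    rw [hZ, hZ', ← integral_const_mul]
    refine integral_mono_ae (hp.const_mul _) hp' ?_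
    filter_upwards [hη] with x hx
    rw [hq, ← Real.exp_add, ← add_div]
    have := (abs_le.1 hx).2
    gcongr; linarith
  have lo' : a * Z' ≤ W' := by
    rw [hW', hZ', ← integral_const_mul]
    refine integral_mono_ae (hp'.const_mul _) hpd' ?_
    filter_upwards [hd] with x hx
    rw [ha, ← Real.exp_add, ← add_div, add_comm]
    have := hx.1
    gcongr
  have hi' : W' ≤ a * Real.exp (δ / ε) * Z' := by
    rw [hW', hZ', ← integral_const_mul]
    refine integral_mono_ae hpd' (hp'.const_mul _) ?_
    filter_upwards [hd] with x hx
    rw [ha, ← Real.exp_add, ← Real.exp_add, ← add_div, ← add_div, add_comm]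
    have := hx.2
    gcongr
  -- W/Z and W'/Z' are the Gibbs means of exp(d/ε). One factor q comes from the numerators, the
  -- other from the normalisations; the left side is a convex combination, ready for concavity of
  -- log.
  have R : (1 - q ^ 2) * a + q ^ 2 * (W' / Z') ≤ W / Z := by
    have h1 : q ^ 2 * (W' / Z' - a) ≤ W / Z - a := by
      have : W / Z - a = (W - a * Z) / Z := by field_simp
      rw [this, le_div_iff₀ Zpos]
      have : W' / Z' - a = (W' - a * Z') / Z' := by field_simp
      rw [this]
      have h0 : 0 ≤ (W' - a * Z') / Z' := div_nonneg (by linarith) Zpos'.le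
      calc q ^ 2 * ((W' - a * Z') / Z') * Z = q * ((W' - a * Z') / Z') * (q * Z) := by ring
        _ ≤ q * ((W' - a * Z') / Z') * Z' := by gcongr
        _ = q * (W' - a * Z') := by field_simp
        _ ≤ _ := comp1
    linarith
  have hlog : (1 - q ^ 2) * Real.log a + q ^ 2 * Real.log (W' / Z') ≤ Real.log (W / Z) := by
    have hc := strictConcaveOn_log_Ioi.concaveOn.2 (mem_Ioi.2 apos)
      (mem_Ioi.2 (div_pos Wpos' Zpos')) (show 0 ≤ 1 - q ^ 2 by nlinarith)
      (show 0 ≤ q ^ 2 by positivity) (by ring)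
    simp only [smul_eq_mul] at hc
    refine hc.trans (Real.log_le_log ?_ R)
    have : 0 < q ^ 2 * (W' / Z') := by positivity
    have : 0 ≤ (1 - q ^ 2) * a := mul_nonneg (by nlinarith) apos.le
    linarith
  have hlog' : Real.log (W' / Z') - Real.log a ≤ δ / ε := by
    rw [← Real.log_div (div_pos Wpos' Zpos').ne' apos.ne', Real.log_le_iff_le_exp (by positivity),
      div_le_iff₀ apos, div_le_iff₀ Zpos']
    linarith
  have hfin : Real.log (W' / Z') - Real.log (W / Z) ≤ (1 - q ^ 2) * (δ / ε) := by
    have : (1 - q ^ 2) * (Real.log (W' / Z') - Real.log a) ≤ (1 - q ^ 2) * (δ / ε) :=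
      mul_le_mul_of_nonneg_left hlog' (by nlinarith)
    linarith
  rw [Real.log_div Wpos.ne' Zpos.ne', Real.log_div Wpos'.ne' Zpos'.ne'] at hfin
  rw [hκ]
  unfold freeEnergy
  have := mul_le_mul_of_nonneg_left hfin hε.le
  rw [show ε * ((1 - q ^ 2) * (δ / ε)) = (1 - q ^ 2) * δ by field_simp] at this
  linarith

/-- Only pairwise differences of d are controlled in the applications; the base level l is taken to
be the infimum of d over s. -/
theorem freeEnergy_osc_le_of_mem [IsProbabilityMeasure m] (hε : 0 < ε) {p p' d : A → ℝ} {η δ : ℝ}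
    {s : Set A} (hs : ∀ᵐ x ∂m, x ∈ s)
    (hp : Integrable (fun x => Real.exp (p x / ε)) m)
    (hp' : Integrable (fun x => Real.exp (p' x / ε)) m)
    (hpd : Integrable (fun x => Real.exp ((p x + d x) / ε)) m)
    (hpd' : Integrable (fun x => Real.exp ((p' x + d x) / ε)) m)
    (hη : ∀ x ∈ s, |p x - p' x| ≤ η) (hd : ∀ x ∈ s, ∀ y ∈ s, d x - d y ≤ δ) :
    (freeEnergy ε m (fun x => p x + d x) - freeEnergy ε m p)
      - (freeEnergy ε m (fun x => p' x + d x) - freeEnergy ε m p')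
      ≤ (1 - Real.exp (-2 * η / ε)) * δ := by
  obtain ⟨x0, hx0⟩ := hs.exists
  have hb : BddBelow (d '' s) := ⟨d x0 - δ, by
    rintro _ ⟨x, hx, rfl⟩
    have := hd x0 hx0 x hx
    linarith⟩
  refine freeEnergy_osc_le (l := sInf (d '' s)) hε hp hp' hpd hpd' (hs.mono hη)
    (hs.mono fun x hx => ⟨csInf_le hb (mem_image_of_mem _ hx), ?_⟩)
  have : d x - δ ≤ sInf (d '' s) := le_csInf ⟨_, mem_image_of_mem _ hx⟩ (by
    rintro _ ⟨y, hy, rfl⟩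
    have := hd x hx y hy
    linarith)
  linarith

end FreeEnergy

/-! ### The Sinkhorn fixed point on a compact space -/

section CompactSinkhorn

variable {K : Type*} [MetricSpace K] [CompactSpace K] [MeasurableSpace K] [BorelSpace K]
  {ε : ℝ}

theorem integrable_of_continuous_compactSpace (m : Measure K) [IsFiniteMeasure m] {a : K → ℝ}
    (ha : Continuous a) : Integrable a m :=
  ha.integrable_of_hasCompactSupport (HasCompactSupport.of_compactSpace a)

/-- The `c`-transform with entropic smoothing, on a compact space. -/
noncomputable def softTransform (ε : ℝ) (m : Measure K) [IsProbabilityMeasure m] (c : C(K × K, ℝ))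
    (u : C(K, ℝ)) : C(K, ℝ) where
  toFun y := freeEnergy ε m (fun x => u x - c (x, y))
  continuous_toFun := by
    have h1 : Continuous fun y => ∫ x in univ, Real.exp ((u x - c (x, y)) / ε) ∂m := by
      apply continuous_parametric_integral_of_continuous (X := K) _ isCompact_univ
      unfold Function.uncurry
      fun_prop
    simp only [Measure.restrict_univ] at h1
    refine continuous_const.mul (h1.log fun y => ?_)
    refine (integral_exp_pos ?_).ne'
    exact integrable_of_continuous_compactSpace m (by fun_prop)

/-- The exponents at y and y' differ only through the cost, so the contraction factor does not
depend on u. -/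
theorem softTransform_osc_le (hε : 0 < ε) (m : Measure K) [IsProbabilityMeasure m] (c : C(K × K, ℝ))
    {B : ℝ} (hB : ∀ x y y', |c (x, y) - c (x, y')| ≤ B) (u u' : C(K, ℝ)) {δ : ℝ}
    (hδ : ∀ x y, (u' x - u x) - (u' y - u y) ≤ δ) (y y' : K) :
    (softTransform ε m c u' y - softTransform ε m c u y)
      - (softTransform ε m c u' y' - softTransform ε m c u y') ≤
        (1 - Real.exp (-2 * B / ε)) * δ := by
  have h := freeEnergy_osc_le_of_mem (m := m) hε (p := fun x => u x - c (x, y))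
    (p' := fun x => u x - c (x, y')) (d := fun x => u' x - u x) (η := B) (δ := δ) (s := univ)
    (by simp)
    (integrable_of_continuous_compactSpace m (by fun_prop))
    (integrable_of_continuous_compactSpace m (by fun_prop))
    (integrable_of_continuous_compactSpace m (by fun_prop))
    (integrable_of_continuous_compactSpace m (by fun_prop))
    (fun x _ => by
      rw [show u x - c (x, y) - (u x - c (x, y')) = c (x, y') - c (x, y) by ring]
      exact hB x y' y) (fun x _ y _ => hδ x y)
  have e : ∀ z, (fun x => u x - c (x, z) + (u' x - u x)) = fun x => u' x - c (x, z) :=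
    fun z => funext fun x => by ring
  simp only [e] at h
  exact h

/-- The free energy is the normalising constant of the Gibbs density; this is the source of all the
marginal identities below. -/
theorem integral_exp_add_freeEnergy {A : Type*} [MeasurableSpace A] {m : Measure A} [NeZero m]
    (hε : 0 < ε) {a : A → ℝ}
    (ha : Integrable (fun x => Real.exp (a x / ε)) m) :
    ∫ x, Real.exp ((a x + freeEnergy ε m a) / ε) ∂m = 1 := by
  have hpos := integral_exp_div_pos ha
  have : ∀ x, Real.exp ((a x + freeEnergy ε m a) / ε)
      = (∫ x, Real.exp (a x / ε) ∂m)⁻¹ * Real.exp (a x / ε) := fun x => by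
    rw [freeEnergy, add_div, Real.exp_add, mul_comm]
    congr 1
    rw [show -ε * Real.log (∫ x, Real.exp (a x / ε) ∂m) / ε
      = -Real.log (∫ x, Real.exp (a x / ε) ∂m) by field_simp, Real.exp_neg, Real.exp_log hpos]
  simp_rw [this]
  rw [integral_const_mul, inv_mul_cancel₀ hpos.ne']

/-- A full iteration contracts oscillations but commutes with adding constants, so the value at a
base point is subtracted. For functions vanishing there, the oscillation bounds the sup norm, and
Banach's theorem applies to a high iterate. -/
theorem exists_softTransform_fixedPoint (hε : 0 < ε) [Nonempty K] (ν ρ : Measure K)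
    [IsProbabilityMeasure ν] [IsProbabilityMeasure ρ] (c c' : C(K × K, ℝ)) :
    ∃ (u : C(K, ℝ)) (a : ℝ), ∀ x,
      softTransform ε ρ c' (softTransform ε ν c u) x = u x + a := by
  obtain ⟨B, hB⟩ : ∃ B, ∀ z, ‖c z‖ ≤ B := ⟨‖c‖, c.norm_coe_le_norm⟩
  obtain ⟨B', hB'⟩ : ∃ B, ∀ z, ‖c' z‖ ≤ B := ⟨‖c'‖, c'.norm_coe_le_norm⟩
  simp only [Real.norm_eq_abs, abs_le] at hB hB'
  set x0 : K := Classical.arbitrary K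
  set lam : ℝ := 1 - Real.exp (-2 * (2 * B) / ε) with hlam
  have hB0 : 0 ≤ B := by have := hB (x0, x0); linarith
  have hB0' : 0 ≤ B' := by have := hB' (x0, x0); linarith
  have lam1 : lam < 1 := by have := Real.exp_pos (-2 * (2 * B) / ε); linarith
  have lam0 : 0 ≤ lam := by
    have : Real.exp (-2 * (2 * B) / ε) ≤ 1 := Real.exp_le_one_iff.2
      (div_nonpos_of_nonpos_of_nonneg (by linarith) hε.le)
    linarith
  set S : C(K, ℝ) → C(K, ℝ) := fun u => softTransform ε ρ c' (softTransform ε ν c u) with hS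
  set N : C(K, ℝ) → C(K, ℝ) := fun u => S u - ContinuousMap.const K (S u x0) with hN
  have hNapply : ∀ u x, N u x = S u x - S u x0 := fun u x => rfl
  have osc1 : ∀ (u u' : C(K, ℝ)) (δ : ℝ), 0 ≤ δ → (∀ x y, (u' x - u x) - (u' y - u y) ≤ δ) →
      ∀ x y, (N u' x - N u x) - (N u' y - N u y) ≤ lam * δ := by
    intro u u' δ hδ0 hδ x y
    have h1 := softTransform_osc_le hε ν c (B := 2 * B) (fun x y y' => by
      rw [abs_le]
      constructor <;> linarith [(hB (x, y)).1, (hB (x, y)).2, (hB (x, y')).1, (hB (x, y')).2])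
      u u' hδ
    have h2 := softTransform_osc_le hε ρ c' (B := 2 * B') (fun x y y' => by
      rw [abs_le]
      constructor <;>
        linarith [(hB' (x, y)).1, (hB' (x, y)).2, (hB' (x, y')).1, (hB' (x, y')).2])
      (softTransform ε ν c u) (softTransform ε ν c u') h1 x y
    -- One strict half step suffices; the other need only be nonexpansive.
    have h3 : (1 - Real.exp (-2 * (2 * B') / ε)) * (lam * δ) ≤ lam * δ := by
      have := Real.exp_pos (-2 * (2 * B') / ε)
      have : 0 ≤ lam * δ := by positivity
      nlinarith
    simp only [hNapply]
    linarith
  have oscn : ∀ (n : ℕ) (u u' : C(K, ℝ)) (x y : K),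
      ((N^[n] u') x - (N^[n] u) x) - ((N^[n] u') y - (N^[n] u) y) ≤ lam ^ n * (2 * dist u' u) := by
    intro n
    induction n with
    | zero =>
      intro u u' x y
      have hx := abs_le.1 (Real.dist_eq (u' x) (u x) ▸ ContinuousMap.dist_apply_le_dist (f := u') (g := u) x)
      have hy := abs_le.1 (Real.dist_eq (u' y) (u y) ▸ ContinuousMap.dist_apply_le_dist (f := u') (g := u) y)
      simp only [Function.iterate_zero, id_eq, pow_zero, one_mul]
      linarith [hx.2, hy.1]
    | succ n ih =>
      intro u u' x y
      rw [Function.iterate_succ_apply', Function.iterate_succ_apply', pow_succ', mul_assoc]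
      exact osc1 _ _ _ (by positivity) (ih u u') x y
  obtain ⟨n, hn⟩ : ∃ n : ℕ, lam ^ n * 2 < 1 := by
    obtain ⟨n, hn⟩ := exists_pow_lt_of_lt_one (show (0 : ℝ) < 1 / 2 by norm_num) lam1
    exact ⟨n, by linarith⟩
  -- The exponent is n + 1 because at least one application of N is needed for the value at x0 to be
  -- zero. The factor 2 bounds the oscillation of u' - u by the sup distance.
  have hlip : ∀ u u', dist (N^[n + 1] u) (N^[n + 1] u') ≤ (lam ^ n * 2) * dist u u' := by
    intro u u'
    rw [ContinuousMap.dist_le (by positivity)]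
    intro x
    have z : ∀ u, (N^[n + 1] u) x0 = 0 := fun u => by
      rw [Function.iterate_succ_apply', hNapply, sub_self]
    have le1 : lam ^ (n + 1) * (2 * dist u u') ≤ lam ^ n * 2 * dist u u' := by
      have h0 : 0 ≤ lam ^ n * 2 * dist u u' := by positivity
      have : lam * (lam ^ n * 2 * dist u u') ≤ lam ^ n * 2 * dist u u' :=
        mul_le_of_le_one_left h0 lam1.le
      linarith [show lam ^ (n + 1) * (2 * dist u u') = lam * (lam ^ n * 2 * dist u u') by ring]
    have h1 := oscn (n + 1) u u' x x0
    have h2 := oscn (n + 1) u' u x x0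
    rw [z, z, dist_comm] at h1
    rw [z, z] at h2
    rw [Real.dist_eq, abs_le]
    constructor <;> linarith
  obtain ⟨q, hq⟩ : ∃ q : NNReal, (q : ℝ) = lam ^ n * 2 :=
    ⟨Real.toNNReal _, Real.coe_toNNReal _ (by positivity)⟩
  simp only [← hq] at hn hlip
  have hC : ContractingWith q N^[n + 1] :=
    ⟨by exact_mod_cast hn, LipschitzWith.of_dist_le_mul hlip⟩
  have hfix := hC.isFixedPt_fixedPoint_iterate
  refine ⟨hC.fixedPoint N^[n + 1], S (hC.fixedPoint N^[n + 1]) x0, fun x => ?_⟩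
  have := congrArg (fun w : C(K, ℝ) => w x) hfix.eq
  simp only [hNapply] at this
  linarith

/-- Existence of Sinkhorn potentials on a compact space. -/
theorem exists_softTransform_pair (hε : 0 < ε) [Nonempty K] (ν ρ : Measure K)
    [IsProbabilityMeasure ν] [IsProbabilityMeasure ρ] (c c' : C(K × K, ℝ))
    (hc : ∀ x y, c' (y, x) = c (x, y)) :
    ∃ f g : C(K, ℝ), softTransform ε ρ c' g = f ∧ softTransform ε ν c f = g := by
  obtain ⟨u, a, hu⟩ := exists_softTransform_fixedPoint hε ν ρ c c'
  set g := softTransform ε ν c u with hg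
  have h1 : ∀ y, ∫ x, Real.exp ((u x - c (x, y) + g y) / ε) ∂ν = 1 := fun y =>
    integral_exp_add_freeEnergy hε (integrable_of_continuous_compactSpace ν (by fun_prop))
  have h2 : ∀ x, ∫ y, Real.exp ((u x - c (x, y) + g y) / ε) ∂ρ = Real.exp (-a / ε) := fun x => by
    have h := integral_exp_add_freeEnergy (m := ρ) hε (a := fun y => g y - c' (y, x))
      (integrable_of_continuous_compactSpace ρ (by fun_prop))
    have e : freeEnergy ε ρ (fun y => g y - c' (y, x)) = u x + a := hu x
    rw [e] at h
    have e2 : ∀ y, Real.exp ((u x - c (x, y) + g y) / ε)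
        = Real.exp (-a / ε) * Real.exp ((g y - c' (y, x) + (u x + a)) / ε) := fun y => by
      rw [← Real.exp_add, hc]; ring_nf
    simp_rw [e2]
    rw [integral_const_mul, h, mul_one]
  -- The total mass of the same density is 1 in one order of integration and exp(-a/ε) in the other,
  -- so a = 0.
  have h3 := integral_integral_swap (μ := ν) (ν := ρ)
    (f := fun x y => Real.exp ((u x - c (x, y) + g y) / ε))
    (Continuous.integrable_of_hasCompactSupport (by unfold Function.uncurry; fun_prop)
      (HasCompactSupport.of_compactSpace _))
  simp only [h1, h2, integral_const, probReal_univ, smul_eq_mul, mul_one, one_mul] at h3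
  have ha : a = 0 := by
    rw [Real.exp_eq_one_iff] at h3
    have := div_eq_zero_iff.1 h3
    rcases this with h | h <;> linarith
  refine ⟨u, g, ?_, rfl⟩
  ext x
  rw [hu, ha, add_zero]

end CompactSinkhorn

/-! ### Compactly carried measures and the quadratic cost -/

theorem Continuous.integrable_of_compl_null {Z : Type*} [TopologicalSpace Z] [T2Space Z]
    [MeasurableSpace Z] [OpensMeasurableSpace Z] {m : Measure Z} [IsFiniteMeasure m]
    {K : Set Z} (hK : IsCompact K) (hm : m Kᶜ = 0) {a : Z → ℝ} (ha : Continuous a) :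
    Integrable a m := by
  have h := ha.continuousOn.integrableOn_compact (μ := m) hK
  rwa [IntegrableOn, Measure.restrict_eq_self_of_ae_mem (mem_ae_iff.2 hm)] at h

section QuadCost

variable {Y : Type*} [MetricSpace Y]

theorem continuous_quadCost : Continuous fun p : Y × Y => quadCost p.1 p.2 := by
  unfold quadCost; fun_prop

@[fun_prop]
theorem Continuous.quadCost {Z : Type*} [TopologicalSpace Z] {a b : Z → Y} (ha : Continuous a)
    (hb : Continuous b) : Continuous fun z => quadCost (a z) (b z) :=
  continuous_quadCost.comp (ha.prodMk hb)

theorem quadCost_comm (x y : Y) : quadCost x y = quadCost y x := by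
  rw [quadCost, quadCost, dist_comm]

theorem abs_quadCost_sub_le {x y y' : Y} {R : ℝ} (h : dist x y ≤ R) (h' : dist x y' ≤ R) :
    |quadCost x y - quadCost x y'| ≤ R * dist y y' := by
  have h1 : |dist x y - dist x y'| ≤ dist y y' := by
    have := abs_dist_sub_le y y' x
    rwa [dist_comm y x, dist_comm y' x] at this
  have e : quadCost x y - quadCost x y' = (dist x y - dist x y') * ((dist x y + dist x y') / 2) := by
    unfold quadCost; ring
  rw [e, abs_mul, mul_comm]
  have h2 : |(dist x y + dist x y') / 2| ≤ R := by
    rw [abs_of_nonneg (by positivity)]; linarith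
  have := abs_nonneg ((dist x y + dist x y') / 2)
  gcongr
  linarith

theorem exists_osc_attained {K : Set Y} (hK : IsCompact K) (hne : K.Nonempty) {d : Y → ℝ} (hd : Continuous d) :
    ∃ x₁ ∈ K, ∃ x₂ ∈ K, ∀ x ∈ K, ∀ y ∈ K, d x - d y ≤ d x₁ - d x₂ := by
  obtain ⟨x₁, h₁, hx₁⟩ := hK.exists_isMaxOn hne hd.continuousOn
  obtain ⟨x₂, h₂, hx₂⟩ := hK.exists_isMinOn hne hd.continuousOn
  exact ⟨x₁, h₁, x₂, h₂, fun x hx y hy => sub_le_sub (hx₁ hx) (hx₂ hy)⟩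

theorem exists_dist_le {K : Set Y} (hK : IsCompact K) :
    ∃ R, 0 ≤ R ∧ ∀ x ∈ K, ∀ y ∈ K, dist x y ≤ R :=
  ⟨Metric.diam K, Metric.diam_nonneg, fun _ hx _ hy => Metric.dist_le_diam_of_mem hK.isBounded hx hy⟩

theorem nonempty_of_compl_null {Z : Type*} [MeasurableSpace Z] {m : Measure Z} {K : Set Z}
    [IsProbabilityMeasure m] (hm : m Kᶜ = 0) : K.Nonempty := by
  by_contra h
  rw [not_nonempty_iff_eq_empty] at h
  simp [h] at hm

end QuadCost

/-! ### Sinkhorn potentials on the whole space: existence, regularity, stability -/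

section SinkhornTransform

variable {Y : Type*} [MetricSpace Y] [MeasurableSpace Y]

/-- One half of a Sinkhorn iteration. -/
noncomputable def sinkhornTransform (ε : ℝ) (m : Measure Y) (u : Y → ℝ) (y : Y) : ℝ :=
  freeEnergy ε m (fun x => u x - quadCost x y)

variable {ε : ℝ} {K : Set Y} {m : Measure Y}

theorem IsSinkhornPair.eq_transform_left {ν ρ : Measure Y} {f g : Y → ℝ}
    (h : IsSinkhornPair ε ν ρ f g) : f = sinkhornTransform ε ρ g := by
  funext x
  rw [h.left_eq x, sinkhornTransform, freeEnergy]
  simp only [quadCost_comm]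

theorem IsSinkhornPair.eq_transform_right {ν ρ : Measure Y} {f g : Y → ℝ}
    (h : IsSinkhornPair ε ν ρ f g) : g = sinkhornTransform ε ν f := by
  funext y
  rw [h.right_eq y, sinkhornTransform, freeEnergy]

variable [BorelSpace Y]

theorem integrable_exp_sub_quadCost [IsFiniteMeasure m] (hK : IsCompact K) (hm : m Kᶜ = 0)
    {u : Y → ℝ} (hu : Continuous u) (y : Y) :
    Integrable (fun x => Real.exp ((u x - quadCost x y) / ε)) m :=
  Continuous.integrable_of_compl_null hK hm (by fun_prop)

theorem sinkhornTransform_add_const [IsProbabilityMeasure m] (hε : 0 < ε) (hK : IsCompact K)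
    (hm : m Kᶜ = 0) {u u' : Y → ℝ} (hu : Continuous u) {r : ℝ} (h : ∀ x ∈ K, u' x = u x + r)
    (y : Y) : sinkhornTransform ε m u' y = sinkhornTransform ε m u y - r := by
  rw [sinkhornTransform, sinkhornTransform,
    ← freeEnergy_add_const hε (integrable_exp_sub_quadCost hK hm hu y)]
  refine freeEnergy_congr ?_
  filter_upwards [mem_ae_iff.2 hm] with x hx
  rw [h x hx]; ring

theorem abs_sinkhornTransform_sub_le [IsProbabilityMeasure m] (hε : 0 < ε) (hK : IsCompact K)
    (hm : m Kᶜ = 0) {u : Y → ℝ} (hu : Continuous u) {y y' : Y} {R : ℝ}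
    (hy : ∀ x ∈ K, dist x y ≤ R) (hy' : ∀ x ∈ K, dist x y' ≤ R) :
    |sinkhornTransform ε m u y - sinkhornTransform ε m u y'| ≤ R * dist y y' := by
  refine abs_freeEnergy_sub_le hε (integrable_exp_sub_quadCost hK hm hu y)
    (integrable_exp_sub_quadCost hK hm hu y') ?_
  filter_upwards [mem_ae_iff.2 hm] with x hx
  rw [show u x - quadCost x y - (u x - quadCost x y') = quadCost x y' - quadCost x y by ring,
    dist_comm]
  exact abs_quadCost_sub_le (hy' x hx) (hy x hx)

/-- The regularity is inherited from the cost alone, whatever the continuous u: points of a unit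
ball stay at bounded distance from K, and the free energy is 1-Lipschitz in the sup norm. -/
theorem locallyLipschitz_sinkhornTransform [IsProbabilityMeasure m] (hε : 0 < ε) (hK : IsCompact K)
    (hm : m Kᶜ = 0) {u : Y → ℝ} (hu : Continuous u) :
    LocallyLipschitz (sinkhornTransform ε m u) := by
  intro y0
  obtain ⟨R, hR⟩ := hK.isBounded.subset_closedBall y0
  refine ⟨Real.toNNReal (R + 1), Metric.ball y0 1, Metric.ball_mem_nhds y0 one_pos,
    LipschitzOnWith.of_dist_le_mul fun y hy y' hy' => ?_⟩
  have key : ∀ y ∈ Metric.ball y0 1, ∀ x ∈ K, dist x y ≤ R + 1 := fun y hy x hx => by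
    have h1 := Metric.mem_closedBall.1 (hR hx)
    have h2 := Metric.mem_ball'.1 hy
    linarith [dist_triangle x y0 y]
  rw [Real.dist_eq]
  refine (abs_sinkhornTransform_sub_le hε hK hm hu (key y hy) (key y' hy')).trans ?_
  gcongr
  exact Real.le_coe_toNNReal _

theorem continuous_sinkhornTransform [IsProbabilityMeasure m] (hε : 0 < ε) (hK : IsCompact K)
    (hm : m Kᶜ = 0) {u : Y → ℝ} (hu : Continuous u) : Continuous (sinkhornTransform ε m u) :=
  (locallyLipschitz_sinkhornTransform hε hK hm hu).continuous

/-- The equations are solved on K with the measures pulled back to the subtype, then continued to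
the whole space by the transforms themselves. -/
theorem exists_isSinkhornPair_of_compl_null (hε : 0 < ε) (hK : IsCompact K) (ν ρ : Measure Y)
    [IsProbabilityMeasure ν] [IsProbabilityMeasure ρ] (hν : ν Kᶜ = 0) (hρ : ρ Kᶜ = 0) :
    ∃ f g, IsSinkhornPair ε ν ρ f g := by
  have hKm : MeasurableSet K := hK.isClosed.measurableSet
  have hne : K.Nonempty := by
    by_contra h
    rw [not_nonempty_iff_eq_empty] at h
    simp [h] at hν
  have : Nonempty K := hne.to_subtype
  have : CompactSpace K := isCompact_iff_compactSpace.1 hK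
  have prob : ∀ m : Measure Y, IsProbabilityMeasure m → m Kᶜ = 0 →
      IsProbabilityMeasure (m.comap ((↑) : K → Y)) := fun m _ hm => ⟨by
    rw [(MeasurableEmbedding.subtype_coe hKm).comap_apply, image_univ, Subtype.range_coe,
      (prob_compl_eq_zero_iff hKm).1 hm]⟩
  have := prob ν ‹_› hν
  have := prob ρ ‹_› hρ
  have hint : ∀ (m : Measure Y), m Kᶜ = 0 → ∀ (F : Y → ℝ),
      ∫ x : K, F x ∂(m.comap ((↑) : K → Y)) = ∫ x, F x ∂m := fun m hm F => by
    rw [integral_subtype_comap hKm, Measure.restrict_eq_self_of_ae_mem (mem_ae_iff.2 hm)]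
  set c : C(K × K, ℝ) := ⟨fun p => quadCost (p.1 : Y) p.2, by fun_prop⟩ with hc
  obtain ⟨f₀, g₀, hf, hg⟩ := exists_softTransform_pair hε (ν.comap ((↑) : K → Y))
    (ρ.comap ((↑) : K → Y)) c c (fun x y => quadCost_comm _ _)
  -- The Tietze extensions are auxiliary and solve the equations only on K. One more transform gives
  -- functions that solve them everywhere, since a transform sees its argument only on K.
  obtain ⟨F, hF⟩ := ContinuousMap.exists_restrict_eq hK.isClosed f₀
  obtain ⟨G, hG⟩ := ContinuousMap.exists_restrict_eq hK.isClosed g₀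
  have hF' : ∀ x : K, f₀ x = F x := fun x => by rw [← hF]; rfl
  have hG' : ∀ x : K, g₀ x = G x := fun x => by rw [← hG]; rfl
  have eF : ∀ x ∈ K, F x = sinkhornTransform ε ρ G x := fun x hx => by
    rw [← hF' ⟨x, hx⟩, ← hf]
    change -ε * Real.log _ = -ε * Real.log _
    rw [← hint ρ hρ]
    simp only [hG', hc, ContinuousMap.coe_mk]
  have eG : ∀ x ∈ K, G x = sinkhornTransform ε ν F x := fun x hx => by
    rw [← hG' ⟨x, hx⟩, ← hg]
    change -ε * Real.log _ = -ε * Real.log _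
    rw [← hint ν hν]
    simp only [hF', hc, ContinuousMap.coe_mk]
  have e1 := fun y => sinkhornTransform_add_const hε hK hρ G.continuous (r := 0)
    (u' := sinkhornTransform ε ν F) (fun x hx => by rw [eG x hx, add_zero]) y
  have e2 := fun y => sinkhornTransform_add_const hε hK hν F.continuous (r := 0)
    (u' := sinkhornTransform ε ρ G) (fun x hx => by rw [eF x hx, add_zero]) y
  refine ⟨sinkhornTransform ε ρ G, sinkhornTransform ε ν F,
    continuous_sinkhornTransform hε hK hρ G.continuous,
    continuous_sinkhornTransform hε hK hν F.continuous, fun x => ?_, fun y => ?_⟩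
  · rw [← sub_zero (sinkhornTransform ε ρ G x), ← e1 x, sinkhornTransform, freeEnergy]
    simp only [quadCost_comm]
  · rw [← sub_zero (sinkhornTransform ε ν F y), ← e2 y, sinkhornTransform, freeEnergy]

/-- Keeping the distance of y and y' in the factor serves two purposes: bounding it by R gives a
uniform contraction, and 1 - exp(-t) ≤ t gives a Lipschitz estimate. -/
theorem sinkhornTransform_osc_le [IsProbabilityMeasure m] (hε : 0 < ε) (hK : IsCompact K)
    (hm : m Kᶜ = 0) {R : ℝ} (hR : ∀ x ∈ K, ∀ y ∈ K, dist x y ≤ R)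
    {u u' : Y → ℝ} (hu : Continuous u) (hu' : Continuous u') {δ : ℝ}
    (hδ : ∀ x ∈ K, ∀ y ∈ K, (u' x - u x) - (u' y - u y) ≤ δ) {y y' : Y} (hy : y ∈ K)
    (hy' : y' ∈ K) :
    (sinkhornTransform ε m u' y - sinkhornTransform ε m u y)
      - (sinkhornTransform ε m u' y' - sinkhornTransform ε m u y')
      ≤ (1 - Real.exp (-2 * (R * dist y y') / ε)) * δ := by
  have e : ∀ z, (fun x => u x - quadCost x z + (u' x - u x)) = fun x => u' x - quadCost x z :=
    fun z => funext fun x => by ring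
  have h := freeEnergy_osc_le_of_mem (m := m) hε (p := fun x => u x - quadCost x y)
    (p' := fun x => u x - quadCost x y') (d := fun x => u' x - u x) (η := R * dist y y') (δ := δ)
    (s := K) (mem_ae_iff.2 hm)
    (Continuous.integrable_of_compl_null hK hm (by fun_prop))
    (Continuous.integrable_of_compl_null hK hm (by fun_prop))
    (Continuous.integrable_of_compl_null hK hm (by fun_prop))
    (Continuous.integrable_of_compl_null hK hm (by fun_prop))
    (fun x hx => by
      rw [show u x - quadCost x y - (u x - quadCost x y') = quadCost x y' - quadCost x y by ring,
        dist_comm]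
      exact abs_quadCost_sub_le (hR x hx y' hy') (hR x hx y hy)) hδ
  simp only [e] at h
  exact h

theorem sinkhornTransform_osc_le_contract [IsProbabilityMeasure m] (hε : 0 < ε)
    (hK : IsCompact K) (hm : m Kᶜ = 0) {R : ℝ} (hR : ∀ x ∈ K, ∀ y ∈ K, dist x y ≤ R)
    {u u' : Y → ℝ} (hu : Continuous u) (hu' : Continuous u') {δ : ℝ} (hδ0 : 0 ≤ δ)
    (hδ : ∀ x ∈ K, ∀ y ∈ K, (u' x - u x) - (u' y - u y) ≤ δ) {y y' : Y} (hy : y ∈ K)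
    (hy' : y' ∈ K) :
    (sinkhornTransform ε m u' y - sinkhornTransform ε m u y)
      - (sinkhornTransform ε m u' y' - sinkhornTransform ε m u y')
      ≤ (1 - Real.exp (-2 * (R * R) / ε)) * δ := by
  refine (sinkhornTransform_osc_le hε hK hm hR hu hu' hδ hy hy').trans ?_
  have hR0 : 0 ≤ R := dist_nonneg.trans (hR y hy y' hy')
  have := hR y hy y' hy'
  refine mul_le_mul_of_nonneg_right (sub_le_sub_left (Real.exp_le_exp.2 ?_) _) hδ0
  gcongr ?_ / ε
  nlinarith

theorem sinkhornTransform_osc_le_dist [IsProbabilityMeasure m] (hε : 0 < ε)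
    (hK : IsCompact K) (hm : m Kᶜ = 0) {R : ℝ} (hR : ∀ x ∈ K, ∀ y ∈ K, dist x y ≤ R)
    {u u' : Y → ℝ} (hu : Continuous u) (hu' : Continuous u') {δ : ℝ} (hδ0 : 0 ≤ δ)
    (hδ : ∀ x ∈ K, ∀ y ∈ K, (u' x - u x) - (u' y - u y) ≤ δ) {y y' : Y} (hy : y ∈ K)
    (hy' : y' ∈ K) :
    (sinkhornTransform ε m u' y - sinkhornTransform ε m u y)
      - (sinkhornTransform ε m u' y' - sinkhornTransform ε m u y')
      ≤ 2 * R / ε * δ * dist y y' := by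
  refine (sinkhornTransform_osc_le hε hK hm hR hu hu' hδ hy hy').trans ?_
  have h := Real.add_one_le_exp (-2 * (R * dist y y') / ε)
  have : 1 - Real.exp (-2 * (R * dist y y') / ε) ≤ 2 * R / ε * dist y y' := by
    have e : -2 * (R * dist y y') / ε = -(2 * R / ε * dist y y') := by ring
    linarith
  calc _ ≤ 2 * R / ε * dist y y' * δ := mul_le_mul_of_nonneg_right this hδ0
    _ = _ := by ring

/-- The oscillation of the difference of the left potentials of two Sinkhorn pairs from the same
`ν` is controlled by the error which one of them makes in the Sinkhorn equation of the other. -/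
theorem IsSinkhornPair.osc_sub_le (hε : 0 < ε) (hK : IsCompact K) {ν ρ ρ' : Measure Y}
    [IsProbabilityMeasure ν] [IsProbabilityMeasure ρ'] (hν : ν Kᶜ = 0)
    (hρ' : ρ' Kᶜ = 0) {R : ℝ} (hR : ∀ x ∈ K, ∀ y ∈ K, dist x y ≤ R) {f g f' g' : Y → ℝ}
    (h : IsSinkhornPair ε ν ρ f g) (h' : IsSinkhornPair ε ν ρ' f' g') {β : ℝ}
    (hβ : ∀ x ∈ K, ∀ y ∈ K, (sinkhornTransform ε ρ' g x - f x)
      - (sinkhornTransform ε ρ' g y - f y) ≤ β) :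
    ∀ x ∈ K, ∀ y ∈ K, (f' x - f x) - (f' y - f y) ≤ Real.exp (2 * (R * R) / ε) * β := by
  obtain ⟨x₁, h₁, x₂, h₂, hmax⟩ := exists_osc_attained hK (nonempty_of_compl_null hν)
    (h'.continuous_left.sub h.continuous_left)
  simp only [Pi.sub_apply] at hmax
  set δ := (f' x₁ - f x₁) - (f' x₂ - f x₂) with hδ
  have δ0 : 0 ≤ δ := by have := hmax x₁ h₁ x₁ h₁; linarith
  set κ := Real.exp (-2 * (R * R) / ε) with hκ
  have κpos : 0 < κ := Real.exp_pos _
  have κ1 : κ ≤ 1 := Real.exp_le_one_iff.2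
    (div_nonpos_of_nonpos_of_nonneg (by nlinarith [mul_self_nonneg R]) hε.le)
  -- Both right potentials are transforms for the same ν, so this half step loses nothing.
  have hg : ∀ x ∈ K, ∀ y ∈ K, (g' x - g x) - (g' y - g y) ≤ δ := fun x hx y hy => by
    have := sinkhornTransform_osc_le_contract hε hK hν hR h.continuous_left h'.continuous_left δ0
      hmax hx hy
    rw [← h.eq_transform_right, ← h'.eq_transform_right] at this
    nlinarith
  have hf := sinkhornTransform_osc_le_contract hε hK hρ' hR h.continuous_right h'.continuous_right
      δ0 hg h₁ h₂
  rw [← h'.eq_transform_left] at hf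
  have hb := hβ x₁ h₁ x₂ h₂
  -- The maximal oscillation satisfies δ ≤ (1 - κ) δ + β: contraction of the ρ'-step plus the error
  -- of f in the equation for ρ'.
  have key : κ * δ ≤ β := by linarith
  have e : Real.exp (2 * (R * R) / ε) = κ⁻¹ := by
    rw [hκ, ← Real.exp_neg]; congr 1; ring
  intro x hx y hy
  rw [e]
  refine (hmax x hx y hy).trans ?_
  rw [inv_mul_eq_div, le_div_iff₀ κpos]
  linarith

/-- Sinkhorn potentials are unique up to an additive constant. -/
theorem IsSinkhornPair.unique (hε : 0 < ε) (hK : IsCompact K) {ν ρ : Measure Y}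
    [IsProbabilityMeasure ν] [IsProbabilityMeasure ρ] (hν : ν Kᶜ = 0)
    (hρ : ρ Kᶜ = 0) {f g f' g' : Y → ℝ}
    (h : IsSinkhornPair ε ν ρ f g) (h' : IsSinkhornPair ε ν ρ f' g') :
    ∃ a : ℝ, (∀ y, f' y = f y + a) ∧ ∀ y, g' y = g y - a := by
  obtain ⟨R, -, hR⟩ := exists_dist_le hK
  -- With the same ρ there is no error, so f' - f is constant on K; the transforms carry this to all
  -- of Y.
  have hosc := h.osc_sub_le hε hK hν hρ hR h' (β := 0) (fun x _ y _ => by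
    rw [← h.eq_transform_left]; simp)
  obtain ⟨x₀, hx₀⟩ := nonempty_of_compl_null hν
  have e : ∀ x ∈ K, f' x = f x + (f' x₀ - f x₀) := fun x hx => by
    have h1 := hosc x hx x₀ hx₀
    have h2 := hosc x₀ hx₀ x hx
    linarith
  have eg : ∀ y, g' y = g y - (f' x₀ - f x₀) := fun y => by
    rw [h'.eq_transform_right, h.eq_transform_right]
    exact sinkhornTransform_add_const hε hK hν h.continuous_left e y
  refine ⟨f' x₀ - f x₀, fun y => ?_, eg⟩
  rw [h'.eq_transform_left, sinkhornTransform_add_const hε hK hρ h.continuous_right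
    (r := -(f' x₀ - f x₀)) (fun x _ => by rw [eg, sub_eq_add_neg]), sub_neg_eq_add]
  rw [← h'.eq_transform_left, ← h.eq_transform_left]

end SinkhornTransform

/-! ### Entropic duality -/

/-- The Donsker–Varadhan inequality. -/
theorem integral_sub_integral_llr_le {α : Type*} [MeasurableSpace α] {γ τ : Measure α}
    [IsProbabilityMeasure γ] [IsProbabilityMeasure τ] (hac : γ ≪ τ)
    (hllr : Integrable (llr γ τ) γ) {a : α → ℝ} (ha : Integrable a γ)
    (hexp : Integrable (fun x => Real.exp (a x)) τ) :
    ∫ x, a x ∂γ - ∫ x, llr γ τ x ∂γ ≤ ∫ x, Real.exp (a x) ∂τ - 1 := by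
  have h1 : ∫ x, (γ.rnDeriv τ x).toReal ∂τ = 1 := by
    rw [Measure.integral_toReal_rnDeriv hac, probReal_univ]
  have hi : Integrable (fun x => (γ.rnDeriv τ x).toReal) τ := Measure.integrable_toReal_rnDeriv
  rw [← integral_sub ha hllr, ← h1, ← integral_sub hexp hi, ← integral_rnDeriv_smul hac]
  refine integral_mono ((integrable_rnDeriv_smul_iff hac).2 (ha.sub hllr)) (hexp.sub hi)
    fun x => ?_
  -- Pointwise in the density h of γ, the claim is h (a - log h) ≤ exp a - h, which is log x ≤ x - 1
  -- at x = exp a / h; where h vanishes it says exp a ≥ 0.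
  simp only [smul_eq_mul, llr]
  have h0 : 0 ≤ (γ.rnDeriv τ x).toReal := ENNReal.toReal_nonneg
  generalize (γ.rnDeriv τ x).toReal = h at h0 ⊢
  rcases h0.eq_or_lt with rfl | h0
  · simpa using (Real.exp_pos _).le
  · have e : a x - Real.log h = Real.log (Real.exp (a x) / h) := by
      rw [Real.log_div (Real.exp_pos _).ne' h0.ne', Real.log_exp]
    have := Real.log_le_sub_one_of_pos (div_pos (Real.exp_pos (a x)) h0)
    rw [e]
    calc h * Real.log (Real.exp (a x) / h) ≤ h * (Real.exp (a x) / h - 1) := by gcongr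
      _ = _ := by field_simp

section Couplings

variable {Y : Type*} [MeasurableSpace Y] {ν ρ : Measure Y} {γ : Measure (Y × Y)}

theorem isProbabilityMeasure_of_mem_couplings [IsProbabilityMeasure ν] (hγ : γ ∈ couplings ν ρ) :
    IsProbabilityMeasure γ := ⟨by
  have := congrArg (fun m => m univ) hγ.1
  simpa [Measure.map_apply measurable_fst MeasurableSet.univ] using this⟩

theorem prod_mem_couplings [IsProbabilityMeasure ν] [IsProbabilityMeasure ρ] :
    ν.prod ρ ∈ couplings ν ρ := ⟨by simp, by simp⟩

theorem integral_add_of_mem_couplings {f g : Y → ℝ} (hν : Integrable f ν) (hρ : Integrable g ρ)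
    (hγ : γ ∈ couplings ν ρ) :
    Integrable (fun p : Y × Y => f p.1 + g p.2) γ ∧
      ∫ p, (f p.1 + g p.2) ∂γ = ∫ x, f x ∂ν + ∫ y, g y ∂ρ := by
  obtain ⟨h1, h2⟩ := hγ
  rw [← h1] at hν ⊢
  rw [← h2] at hρ ⊢
  have i1 := hν.comp_measurable measurable_fst
  have i2 := hρ.comp_measurable measurable_snd
  refine ⟨i1.add i2, ?_⟩
  rw [integral_map measurable_fst.aemeasurable hν.1, integral_map measurable_snd.aemeasurable hρ.1]
  exact integral_add i1 i2

end Couplings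

section Duality

variable {Y : Type*} [MetricSpace Y] [MeasurableSpace Y]
  {ε : ℝ} {K : Set Y} {ν ρ : Measure Y} {γ : Measure (Y × Y)}

variable [BorelSpace Y]

theorem prod_compl_null_of_mem_couplings (hK : IsCompact K) (hν : ν Kᶜ = 0) (hρ : ρ Kᶜ = 0)
    (hγ : γ ∈ couplings ν ρ) : γ (K ×ˢ K)ᶜ = 0 := by
  have hKm := hK.isClosed.measurableSet.compl
  have h1 : γ (Prod.fst ⁻¹' Kᶜ) = 0 := by rw [← Measure.map_apply measurable_fst hKm, hγ.1, hν]
  have h2 : γ (Prod.snd ⁻¹' Kᶜ) = 0 := by rw [← Measure.map_apply measurable_snd hKm, hγ.2, hρ]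
  refine measure_mono_null (t := Prod.fst ⁻¹' Kᶜ ∪ Prod.snd ⁻¹' Kᶜ) ?_ (measure_union_null h1 h2)
  rintro ⟨x, y⟩ hp
  simp only [mem_compl_iff, mem_prod, not_and_or] at hp
  exact hp

theorem IsSinkhornPair.integral_exp_right [IsProbabilityMeasure ν] (hε : 0 < ε)
    (hK : IsCompact K) (hν : ν Kᶜ = 0) {f g : Y → ℝ} (h : IsSinkhornPair ε ν ρ f g) (y : Y) :
    ∫ x, Real.exp ((f x + g y - quadCost x y) / ε) ∂ν = 1 := by
  rw [← integral_exp_add_freeEnergy hε (integrable_exp_sub_quadCost hK hν h.continuous_left y),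
    h.eq_transform_right]
  congr 1
  funext x
  rw [sinkhornTransform]
  ring_nf

theorem IsSinkhornPair.integral_exp_left [IsProbabilityMeasure ρ] (hε : 0 < ε)
    (hK : IsCompact K) (hρ : ρ Kᶜ = 0) {f g : Y → ℝ} (h : IsSinkhornPair ε ν ρ f g) (x : Y) :
    ∫ y, Real.exp ((f x + g y - quadCost x y) / ε) ∂ρ = 1 := by
  rw [← integral_exp_add_freeEnergy hε (integrable_exp_sub_quadCost hK hρ h.continuous_right x),
    h.eq_transform_left]
  congr 1
  funext y
  rw [sinkhornTransform, quadCost_comm x y]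
  ring_nf

variable [SecondCountableTopology Y]

theorem Continuous.integrable_coupling [IsProbabilityMeasure ν] (hK : IsCompact K)
    (hν : ν Kᶜ = 0) (hρ : ρ Kᶜ = 0) (hγ : γ ∈ couplings ν ρ) {a : Y × Y → ℝ}
    (ha : Continuous a) : Integrable a γ := by
  have := isProbabilityMeasure_of_mem_couplings hγ
  exact ha.integrable_of_compl_null (hK.prod hK) (prod_compl_null_of_mem_couplings hK hν hρ hγ)

/-- The bridge from the extended-valued cost to real integrals. The mass corrections in `klDiv`
cancel between probability measures, and the divergence is nonnegative. -/
theorem entropicCost_eq [IsProbabilityMeasure ν] [IsProbabilityMeasure ρ] (hε : 0 < ε)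
    (hK : IsCompact K) (hν : ν Kᶜ = 0) (hρ : ρ Kᶜ = 0) (hγ : γ ∈ couplings ν ρ)
    (hac : γ ≪ ν.prod ρ) (hllr : Integrable (llr γ (ν.prod ρ)) γ) :
    (∫⁻ p, ENNReal.ofReal (dist p.1 p.2 ^ 2) ∂γ) +
      ENNReal.ofReal (2 * ε) * InformationTheory.klDiv γ (ν.prod ρ)
      = ENNReal.ofReal (2 * (∫ p, quadCost p.1 p.2 ∂γ + ε * ∫ p, llr γ (ν.prod ρ) p ∂γ)) ∧
    0 ≤ ∫ p, quadCost p.1 p.2 ∂γ + ε * ∫ p, llr γ (ν.prod ρ) p ∂γ := by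
  have := isProbabilityMeasure_of_mem_couplings hγ
  have h0 := InformationTheory.integral_llr_add_sub_measure_univ_nonneg hac hllr
  simp only [probReal_univ, add_sub_cancel_right] at h0
  refine ⟨?_, add_nonneg (integral_nonneg fun p => by unfold quadCost; positivity)
    (by positivity)⟩
  rw [← ofReal_integral_eq_lintegral_ofReal
      (Continuous.integrable_coupling hK hν hρ hγ (by fun_prop)) (ae_of_all _ fun p => by positivity),
    InformationTheory.klDiv_of_ac_of_integrable hac hllr, ← ENNReal.ofReal_mul (by positivity),
    ← ENNReal.ofReal_add (integral_nonneg fun p => by positivity)]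
  · simp only [probReal_univ, add_sub_cancel_right]
    congr 1
    have : ∫ p : Y × Y, dist p.1 p.2 ^ 2 ∂γ = 2 * ∫ p, quadCost p.1 p.2 ∂γ := by
      rw [← integral_const_mul]
      congr 1
      funext p
      unfold quadCost
      ring
    rw [this]; ring
  · simp only [probReal_univ, add_sub_cancel_right]
    positivity

/-- Weak duality: Donsker–Varadhan with exponent (f + g - c)/ε, where the marginal conditions split
the integral of f + g. -/
theorem entropicDual_le_cost [IsProbabilityMeasure ν] [IsProbabilityMeasure ρ] (hε : 0 < ε)
    (hK : IsCompact K) (hν : ν Kᶜ = 0) (hρ : ρ Kᶜ = 0) (hγ : γ ∈ couplings ν ρ)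
    {f g : Y → ℝ} (hf : Continuous f) (hg : Continuous g) :
    ENNReal.ofReal (2 * entropicDual ε ν ρ f g) ≤
    (∫⁻ p, ENNReal.ofReal (dist p.1 p.2 ^ 2) ∂γ) +
      ENNReal.ofReal (2 * ε) * InformationTheory.klDiv γ (ν.prod ρ) := by
  by_cases h : InformationTheory.klDiv γ (ν.prod ρ) = ⊤
  · rw [h, ENNReal.mul_top (by simpa using hε), add_top]
    exact le_top
  obtain ⟨hac, hllr⟩ := InformationTheory.klDiv_ne_top_iff.1 h
  have := isProbabilityMeasure_of_mem_couplings hγ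
  rw [(entropicCost_eq hε hK hν hρ hγ hac hllr).1]
  have hc : Integrable (fun p : Y × Y => quadCost p.1 p.2) γ :=
    Continuous.integrable_coupling hK hν hρ hγ (by fun_prop)
  obtain ⟨hfg, e⟩ := integral_add_of_mem_couplings (hf.integrable_of_compl_null hK hν)
    (hg.integrable_of_compl_null hK hρ) hγ
  have key := integral_sub_integral_llr_le hac hllr
    (a := fun p => (f p.1 + g p.2 - quadCost p.1 p.2) / ε) ((hfg.sub hc).div_const ε)
    (Continuous.integrable_coupling hK hν hρ prod_mem_couplings (by fun_prop))
  rw [integral_div, integral_sub hfg hc, e] at key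
  gcongr
  unfold entropicDual
  have k2 := mul_le_mul_of_nonneg_left key hε.le
  rw [mul_sub, mul_div_cancel₀ _ hε.ne'] at k2
  linarith

/-- The dual functional is affine in the second marginal at potentials which solve the right
Sinkhorn equation. -/
theorem IsSinkhornPair.entropicDual_eq [IsProbabilityMeasure ν] {ρ' : Measure Y}
    [IsProbabilityMeasure ρ'] (hε : 0 < ε)
    (hK : IsCompact K) (hν : ν Kᶜ = 0) (hρ' : ρ' Kᶜ = 0) {f g : Y → ℝ}
    (h : IsSinkhornPair ε ν ρ f g) :
    entropicDual ε ν ρ' f g = ∫ x, f x ∂ν + ∫ y, g y ∂ρ' := by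
  have hf := h.continuous_left
  have hg := h.continuous_right
  rw [entropicDual, integral_prod_symm]
  · simp only [h.integral_exp_right hε hK hν]
    simp
  · exact Continuous.integrable_coupling hK hν hρ' prod_mem_couplings (by fun_prop)

/-- The optimal plan given by Sinkhorn potentials. -/
noncomputable def sinkhornPlan (ε : ℝ) (ν ρ : Measure Y) (f g : Y → ℝ) : Measure (Y × Y) :=
  (ν.prod ρ).withDensity
    fun p => ENNReal.ofReal (Real.exp ((f p.1 + g p.2 - quadCost p.1 p.2) / ε))

theorem IsSinkhornPair.sinkhornPlan_mem_couplings [IsProbabilityMeasure ν]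
    [IsProbabilityMeasure ρ] (hε : 0 < ε) (hK : IsCompact K) (hν : ν Kᶜ = 0) (hρ : ρ Kᶜ = 0)
    {f g : Y → ℝ} (h : IsSinkhornPair ε ν ρ f g) :
    sinkhornPlan ε ν ρ f g ∈ couplings ν ρ := by
  have hf := h.continuous_left
  have hg := h.continuous_right
  have hmeas : Measurable fun p : Y × Y =>
      ENNReal.ofReal (Real.exp ((f p.1 + g p.2 - quadCost p.1 p.2) / ε)) := by
    have : Continuous fun p : Y × Y => Real.exp ((f p.1 + g p.2 - quadCost p.1 p.2) / ε) := by
      fun_prop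
    exact this.measurable.ennreal_ofReal
  constructor
  · ext s hs
    rw [Measure.map_apply measurable_fst hs, sinkhornPlan,
      withDensity_apply _ (measurable_fst hs), ← prod_univ, ← Measure.prod_restrict,
      Measure.restrict_univ, lintegral_prod _ hmeas.aemeasurable]
    have : ∀ x, ∫⁻ y, ENNReal.ofReal (Real.exp ((f x + g y - quadCost x y) / ε)) ∂ρ = 1 :=
      fun x => by
        rw [← ofReal_integral_eq_lintegral_ofReal
          (Continuous.integrable_of_compl_null hK hρ (by fun_prop))
          (ae_of_all _ fun _ => (Real.exp_pos _).le), h.integral_exp_left hε hK hρ,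
          ENNReal.ofReal_one]
    simp [this]
  · ext s hs
    rw [Measure.map_apply measurable_snd hs, sinkhornPlan,
      withDensity_apply _ (measurable_snd hs), ← univ_prod, ← Measure.prod_restrict,
      Measure.restrict_univ, lintegral_prod_symm _ hmeas.aemeasurable]
    have : ∀ y, ∫⁻ x, ENNReal.ofReal (Real.exp ((f x + g y - quadCost x y) / ε)) ∂ν = 1 :=
      fun y => by
        rw [← ofReal_integral_eq_lintegral_ofReal
          (Continuous.integrable_of_compl_null hK hν (by fun_prop))
          (ae_of_all _ fun _ => (Real.exp_pos _).le), h.integral_exp_right hε hK hν,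
          ENNReal.ofReal_one]
    simp [this]

theorem IsSinkhornPair.cost_sinkhornPlan [IsProbabilityMeasure ν]
    [IsProbabilityMeasure ρ] (hε : 0 < ε) (hK : IsCompact K) (hν : ν Kᶜ = 0) (hρ : ρ Kᶜ = 0)
    {f g : Y → ℝ} (h : IsSinkhornPair ε ν ρ f g) :
    (∫⁻ p, ENNReal.ofReal (dist p.1 p.2 ^ 2) ∂(sinkhornPlan ε ν ρ f g)) +
      ENNReal.ofReal (2 * ε) * InformationTheory.klDiv (sinkhornPlan ε ν ρ f g) (ν.prod ρ)
      = ENNReal.ofReal (2 * entropicDual ε ν ρ f g) ∧ 0 ≤ entropicDual ε ν ρ f g := by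
  have hf := h.continuous_left
  have hg := h.continuous_right
  have hγ := h.sinkhornPlan_mem_couplings hε hK hν hρ
  set γ := sinkhornPlan ε ν ρ f g with hγdef
  have := isProbabilityMeasure_of_mem_couplings hγ
  have hac : γ ≪ ν.prod ρ := withDensity_absolutelyContinuous _ _
  -- The logarithm of the Gibbs density is affine in the cost, so ε KL cancels ∫ c dγ and leaves ∫ f
  -- dν + ∫ g dρ.
  have hllr : llr γ (ν.prod ρ) =ᵐ[γ] fun p => (f p.1 + g p.2 - quadCost p.1 p.2) / ε := by
    have hmeas : Measurable fun p : Y × Y =>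
        ENNReal.ofReal (Real.exp ((f p.1 + g p.2 - quadCost p.1 p.2) / ε)) := by
      have : Continuous fun p : Y × Y => Real.exp ((f p.1 + g p.2 - quadCost p.1 p.2) / ε) := by
        fun_prop
      exact this.measurable.ennreal_ofReal
    filter_upwards [hac.ae_le (Measure.rnDeriv_withDensity (ν.prod ρ) hmeas)] with p hp
    rw [llr, hγdef, sinkhornPlan, hp, ENNReal.toReal_ofReal (Real.exp_pos _).le, Real.log_exp]
  have hc : Integrable (fun p : Y × Y => quadCost p.1 p.2) γ :=
    Continuous.integrable_coupling hK hν hρ hγ (by fun_prop)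
  obtain ⟨hfg, e⟩ := integral_add_of_mem_couplings (hf.integrable_of_compl_null hK hν)
    (hg.integrable_of_compl_null hK hρ) hγ
  have key := entropicCost_eq hε hK hν hρ hγ hac (((hfg.sub hc).div_const ε).congr hllr.symm)
  rwa [integral_congr_ae hllr, integral_div, integral_sub hfg hc, e, mul_div_cancel₀ _ hε.ne',
    add_sub_cancel, ← h.entropicDual_eq hε hK hν hρ] at key

/-- Sinkhorn potentials are optimal, and there is no duality gap. -/
theorem IsSinkhornPair.entropicW2Sq_eq [IsProbabilityMeasure ν]
    [IsProbabilityMeasure ρ] (hε : 0 < ε) (hK : IsCompact K) (hν : ν Kᶜ = 0) (hρ : ρ Kᶜ = 0)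
    {f g : Y → ℝ} (h : IsSinkhornPair ε ν ρ f g) :
    1 / 2 * entropicW2Sq ε ν ρ = entropicDual ε ν ρ f g ∧
      ∀ f' g' : Y → ℝ, Continuous f' → Continuous g' →
        entropicDual ε ν ρ f' g' ≤ 1 / 2 * entropicW2Sq ε ν ρ := by
  have hγ := h.sinkhornPlan_mem_couplings hε hK hν hρ
  obtain ⟨hcost, hnonneg⟩ := h.cost_sinkhornPlan hε hK hν hρ
  have hW : entropicW2Sq ε ν ρ = 2 * entropicDual ε ν ρ f g := by
    rw [entropicW2Sq]
    have : (⨅ γ ∈ couplings ν ρ, (∫⁻ p, ENNReal.ofReal (dist p.1 p.2 ^ 2) ∂γ) +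
        ENNReal.ofReal (2 * ε) * InformationTheory.klDiv γ (ν.prod ρ))
        = ENNReal.ofReal (2 * entropicDual ε ν ρ f g) := by
      refine le_antisymm ?_ (le_iInf₂ fun γ hγ => entropicDual_le_cost hε hK hν hρ hγ
        h.continuous_left h.continuous_right)
      rw [← hcost]
      exact iInf₂_le _ hγ
    rw [this, ENNReal.toReal_ofReal (by linarith)]
  refine ⟨by rw [hW]; ring, fun f' g' hf' hg' => ?_⟩
  have := entropicDual_le_cost hε hK hν hρ hγ hf' hg'
  rw [hcost, ENNReal.ofReal_le_ofReal_iff (by linarith)] at this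
  rw [hW]; linarith

end Duality

/-! ### First-order expansion of the entropic cost with quadratic remainder -/

theorem abs_log_le_two_mul {t η : ℝ} (hη : η ≤ 1 / 2) (h : |t - 1| ≤ η) :
    |Real.log t| ≤ 2 * η := by
  obtain ⟨h1, h2⟩ := abs_le.1 h
  have ht : 0 < t := by linarith
  rw [abs_le]
  constructor
  · have h3 := Real.one_sub_inv_le_log_of_pos ht
    have h4 : t⁻¹ ≤ 1 + 2 * η := by
      rw [inv_le_iff_one_le_mul₀ ht]
      nlinarith
    linarith
  · have := Real.log_le_sub_one_of_pos ht
    linarith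

theorem exp_sub_exp_le {a b P : ℝ} (ha : a ≤ P) (hb : b ≤ P) :
    |Real.exp a - Real.exp b| ≤ Real.exp P * |a - b| := by
  wlog h : b ≤ a generalizing a b
  · rw [abs_sub_comm, abs_sub_comm a]
    exact this hb ha (le_of_not_ge h)
  rw [abs_of_nonneg (sub_nonneg.2 (Real.exp_le_exp.2 h)), abs_of_nonneg (sub_nonneg.2 h)]
  have h1 := Real.add_one_le_exp (b - a)
  have h2 : Real.exp b = Real.exp a * Real.exp (b - a) := by rw [← Real.exp_add]; ring_nf
  have h3 := Real.exp_le_exp.2 ha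
  have h4 := Real.exp_pos a
  rw [h2]
  calc Real.exp a - Real.exp a * Real.exp (b - a) = Real.exp a * (1 - Real.exp (b - a)) := by ring
    _ ≤ Real.exp a * (a - b) := mul_le_mul_of_nonneg_left (by linarith) h4.le
    _ ≤ _ := mul_le_mul_of_nonneg_right h3 (by linarith)

section Stability

variable {Y : Type*} [MetricSpace Y] [MeasurableSpace Y] [BorelSpace Y]
  {ε : ℝ} {K : Set Y} {ν ρ : Measure Y} {f g : Y → ℝ}

theorem integral_sub_integral_le_of_osc_le {m m' : Measure Y} [IsProbabilityMeasure m]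
    [IsProbabilityMeasure m'] (hK : IsCompact K) (hm : m Kᶜ = 0) (hm' : m' Kᶜ = 0) {w : Y → ℝ}
    (hw : Continuous w) {B : ℝ} (hB : ∀ x ∈ K, ∀ y ∈ K, w x - w y ≤ B) :
    ∫ y, w y ∂m' - ∫ y, w y ∂m ≤ B := by
  obtain ⟨x₁, h₁, x₂, h₂, h⟩ := exists_osc_attained hK (nonempty_of_compl_null hm) hw
  have i1 : ∫ y, w y ∂m' ≤ w x₁ := by
    have := integral_mono_ae (hw.integrable_of_compl_null hK hm') (integrable_const (w x₁))
      (Filter.Eventually.mono (mem_ae_iff.2 hm') fun y hy => by have := h y hy x₂ h₂; linarith)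
    simpa using this
  have i2 : w x₂ ≤ ∫ y, w y ∂m := by
    have := integral_mono_ae (integrable_const (w x₂)) (hw.integrable_of_compl_null hK hm)
      (Filter.Eventually.mono (mem_ae_iff.2 hm) fun y hy => by have := h x₁ h₁ y hy; linarith)
    simpa using this
  have := hB x₁ h₁ x₂ h₂
  linarith

/-- Expresses the error in the left equation through the mass of the old Gibbs density under ρ',
which is easy to estimate. -/
theorem IsSinkhornPair.sinkhornTransform_sub_eq {ρ' : Measure Y} [IsProbabilityMeasure ρ']
    (hε : 0 < ε) (hK : IsCompact K) (hρ' : ρ' Kᶜ = 0) (h : IsSinkhornPair ε ν ρ f g) (x : Y) :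
    sinkhornTransform ε ρ' g x - f x
      = -ε * Real.log (∫ y, Real.exp ((f x + g y - quadCost x y) / ε) ∂ρ') := by
  rw [sinkhornTransform, ← freeEnergy_add_const hε
    (integrable_exp_sub_quadCost hK hρ' h.continuous_right x), freeEnergy]
  congr 3
  funext y
  rw [quadCost_comm]
  ring_nf

variable [SecondCountableTopology Y]

/-- The potential `g` is a subgradient of the convex functional `½ W²_{2,ε}(ν, ·)` at `ρ`. -/
theorem IsSinkhornPair.le_entropicW2Sq_sub {ρ' : Measure Y} {f' g' : Y → ℝ}
    [IsProbabilityMeasure ν] [IsProbabilityMeasure ρ] [IsProbabilityMeasure ρ']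
    (hε : 0 < ε) (hK : IsCompact K) (hν : ν Kᶜ = 0) (hρ : ρ Kᶜ = 0) (hρ' : ρ' Kᶜ = 0)
    (h : IsSinkhornPair ε ν ρ f g) (h' : IsSinkhornPair ε ν ρ' f' g') :
    ∫ y, g y ∂ρ' - ∫ y, g y ∂ρ ≤ 1 / 2 * entropicW2Sq ε ν ρ' - 1 / 2 * entropicW2Sq ε ν ρ := by
  have h1 := (h'.entropicW2Sq_eq hε hK hν hρ').2 f g h.continuous_left h.continuous_right
  have h2 := (h.entropicW2Sq_eq hε hK hν hρ).1
  rw [h.entropicDual_eq hε hK hν hρ'] at h1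
  rw [h.entropicDual_eq hε hK hν hρ] at h2
  linarith

/-- First order expansion of `½ W²_{2,ε}(ν, ·)` at `ρ`, with a remainder controlled by the error
`η` which the potentials at `ρ` make in the Sinkhorn equation for `ρ'`. -/
theorem IsSinkhornPair.exists_remainder [IsProbabilityMeasure ν] [IsProbabilityMeasure ρ]
    (hε : 0 < ε) (hK : IsCompact K) (hν : ν Kᶜ = 0) (hρ : ρ Kᶜ = 0)
    (h : IsSinkhornPair ε ν ρ f g) :
    ∃ C : ℝ, 0 ≤ C ∧ ∀ ρ' : Measure Y, IsProbabilityMeasure ρ' → ρ' Kᶜ = 0 → ∀ η, 0 ≤ η → η ≤ 1 / 2 →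
      (∀ x ∈ K, |∫ y, Real.exp ((f x + g y - quadCost x y) / ε) ∂ρ' - 1| ≤ η) →
      ∃ w : Y → ℝ, Continuous w ∧ (∀ y ∈ K, ∀ y' ∈ K, w y - w y' ≤ C * η) ∧
        (∀ y ∈ K, ∀ y' ∈ K, w y - w y' ≤ C * η * dist y y') ∧
        ∫ y, g y ∂ρ' - ∫ y, g y ∂ρ ≤ 1 / 2 * entropicW2Sq ε ν ρ' - 1 / 2 * entropicW2Sq ε ν ρ ∧
        1 / 2 * entropicW2Sq ε ν ρ' - 1 / 2 * entropicW2Sq ε ν ρ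
          - (∫ y, g y ∂ρ' - ∫ y, g y ∂ρ) ≤ ∫ y, w y ∂ρ' - ∫ y, w y ∂ρ := by
  obtain ⟨R, hR0, hR⟩ := exists_dist_le hK
  -- The error at one point is at most ε · 2η by the logarithm bound; two points give 4εη, and the
  -- exponential is the amplification in `IsSinkhornPair.osc_sub_le`.
  set L := Real.exp (2 * (R * R) / ε) * (4 * ε) with hL
  have L0 : 0 ≤ L := by positivity
  refine ⟨max L (2 * R / ε * L), le_max_of_le_left L0, fun ρ' _ hρ' η hη0 hη hI => ?_⟩
  obtain ⟨f', g', h'⟩ := exists_isSinkhornPair_of_compl_null hε hK ν ρ' hν hρ'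
  have hβ : ∀ x ∈ K, |sinkhornTransform ε ρ' g x - f x| ≤ ε * (2 * η) := fun x hx => by
    rw [h.sinkhornTransform_sub_eq hε hK hρ', abs_mul, abs_neg, abs_of_pos hε]
    gcongr
    exact abs_log_le_two_mul hη (hI x hx)
  have hosc : ∀ x ∈ K, ∀ y ∈ K, (f' x - f x) - (f' y - f y) ≤ L * η := fun x hx y hy => by
    have := h.osc_sub_le hε hK hν hρ' hR h' (β := 4 * ε * η) (fun x hx y hy => by
      have h1 := (abs_le.1 (hβ x hx)).2
      have h2 := (abs_le.1 (hβ y hy)).1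
      linarith) x hx y hy
    rw [hL]; linarith
  have hLη : 0 ≤ L * η := by positivity
  -- The difference of the right potentials is the remainder density: the lower bound is the
  -- subgradient inequality at ρ, the upper bound the one at ρ' with the roles exchanged.
  refine ⟨fun y => g' y - g y, h'.continuous_right.sub h.continuous_right, fun y hy y' hy' => ?_,
    fun y hy y' hy' => ?_, h.le_entropicW2Sq_sub hε hK hν hρ hρ' h', ?_⟩
  · have h1 := sinkhornTransform_osc_le_contract hε hK hν hR h.continuous_left h'.continuous_left
      hLη hosc hy hy'
    rw [← h.eq_transform_right, ← h'.eq_transform_right] at h1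
    have h2 := Real.exp_pos (-2 * (R * R) / ε)
    have h3 : L * η ≤ max L (2 * R / ε * L) * η := by gcongr; exact le_max_left _ _
    nlinarith
  · have h1 := sinkhornTransform_osc_le_dist hε hK hν hR h.continuous_left h'.continuous_left
      hLη hosc hy hy'
    rw [← h.eq_transform_right, ← h'.eq_transform_right] at h1
    have h3 : 2 * R / ε * (L * η) * dist y y' ≤ max L (2 * R / ε * L) * η * dist y y' := by
      rw [← mul_assoc]
      gcongr
      exact le_max_right _ _
    exact h1.trans h3
  · have h1 := h'.le_entropicW2Sq_sub hε hK hν hρ' hρ h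
    have ig := fun (m : Measure Y) (_ : IsProbabilityMeasure m) (hm : m Kᶜ = 0) =>
      integral_sub (h'.continuous_right.integrable_of_compl_null hK hm)
        (h.continuous_right.integrable_of_compl_null hK hm)
    rw [ig ρ ‹_› hρ, ig ρ' ‹_› hρ']
    linarith

/-- Quadratic expansion along segments of probability measures. -/
theorem IsSinkhornPair.segment_expansion [IsProbabilityMeasure ν] [IsProbabilityMeasure ρ]
    {σ : Measure Y} [IsProbabilityMeasure σ]
    (hε : 0 < ε) (hK : IsCompact K) (hν : ν Kᶜ = 0) (hρ : ρ Kᶜ = 0) (hσ : σ Kᶜ = 0)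
    (h : IsSinkhornPair ε ν ρ f g) :
    ∃ C s₀ : ℝ, 0 < s₀ ∧ ∀ s, 0 ≤ s → s ≤ s₀ →
      |1 / 2 * entropicW2Sq ε ν (ENNReal.ofReal (1 - s) • ρ + ENNReal.ofReal s • σ)
        - 1 / 2 * entropicW2Sq ε ν ρ - s * (∫ y, g y ∂σ - ∫ y, g y ∂ρ)| ≤ C * s ^ 2 := by
  obtain ⟨C, hC0, hC⟩ := h.exists_remainder hε hK hν hρ
  have hf := h.continuous_left
  have hg := h.continuous_right
  have hEc : Continuous fun p : Y × Y => Real.exp ((f p.1 + g p.2 - quadCost p.1 p.2) / ε) := by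
    fun_prop
  obtain ⟨M, hM⟩ := (hK.prod hK).bddAbove_image hEc.continuousOn
  have hM' : ∀ x ∈ K, ∀ y ∈ K, Real.exp ((f x + g y - quadCost x y) / ε) ≤ M := fun x hx y hy =>
    hM (mem_image_of_mem _ (mk_mem_prod hx hy : (x, y) ∈ K ×ˢ K))
  have M0 : 0 ≤ M := by
    obtain ⟨x, hx⟩ := nonempty_of_compl_null hν
    exact (Real.exp_pos _).le.trans (hM' x hx x hx)
  refine ⟨C * (M + 1), min 1 (1 / (2 * (M + 1))), by positivity, fun s hs0 hs => ?_⟩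
  have hs1 : s ≤ 1 := hs.trans (min_le_left _ _)
  have hs2 : (M + 1) * s ≤ 1 / 2 := by
    have := hs.trans (min_le_right _ _)
    rw [le_div_iff₀ (by positivity)] at this
    linarith
  set ρ' := ENNReal.ofReal (1 - s) • ρ + ENNReal.ofReal s • σ with hρ'def
  have : IsProbabilityMeasure ρ' := ⟨by
    simp only [hρ'def, Measure.add_apply, Measure.smul_apply, measure_univ, smul_eq_mul, mul_one]
    rw [← ENNReal.ofReal_add (by linarith) hs0]
    simp⟩
  have hρ' : ρ' Kᶜ = 0 := by simp [hρ'def, hρ, hσ]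
  have hint : ∀ a : Y → ℝ, Continuous a →
      ∫ y, a y ∂ρ' = (1 - s) * ∫ y, a y ∂ρ + s * ∫ y, a y ∂σ := fun a ha => by
    rw [hρ'def, integral_add_measure
      ((ha.integrable_of_compl_null hK hρ).smul_measure ENNReal.ofReal_ne_top)
      ((ha.integrable_of_compl_null hK hσ).smul_measure ENNReal.ofReal_ne_top),
      integral_smul_measure, integral_smul_measure, ENNReal.toReal_ofReal (by linarith),
      ENNReal.toReal_ofReal hs0, smul_eq_mul, smul_eq_mul]
  -- The mass of the Gibbs density under ρ' is 1 + s (I - 1), where I ∈ [0, M] is its integral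
  -- against σ. The remainder carries a second factor s because ρ' - ρ = s (σ - ρ).
  obtain ⟨w, hw, hosc, -, hlo, hhi⟩ := hC ρ' this hρ' ((M + 1) * s) (by positivity) hs2
    (fun x hx => by
      rw [hint _ (by fun_prop), h.integral_exp_left hε hK hρ x]
      have i1 : ∫ y, Real.exp ((f x + g y - quadCost x y) / ε) ∂σ ≤ M := by
        have := integral_mono_ae
          (Continuous.integrable_of_compl_null hK hσ
            (show Continuous fun y => Real.exp ((f x + g y - quadCost x y) / ε) by fun_prop))
          (integrable_const M) (Filter.Eventually.mono (mem_ae_iff.2 hσ) fun y hy => hM' x hx y hy)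
        simpa using this
      have i0 : 0 ≤ ∫ y, Real.exp ((f x + g y - quadCost x y) / ε) ∂σ :=
        integral_nonneg fun y => (Real.exp_pos _).le
      rw [abs_le]
      constructor <;> nlinarith)
  have hwb := integral_sub_integral_le_of_osc_le hK hρ hσ hw hosc
  rw [hint w hw] at hhi
  rw [hint g hg] at hlo hhi
  rw [abs_le]
  have e : s * (∫ y, w y ∂σ - ∫ y, w y ∂ρ) ≤ s * (C * ((M + 1) * s)) := by gcongr
  have : 0 ≤ C * (M + 1) * s ^ 2 := by positivity
  constructor <;> nlinarith

/-- Quadratic expansion along push-forwards. -/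
theorem IsSinkhornPair.map_expansion {Z : Type*} [MeasurableSpace Z] {μ : Measure Z}
    [IsProbabilityMeasure μ] [IsProbabilityMeasure ν] {a : Z → Y} (ha : Measurable a)
    (hε : 0 < ε) (hK : IsCompact K) (hν : ν Kᶜ = 0) (haK : ∀ᵐ z ∂μ, a z ∈ K)
    (h : IsSinkhornPair ε ν (μ.map a) f g) :
    ∃ C D₀ : ℝ, 0 ≤ C ∧ 0 < D₀ ∧ ∀ D, 0 ≤ D → D ≤ D₀ → ∀ b : Z → Y, Measurable b →
      (∀ᵐ z ∂μ, b z ∈ K) → (∀ᵐ z ∂μ, dist (a z) (b z) ≤ D) →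
      |1 / 2 * entropicW2Sq ε ν (μ.map b)
        - 1 / 2 * entropicW2Sq ε ν (μ.map a) - (∫ z, g (b z) ∂μ - ∫ z, g (a z) ∂μ)| ≤ C * D ^ 2 := by
  have hnull : ∀ b : Z → Y, Measurable b → (∀ᵐ z ∂μ, b z ∈ K) → (μ.map b) Kᶜ = 0 :=
    fun b hb hbK => by
      rw [Measure.map_apply hb hK.isClosed.measurableSet.compl]
      exact mem_ae_iff.1 hbK
  have hprob : ∀ b : Z → Y, Measurable b → IsProbabilityMeasure (μ.map b) := fun b hb =>
    Measure.isProbabilityMeasure_map hb.aemeasurable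
  have hintm : ∀ (b : Z → Y), Measurable b → ∀ u : Y → ℝ, Continuous u →
      ∫ y, u y ∂(μ.map b) = ∫ z, u (b z) ∂μ := fun b hb u hu =>
    integral_map hb.aemeasurable hu.measurable.aestronglyMeasurable
  have hinteg : ∀ (b : Z → Y), Measurable b → (∀ᵐ z ∂μ, b z ∈ K) → ∀ u : Y → ℝ, Continuous u →
      Integrable (fun z => u (b z)) μ := fun b hb hbK u hu => by
    have := hprob b hb
    exact (hu.integrable_of_compl_null hK (hnull b hb hbK)).comp_measurable hb
  have hpa := hprob a ha
  have hρ := hnull a ha haK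
  obtain ⟨C, hC0, hC⟩ := h.exists_remainder hε hK hν hρ
  have hf := h.continuous_left
  have hg := h.continuous_right
  obtain ⟨R, hR0, hR⟩ := exists_dist_le hK
  have hqc : Continuous fun p : Y × Y => (f p.1 + g p.2 - quadCost p.1 p.2) / ε := by
    fun_prop
  obtain ⟨P, hP⟩ := (hK.prod hK).bddAbove_image hqc.continuousOn
  have hP' : ∀ x ∈ K, ∀ y ∈ K, (f x + g y - quadCost x y) / ε ≤ P := fun x hx y hy =>
    hP (mem_image_of_mem _ (mk_mem_prod hx hy : (x, y) ∈ K ×ˢ K))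
  -- A Lipschitz constant in y of exp((f + g - c)/ε) on K: the potential and the cost contribute R
  -- each.
  set L := Real.exp P * (2 * R / ε) with hLdef
  have hL0 : 0 ≤ L := by positivity
  have hE : ∀ x ∈ K, ∀ y ∈ K, ∀ y' ∈ K, |Real.exp ((f x + g y - quadCost x y) / ε)
      - Real.exp ((f x + g y' - quadCost x y') / ε)| ≤ L * dist y y' := by
    intro x hx y hy y' hy'
    refine (exp_sub_exp_le (hP' x hx y hy) (hP' x hx y' hy')).trans ?_
    rw [hLdef, mul_assoc]
    gcongr
    have h1 := abs_quadCost_sub_le (hR x hx y hy) (hR x hx y' hy')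
    have h2 := abs_sinkhornTransform_sub_le hε hK hν hf (fun x hx => hR x hx y hy)
      (fun x hx => hR x hx y' hy')
    rw [← h.eq_transform_right] at h2
    rw [← sub_div, abs_div, abs_of_pos hε, div_mul_eq_mul_div]
    gcongr
    rw [abs_le] at h1 h2 ⊢
    constructor <;> linarith
  refine ⟨C * L, 1 / (2 * (L + 1)), by positivity, by positivity, fun D hD0 hD b hb hbK hab => ?_⟩
  have hLD : L * D ≤ 1 / 2 := by
    rw [le_div_iff₀ (by positivity)] at hD
    nlinarith
  have hpb := hprob b hb
  obtain ⟨w, hw, -, hlip, hlo, hhi⟩ := hC (μ.map b) hpb (hnull b hb hbK) (L * D) (by positivity)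
    hLD (fun x hx => by
      have hcx : Continuous fun y => Real.exp ((f x + g y - quadCost x y) / ε) := by fun_prop
      rw [← h.integral_exp_left hε hK hρ x, hintm a ha _ hcx, hintm b hb _ hcx,
        ← integral_sub (hinteg b hb hbK _ hcx) (hinteg a ha haK _ hcx), ← Real.norm_eq_abs]
      have := norm_integral_le_of_norm_le_const (μ := μ) (C := L * D)
        (f := fun z => Real.exp ((f x + g (b z) - quadCost x (b z)) / ε)
          - Real.exp ((f x + g (a z) - quadCost x (a z)) / ε)) (by
          filter_upwards [haK, hbK, hab] with z h1 h2 h3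
          refine (hE x hx _ h2 _ h1).trans ?_
          rw [dist_comm]
          gcongr)
      simpa using this)
  rw [hintm a ha g hg, hintm b hb g hg] at hlo hhi
  rw [hintm a ha w hw, hintm b hb w hw] at hhi
  -- Here the Lipschitz bound on w is essential: its oscillation alone would leave a remainder of
  -- order D, not D².
  have hwb : ∫ z, w (b z) ∂μ - ∫ z, w (a z) ∂μ ≤ C * (L * D) * D := by
    rw [← integral_sub (hinteg b hb hbK w hw) (hinteg a ha haK w hw)]
    have := integral_mono_ae ((hinteg b hb hbK w hw).sub (hinteg a ha haK w hw))
      (integrable_const (C * (L * D) * D)) (by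
        filter_upwards [haK, hbK, hab] with z h1 h2 h3
        refine (hlip _ h2 _ h1).trans ?_
        rw [dist_comm]
        gcongr)
    simpa using this
  have : 0 ≤ C * L * D ^ 2 := by positivity
  rw [abs_le]
  constructor <;> linarith

end Stability

/-! ### Riemannian distance and charts -/

/-- The derivative at `x` of the preferred chart at `x₀`. -/
noncomputable def chartDeriv {n : ℕ} {M : Type*} [TopologicalSpace M]
    [ChartedSpace (EuclideanSpace ℝ (Fin n)) M] (x₀ x : M) :
    TangentSpace (𝓡 n) x →L[ℝ] EuclideanSpace ℝ (Fin n) :=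
  mfderiv (𝓡 n) 𝓘(ℝ, EuclideanSpace ℝ (Fin n)) (extChartAt (𝓡 n) x₀) x

section RiemannianDistance

open scoped NNReal

attribute [local instance] normedAddCommGroupTangentSpaceVectorSpace
  normedSpaceTangentSpaceVectorSpace

variable {E : Type*} [NormedAddCommGroup E] [NormedSpace ℝ E] {H : Type*} [TopologicalSpace H]
  (I : ModelWithCorners ℝ E H) {M : Type*} [TopologicalSpace M] [ChartedSpace H M]
  [RiemannianBundle (fun x : M => TangentSpace I x)] [IsManifold I 1 M]
  [IsContinuousRiemannianBundle E (fun x : M => TangentSpace I x)]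

theorem exists_enorm_mfderivWithin_symm_extChartAt_le (x : M) :
    ∃ C : ℝ≥0, ∀ᶠ y in 𝓝[range I] (extChartAt I x x), ∀ v : E,
      ‖mfderivWithin 𝓘(ℝ, E) I (extChartAt I x).symm (range I) y v‖ₑ ≤ C * ‖v‖ₑ := by
  rcases eventually_enorm_mfderivWithin_symm_extChartAt_lt I x with ⟨C, C_pos, hC⟩
  refine ⟨C, hC.mono fun y hy v => ?_⟩
  refine (ContinuousLinearMap.le_opENorm
    (mfderivWithin 𝓘(ℝ, E) I (extChartAt I x).symm (range I) y) v).trans ?_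
  exact mul_le_mul_left hy.le _

/-- Two-point version of `eventually_riemannianEDist_le_edist_extChartAt`. -/
theorem exists_riemannianEDist_le_edist_extChartAt (x : M) :
    ∃ C : ℝ≥0, ∃ U ∈ 𝓝 x, ∀ y ∈ U, ∀ z ∈ U,
      Manifold.riemannianEDist I y z
        ≤ C * edist (extChartAt I x y) (extChartAt I x z) := by
  obtain ⟨C, hC⟩ := exists_enorm_mfderivWithin_symm_extChartAt_le I x
  obtain ⟨r, r_pos, hr⟩ : ∃ r > 0,
      Metric.ball (extChartAt I x x) r ∩ range I ⊆ (extChartAt I x).target ∩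
        {y | ∀ v : E, ‖mfderivWithin 𝓘(ℝ, E) I (extChartAt I x).symm (range I) y v‖ₑ ≤ C * ‖v‖ₑ} :=
    Metric.mem_nhdsWithin_iff.1 (inter_mem (extChartAt_target_mem_nhdsWithin x) hC)
  have A : (extChartAt I x) ⁻¹' (Metric.ball (extChartAt I x x) r ∩ range I) ∈ 𝓝 x := by
    apply extChartAt_preimage_mem_nhds_of_mem_nhdsWithin (by simp)
    rw [inter_comm]
    exact inter_mem_nhdsWithin _ (Metric.ball_mem_nhds _ r_pos)
  refine ⟨C, _, inter_mem A (extChartAt_source_mem_nhds (I := I) x),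
    fun y ⟨hy, h'y⟩ z ⟨hz, h'z⟩ => ?_⟩
  -- The competitor path is the straight segment in the chart. It stays where the derivative of the
  -- inverse chart is bounded, because a ball intersected with `range I` is convex.
  let η := ContinuousAffineMap.lineMap (R := ℝ) (extChartAt I x y) (extChartAt I x z)
  set γ := (extChartAt I x).symm ∘ η
  have hη : Icc 0 1 ⊆ ⇑η ⁻¹' ((extChartAt I x).target ∩
        {y | ∀ v : E, ‖mfderivWithin 𝓘(ℝ, E) I (extChartAt I x).symm (range I) y v‖ₑ ≤ C * ‖v‖ₑ}) := by
    simp only [← image_subset_iff, ContinuousAffineMap.coe_lineMap_eq,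
     ← segment_eq_image_lineMap, η]
    apply Subset.trans _ hr
    exact ((convex_ball _ _).inter I.convex_range).segment_subset hy hz
  simp only [preimage_inter, subset_inter_iff] at hη
  have η_smooth : CMDiff[Icc 0 1] 1 η := by
    apply ContMDiff.contMDiffOn
    rw [contMDiff_iff_contDiff]
    exact ContinuousAffineMap.contDiff _
  have : Manifold.riemannianEDist I y z ≤ Manifold.pathELength I γ 0 1 := by
    apply Manifold.riemannianEDist_le_pathELength _ _ _ zero_le_one
    · exact (contMDiffOn_extChartAt_symm x).comp η_smooth hη.1
    · simp only [γ, η, Function.comp_apply, ContinuousAffineMap.coe_lineMap_eq,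
        AffineMap.lineMap_apply_zero, (extChartAt I x).left_inv h'y]
    · simp only [γ, η, Function.comp_apply, ContinuousAffineMap.coe_lineMap_eq,
        AffineMap.lineMap_apply_one, (extChartAt I x).left_inv h'z]
  apply this.trans
  rw [← lintegral_fderiv_lineMap_eq_edist, Manifold.pathELength_eq_lintegral_mfderivWithin_Icc,
    ← lintegral_const_mul' _ _ ENNReal.coe_ne_top]
  apply setLIntegral_mono' measurableSet_Icc (fun t ht ↦ ?_)
  have : mfderiv[Icc 0 1] γ t =
      (mfderiv[range I] (extChartAt I x).symm (η t)) ∘L (mfderiv[Icc 0 1] η t) := by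
    apply mfderivWithin_comp
    · exact mdifferentiableWithinAt_extChartAt_symm (hη.1 ht)
    · exact η_smooth.mdifferentiableOn one_ne_zero t ht
    · exact hη.1.trans (preimage_mono (extChartAt_target_subset_range x))
    · rw [uniqueMDiffWithinAt_iff_uniqueDiffWithinAt]
      exact uniqueDiffOn_Icc zero_lt_one t ht
  have : mfderiv[Icc 0 1] γ t 1 =
      (mfderiv[range I] (extChartAt I x).symm (η t)) (mfderiv[Icc 0 1] η t 1) :=
    congr($this 1)
  rw [this]
  refine (hη.2 ht _).trans ?_
  gcongr
  simp only [mfderivWithin_eq_fderivWithin]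
  exact le_of_eq rfl

end RiemannianDistance

section RiemannianCharts

open scoped NNReal

attribute [local instance] normedAddCommGroupTangentSpaceVectorSpace
  normedSpaceTangentSpaceVectorSpace

variable {n : ℕ} {M : Type*} [TopologicalSpace M] [ChartedSpace (EuclideanSpace ℝ (Fin n)) M]
  [IsManifold (𝓡 n) ∞ M] [RiemannianBundle (fun x : M => TangentSpace (𝓡 n) x)]
  [IsContMDiffRiemannianBundle (𝓡 n) ∞ (EuclideanSpace ℝ (Fin n))
    (fun x : M => TangentSpace (𝓡 n) x)]

variable (n M) in
theorem isContinuousRiemannianBundle_tangentSpace :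
    IsContinuousRiemannianBundle (EuclideanSpace ℝ (Fin n))
      (fun x : M => TangentSpace (𝓡 n) x) := by
  obtain ⟨g, hg, h⟩ := IsContMDiffRiemannianBundle.exists_contMDiff (IB := 𝓡 n) (n := ∞)
    (F := EuclideanSpace ℝ (Fin n)) (E := fun x : M => TangentSpace (𝓡 n) x)
  exact ⟨g, hg.continuous, h⟩

/-- Local comparison of the Riemannian norm with the Euclidean one, uniform in the base point; it
turns Euclidean estimates of differentials into estimates of Riemannian gradients. -/
theorem exists_norm_chartDeriv_le (x : M) :
    ∃ C : ℝ, 0 < C ∧ ∀ᶠ y in 𝓝 x, ∀ v : TangentSpace (𝓡 n) y, ‖chartDeriv x y v‖ ≤ C * ‖v‖ := by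
  have : IsManifold (𝓡 n) 1 M := IsManifold.of_le (n := ∞) (by simp)
  have := isContinuousRiemannianBundle_tangentSpace n M
  obtain ⟨C, hC, h⟩ := eventually_norm_mfderiv_extChartAt_lt (𝓡 n) x
  refine ⟨C, hC, h.mono fun y hy v => ?_⟩
  refine (ContinuousLinearMap.le_opNorm (mfderiv (𝓡 n) 𝓘(ℝ, EuclideanSpace ℝ (Fin n))
    (extChartAt (𝓡 n) x) y) v).trans ?_
  gcongr
  exact hy.le

end RiemannianCharts

section LipschitzMaps

variable {n : ℕ} {Y : Type*} [MetricSpace Y]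
    [ChartedSpace (EuclideanSpace ℝ (Fin n)) Y] [IsManifold (𝓡 n) ∞ Y]
    [RiemannianBundle (fun y : Y => TangentSpace (𝓡 n) y)]
    [IsContMDiffRiemannianBundle (𝓡 n) ∞ (EuclideanSpace ℝ (Fin n))
      (fun y : Y => TangentSpace (𝓡 n) y)]
    [IsRiemannianManifold (𝓡 n) Y]

/-- A `C^1` map from a normed space to a Riemannian manifold is locally Lipschitz for the
geodesic distance. -/
theorem ContMDiffAt.exists_lipschitzOnWith_riemannian {V : Type*} [NormedAddCommGroup V]
    [NormedSpace ℝ V] {Φ : V → Y} {u : V} (hΦ : ContMDiffAt 𝓘(ℝ, V) (𝓡 n) 1 Φ u) :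
    ∃ K, ∃ t ∈ 𝓝 u, LipschitzOnWith K Φ t := by
  have : IsManifold (𝓡 n) 1 Y := IsManifold.of_le (n := ∞) (by simp)
  have := isContinuousRiemannianBundle_tangentSpace n Y
  obtain ⟨C, U, hU, hC⟩ := exists_riemannianEDist_le_edist_extChartAt (𝓡 n) (Φ u)
  have h1 : ContMDiffAt 𝓘(ℝ, V) 𝓘(ℝ, EuclideanSpace ℝ (Fin n)) 1
      (extChartAt (𝓡 n) (Φ u) ∘ Φ) u :=
    (contMDiffAt_extChartAt (I := 𝓡 n) (n := 1) (x := Φ u)).comp u hΦ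
  obtain ⟨L, t, ht, hL⟩ := h1.contDiffAt.exists_lipschitzOnWith
  refine ⟨C * L, t ∩ Φ ⁻¹' U, inter_mem ht (hΦ.continuousAt hU), fun a ha b hb => ?_⟩
  rw [IsRiemannianManifold.out (I := 𝓡 n) (Φ a) (Φ b)]
  refine (hC _ ha.2 _ hb.2).trans ?_
  push_cast
  rw [mul_assoc]
  gcongr
  exact hL ha.1 hb.1

end LipschitzMaps

/-! ### Mollification of Lipschitz functions -/

section Mollification

open ContinuousLinearMap
open scoped Convolution NNReal

/-- A locally Lipschitz function with compact support is Lipschitz. -/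
theorem LocallyLipschitz.exists_lipschitzWith_of_hasCompactSupport {E : Type*}
    [NormedAddCommGroup E] [NormedSpace ℝ E] [FiniteDimensional ℝ E] {u : E → ℝ}
    (hu : LocallyLipschitz u) (hc : HasCompactSupport u) : ∃ L, LipschitzWith L u := by
  obtain ⟨R, hR⟩ := hc.isBounded.subset_closedBall (0 : E)
  have hprop : ProperSpace E := FiniteDimensional.proper ℝ E
  obtain ⟨L, hL⟩ := LocallyLipschitzOn.exists_lipschitzOnWith_of_compact
    (isCompact_closedBall (0 : E) (R + 1)) (f := u) (fun x _ => by
      obtain ⟨K, t, ht, h⟩ := hu x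
      exact ⟨K, t, mem_nhdsWithin_of_mem_nhds ht, h⟩)
  obtain ⟨B, hB⟩ := hu.continuous.bounded_above_of_compact_support hc
  have hB0 : 0 ≤ B := (norm_nonneg _).trans (hB 0)
  have key : ∀ a b, a ∈ tsupport u → dist (u a) (u b) ≤ max (L : ℝ) B * dist a b := fun a b ha => by
    have haR := mem_closedBall_zero_iff.1 (hR ha)
    by_cases hb : b ∈ Metric.closedBall (0 : E) (R + 1)
    · refine (hL.dist_le_mul a (mem_closedBall_zero_iff.2 (by linarith)) b hb).trans ?_
      gcongr
      exact le_max_left _ _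
    · have hb' : R + 1 < ‖b‖ := by simpa using hb
      have h0 : u b = 0 := by
        by_contra h
        have := mem_closedBall_zero_iff.1 (hR (subset_tsupport u h))
        linarith
      -- The collar of width 1 separates b from the support, so the sup bound of u acts as a
      -- Lipschitz constant for such pairs.
      have hd : 1 ≤ dist a b := by
        have := norm_sub_norm_le b a
        rw [dist_comm, dist_eq_norm]
        linarith
      rw [h0, dist_zero_right]
      calc ‖u a‖ ≤ B * 1 := by rw [mul_one]; exact hB a
        _ ≤ max (L : ℝ) B * dist a b := by gcongr; exact le_max_right _ _
  refine ⟨max L ⟨B, hB0⟩, LipschitzWith.of_dist_le_mul fun a b => ?_⟩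
  change dist (u a) (u b) ≤ max (L : ℝ) B * dist a b
  by_cases ha : a ∈ tsupport u
  · exact key a b ha
  by_cases hb : b ∈ tsupport u
  · rw [dist_comm, dist_comm a]; exact key b a hb
  · rw [image_eq_zero_of_notMem_tsupport ha, image_eq_zero_of_notMem_tsupport hb, dist_self]
    positivity

variable {E : Type*} [NormedAddCommGroup E] [InnerProductSpace ℝ E] [FiniteDimensional ℝ E]
  [MeasurableSpace E] [BorelSpace E]

theorem locallyIntegrable_fderiv_of_lipschitzWith {u : E → ℝ} {L : ℝ≥0} (hu : LipschitzWith L u) :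
    LocallyIntegrable (fderiv ℝ u) (volume : Measure E) := by
  refine LocallyIntegrable.mono (f := fun _ : E => (L : ℝ)) (locallyIntegrable_const _)
    (measurable_fderiv ℝ u).aestronglyMeasurable (ae_of_all _ fun x => ?_)
  simpa using norm_fderiv_le_of_lipschitz ℝ hu

/-- The derivative is put on u, not on the bump, so that the mollified gradients inherit the bound L
and converge to the gradient of u. Rademacher makes differentiation under the integral legitimate.
-/
theorem hasFDerivAt_bump_convolution {u : E → ℝ} {L : ℝ≥0} (hu : LipschitzWith L u)
    (φ : ContDiffBump (0 : E)) (x : E) :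
    HasFDerivAt (φ.normed volume ⋆[lsmul ℝ ℝ, volume] u)
      ((φ.normed volume ⋆[lsmul ℝ ℝ, volume] fderiv ℝ u) x) x := by
  have hφc := φ.continuous_normed (μ := (volume : Measure E))
  have hφs := φ.hasCompactSupport_normed (μ := (volume : Measure E))
  have hdiff : ∀ᵐ t : E, DifferentiableAt ℝ u (x - t) := by
    have := (quasiMeasurePreserving_sub_left (volume : Measure E) x).ae hu.ae_differentiableAt
    exact this
  have hmeas : Measurable fun t : E => fderiv ℝ u (x - t) :=
    (measurable_fderiv ℝ u).comp (measurable_const.sub measurable_id)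
  refine (hasFDerivAt_integral_of_dominated_loc_of_lip'
    (F := fun x t => φ.normed volume t • u (x - t))
    (F' := fun t => φ.normed volume t • fderiv ℝ u (x - t))
    (bound := fun t => φ.normed volume t * L) (s := univ) univ_mem ?_ ?_ ?_ ?_ ?_ ?_).2
  · intro y _
    exact (hφc.smul (hu.continuous.comp (continuous_const.sub continuous_id))).aestronglyMeasurable
  · exact (hφc.smul (hu.continuous.comp (continuous_const.sub
      continuous_id))).integrable_of_hasCompactSupport hφs.smul_right
  · exact (hφc.measurable.smul hmeas).aestronglyMeasurable
  · refine ae_of_all _ fun t y _ => ?_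
    rw [← smul_sub, norm_smul, Real.norm_of_nonneg (φ.nonneg_normed t), mul_assoc]
    refine mul_le_mul_of_nonneg_left ?_ (φ.nonneg_normed t)
    have := hu.norm_sub_le (y - t) (x - t)
    simpa using this
  · exact (hφc.mul continuous_const).integrable_of_hasCompactSupport hφs.mul_right
  · filter_upwards [hdiff] with t ht
    have h1 : HasFDerivAt (fun y : E => u (y - t)) (fderiv ℝ u (x - t)) x := by
      have := ht.hasFDerivAt.comp x ((hasFDerivAt_id (𝕜 := ℝ) x).sub_const t)
      rwa [ContinuousLinearMap.comp_id] at this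
    exact h1.const_smul (φ.normed volume t)

theorem norm_bump_convolution_fderiv_le {u : E → ℝ} {L : ℝ≥0} (hu : LipschitzWith L u)
    (φ : ContDiffBump (0 : E)) (x : E) :
    ‖(φ.normed volume ⋆[lsmul ℝ ℝ, volume] fderiv ℝ u) x‖ ≤ L := by
  rw [convolution_lsmul]
  have hi : Integrable (fun t => φ.normed volume t * (L : ℝ)) (volume : Measure E) :=
    φ.integrable_normed.mul_const _
  refine (norm_integral_le_of_norm_le hi (ae_of_all _ fun t => ?_)).trans ?_
  · rw [norm_smul, Real.norm_of_nonneg (φ.nonneg_normed t)]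
    exact mul_le_mul_of_nonneg_left (norm_fderiv_le_of_lipschitz ℝ hu) (φ.nonneg_normed t)
  · rw [integral_mul_const, φ.integral_normed, one_mul]

/-- A compactly supported Lipschitz function can be approximated by smooth functions, supported
in a given neighbourhood, with derivatives close in `L²` of a given absolutely continuous
measure. -/
theorem exists_contDiff_fderiv_approx {m : Measure E} [IsFiniteMeasure m]
    (hm : m ≪ volume) {u : E → ℝ} {L : ℝ≥0} (hu : LipschitzWith L u) (hc : HasCompactSupport u)
    {Ω : Set E} (hΩ : IsOpen Ω) (hsub : tsupport u ⊆ Ω) {δ : ℝ≥0∞} (hδ : 0 < δ) :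
    ∃ ψ : E → ℝ, ContDiff ℝ ∞ ψ ∧ HasCompactSupport ψ ∧ tsupport ψ ⊆ Ω ∧
      ∫⁻ w, ‖fderiv ℝ u w - fderiv ℝ ψ w‖ₑ ^ 2 ∂m < δ := by
  let φ : ℕ → ContDiffBump (0 : E) := fun k =>
    ⟨1 / (2 * ((k : ℝ) + 1)), 1 / ((k : ℝ) + 1), by positivity, by
      gcongr; linarith [(by positivity : (0 : ℝ) < (k : ℝ) + 1)]⟩
  have hφ : Tendsto (fun k => (φ k).rOut) atTop (𝓝 0) := tendsto_one_div_add_atTop_nhds_zero_nat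
  -- Comparable radii are what almost everywhere convergence of the mollifications of a merely
  -- locally integrable function requires.
  have h'φ : ∀ᶠ k in atTop, (φ k).rOut ≤ 2 * (φ k).rIn := Eventually.of_forall fun k => by
    change 1 / ((k : ℝ) + 1) ≤ 2 * (1 / (2 * ((k : ℝ) + 1)))
    apply le_of_eq
    field_simp
  set ψ : ℕ → E → ℝ := fun k => (φ k).normed volume ⋆[lsmul ℝ ℝ, volume] u with hψ
  have hfd : ∀ k x, fderiv ℝ (ψ k) x
      = ((φ k).normed volume ⋆[lsmul ℝ ℝ, volume] fderiv ℝ u) x := fun k x =>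
    (hasFDerivAt_bump_convolution hu (φ k) x).fderiv
  have hae : ∀ᵐ x ∂m, Tendsto (fun k => fderiv ℝ (ψ k) x) atTop (𝓝 (fderiv ℝ u x)) := by
    refine hm.ae_le ?_
    filter_upwards [ContDiffBump.ae_convolution_tendsto_right_of_locallyIntegrable hφ h'φ
      (locallyIntegrable_fderiv_of_lipschitzWith hu)] with x hx
    simp only [hfd]
    exact hx
  have hlim : Tendsto (fun k => ∫⁻ w, ‖fderiv ℝ u w - fderiv ℝ (ψ k) w‖ₑ ^ 2 ∂m) atTop
      (𝓝 (∫⁻ _, 0 ∂m)) := by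
    refine tendsto_lintegral_of_dominated_convergence (fun _ => ENNReal.ofReal (L + L) ^ 2)
      (fun k => ?_) (fun k => ae_of_all _ fun w => ?_) ?_ ?_
    · exact ((measurable_fderiv ℝ u).sub (measurable_fderiv ℝ (ψ k))).enorm.pow_const 2
    · dsimp only
      gcongr
      rw [← ofReal_norm]
      gcongr
      refine (norm_sub_le _ _).trans (add_le_add (norm_fderiv_le_of_lipschitz ℝ hu) ?_)
      rw [hfd]
      exact norm_bump_convolution_fderiv_le hu (φ k) w
    · rw [lintegral_const]
      exact ENNReal.mul_ne_top (by simp) (measure_ne_top _ _)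
    · filter_upwards [hae] with w hw
      have h1 : Tendsto (fun k => ‖fderiv ℝ u w - fderiv ℝ (ψ k) w‖ₑ) atTop (𝓝 0) := by
        have h2 := ENNReal.tendsto_ofReal (tendsto_iff_norm_sub_tendsto_zero.1 hw)
        simp only [norm_sub_rev _ (fderiv ℝ u w), ofReal_norm, ENNReal.ofReal_zero] at h2
        exact h2
      have h3 := ((ENNReal.continuous_pow 2).tendsto _).comp h1
      rwa [zero_pow two_ne_zero] at h3
  rw [lintegral_zero] at hlim
  obtain ⟨r, hr0, hr⟩ := hc.isCompact.exists_cthickening_subset_open hΩ hsub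
  -- Convolution enlarges the support by at most the outer radius, so for large k it remains inside
  -- Ω.
  have hball : ∀ k, (φ k).rOut ≤ r → tsupport (ψ k) ⊆ Metric.cthickening r (tsupport u) := by
    intro k hk
    refine closure_minimal ?_ Metric.isClosed_cthickening
    refine (support_convolution_subset _).trans ?_
    rintro _ ⟨a, ha, b, hb, rfl⟩
    rw [(φ k).support_normed_eq, mem_ball_zero_iff] at ha
    refine Metric.mem_cthickening_of_dist_le (a + b) b r _ (subset_tsupport u hb) ?_
    rw [dist_eq_norm, add_sub_cancel_right]
    linarith
  obtain ⟨k, hk1, hk2⟩ := ((hlim.eventually_lt_const hδ).and (hφ.eventually_le_const hr0)).exists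
  refine ⟨ψ k, ?_, ?_, (hball k hk2).trans hr, hk1⟩
  · exact HasCompactSupport.contDiff_convolution_left _ (φ k).hasCompactSupport_normed
      (φ k).contDiff_normed hu.continuous.locallyIntegrable
  · exact HasCompactSupport.intro' hc.isCompact.cthickening Metric.isClosed_cthickening
      fun x hx => image_eq_zero_of_notMem_tsupport fun h => hx (hball k hk2 h)

end Mollification

/-! ### Differentials and Riemannian gradients in charts -/

section ChartCalculus

variable {n : ℕ} {X : Type*} [TopologicalSpace X] [ChartedSpace (EuclideanSpace ℝ (Fin n)) X]

theorem comp_extChartAt_symm_comp_eventuallyEq (h : X → ℝ) (x₀ : X) {x : X}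
    (hx : x ∈ (extChartAt (𝓡 n) x₀).source) :
    (h ∘ (extChartAt (𝓡 n) x₀).symm) ∘ extChartAt (𝓡 n) x₀ =ᶠ[𝓝 x] h := by
  filter_upwards [extChartAt_source_mem_nhds' hx] with y hy
  simp only [Function.comp_apply, (extChartAt (𝓡 n) x₀).left_inv hy]

variable [IsManifold (𝓡 n) ∞ X]

theorem extChartAt_symm_contMDiffAt (x₀ : X) {w : EuclideanSpace ℝ (Fin n)}
    (hw : w ∈ (extChartAt (𝓡 n) x₀).target) :
    ContMDiffAt 𝓘(ℝ, EuclideanSpace ℝ (Fin n)) (𝓡 n) ∞ (extChartAt (𝓡 n) x₀).symm w :=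
  (contMDiffOn_extChartAt_symm x₀).contMDiffAt
    ((isOpen_extChartAt_target (I := 𝓡 n) x₀).mem_nhds hw)

theorem extChartAt_contMDiffAt (x₀ : X) {x : X} (hx : x ∈ (extChartAt (𝓡 n) x₀).source) :
    ContMDiffAt (𝓡 n) 𝓘(ℝ, EuclideanSpace ℝ (Fin n)) ∞ (extChartAt (𝓡 n) x₀) x :=
  contMDiffAt_extChartAt' (by simpa using hx)

theorem mdifferentiableAt_iff_comp_extChartAt_symm (h : X → ℝ) (x₀ : X) {x : X}
    (hx : x ∈ (extChartAt (𝓡 n) x₀).source) :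
    MDifferentiableAt (𝓡 n) 𝓘(ℝ, ℝ) h x ↔
      DifferentiableAt ℝ (h ∘ (extChartAt (𝓡 n) x₀).symm) (extChartAt (𝓡 n) x₀ x) := by
  rw [← mdifferentiableAt_iff_differentiableAt]
  constructor
  · intro H
    have h1 := (extChartAt_symm_contMDiffAt x₀
      ((extChartAt (𝓡 n) x₀).map_source hx)).mdifferentiableAt (by simp)
    refine MDifferentiableAt.comp _ ?_ h1
    rwa [(extChartAt (𝓡 n) x₀).left_inv hx]
  · intro H
    have h1 := (extChartAt_contMDiffAt x₀ hx).mdifferentiableAt (by simp)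
    exact (H.comp x h1).congr_of_eventuallyEq
      (comp_extChartAt_symm_comp_eventuallyEq h x₀ hx).symm

/-- No differentiability is needed: it fails on both sides together, and both derivatives are then
zero. -/
theorem mfderiv_eq_fderiv_comp_extChartAt (h : X → ℝ) (x₀ : X) {x : X}
    (hx : x ∈ (extChartAt (𝓡 n) x₀).source) (v : TangentSpace (𝓡 n) x) :
    (mfderiv (𝓡 n) 𝓘(ℝ, ℝ) h x v : ℝ) =
      fderiv ℝ (h ∘ (extChartAt (𝓡 n) x₀).symm) (extChartAt (𝓡 n) x₀ x)
        (chartDeriv x₀ x v) := by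
  by_cases H : MDifferentiableAt (𝓡 n) 𝓘(ℝ, ℝ) h x
  · have h1 := (extChartAt_contMDiffAt x₀ hx).mdifferentiableAt (by simp)
    have h2 := (mdifferentiableAt_iff_comp_extChartAt_symm h x₀ hx).1 H
    have h3 := mfderiv_comp x h2.mdifferentiableAt h1
    rw [← (comp_extChartAt_symm_comp_eventuallyEq h x₀ hx).mfderiv_eq, h3, mfderiv_eq_fderiv]
    rfl
  · rw [mfderiv_zero_of_not_mdifferentiableAt H, fderiv_zero_of_not_differentiableAt]
    · rfl
    · rwa [← mdifferentiableAt_iff_comp_extChartAt_symm h x₀ hx]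

end ChartCalculus

section Gradient

variable {n : ℕ} {X : Type*} [TopologicalSpace X] [ChartedSpace (EuclideanSpace ℝ (Fin n)) X]
  [RiemannianBundle (fun x : X => TangentSpace (𝓡 n) x)]

theorem inner_riemGrad (h : X → ℝ) (x : X) (v : TangentSpace (𝓡 n) x) :
    inner ℝ (riemGrad (n := n) h x) v = (mfderiv (𝓡 n) 𝓘(ℝ, ℝ) h x v : ℝ) := by
  unfold riemGrad
  have : FiniteDimensional ℝ (TangentSpace (𝓡 n) x) :=
    inferInstanceAs (FiniteDimensional ℝ (EuclideanSpace ℝ (Fin n)))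
  have : CompleteSpace (TangentSpace (𝓡 n) x) := FiniteDimensional.complete ℝ _
  rw [InnerProductSpace.toDual_symm_apply]
  rfl

theorem eq_of_inner_riemGrad {h : X → ℝ} {x : X} {u : TangentSpace (𝓡 n) x}
    (H : ∀ v, inner ℝ u v = (mfderiv (𝓡 n) 𝓘(ℝ, ℝ) h x v : ℝ)) :
    riemGrad (n := n) h x = u := by
  refine ext_inner_right ℝ fun v => ?_
  rw [inner_riemGrad, H]

theorem riemGrad_congr {h k : X → ℝ} {x : X} (H : h =ᶠ[𝓝 x] k) :
    riemGrad (n := n) h x = riemGrad (n := n) k x := by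
  refine eq_of_inner_riemGrad fun v => ?_
  rw [inner_riemGrad, H.mfderiv_eq]
  rfl

theorem riemGrad_add {h k : X → ℝ} {x : X} (hh : MDifferentiableAt (𝓡 n) 𝓘(ℝ, ℝ) h x)
    (hk : MDifferentiableAt (𝓡 n) 𝓘(ℝ, ℝ) k x) :
    riemGrad (n := n) (h + k) x = riemGrad (n := n) h x + riemGrad (n := n) k x := by
  refine eq_of_inner_riemGrad fun v => ?_
  rw [inner_add_left, inner_riemGrad, inner_riemGrad, mfderiv_add hh hk]
  rfl

theorem riemGrad_zero (x : X) : riemGrad (n := n) (0 : X → ℝ) x = 0 := by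
  refine eq_of_inner_riemGrad fun v => ?_
  have : (mfderiv (𝓡 n) 𝓘(ℝ, ℝ) (0 : X → ℝ) x) = 0 := mfderiv_const
  rw [this, inner_zero_left]
  rfl

theorem riemGrad_of_notMem_tsupport {h : X → ℝ} {x : X} (hx : x ∉ tsupport h) :
    riemGrad (n := n) h x = 0 := by
  rw [← riemGrad_zero (n := n) x]
  exact riemGrad_congr (notMem_tsupport_iff_eventuallyEq.1 hx)

variable [IsManifold (𝓡 n) ∞ X]

theorem norm_riemGrad_sub_le (h k : X → ℝ) (x₀ : X) {x : X}
    (hx : x ∈ (extChartAt (𝓡 n) x₀).source) {C : ℝ} (hC0 : 0 ≤ C)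
    (hC : ∀ v : TangentSpace (𝓡 n) x, ‖chartDeriv x₀ x v‖ ≤ C * ‖v‖) :
    ‖riemGrad (n := n) h x - riemGrad (n := n) k x‖ ≤
      C * ‖fderiv ℝ (h ∘ (extChartAt (𝓡 n) x₀).symm) (extChartAt (𝓡 n) x₀ x)
        - fderiv ℝ (k ∘ (extChartAt (𝓡 n) x₀).symm) (extChartAt (𝓡 n) x₀ x)‖ := by
  set D := fderiv ℝ (h ∘ (extChartAt (𝓡 n) x₀).symm) (extChartAt (𝓡 n) x₀ x)
        - fderiv ℝ (k ∘ (extChartAt (𝓡 n) x₀).symm) (extChartAt (𝓡 n) x₀ x) with hD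
  set u := riemGrad (n := n) h x - riemGrad (n := n) k x with hu
  -- The difference of the gradients is tested against itself.
  have h1 : ‖u‖ * ‖u‖ ≤ C * ‖D‖ * ‖u‖ := by
    rw [← real_inner_self_eq_norm_mul_norm]
    nth_rewrite 1 [hu]
    rw [inner_sub_left, inner_riemGrad, inner_riemGrad, mfderiv_eq_fderiv_comp_extChartAt h x₀ hx,
      mfderiv_eq_fderiv_comp_extChartAt k x₀ hx]
    refine (le_abs_self _).trans ?_
    have h2 := D.le_opNorm (chartDeriv x₀ x u)
    have h3 := mul_le_mul_of_nonneg_left (hC u) (norm_nonneg D)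
    rw [mul_comm C, mul_assoc]
    exact h2.trans h3
  rcases (norm_nonneg u).eq_or_lt with h0 | h0
  · rw [← h0]; positivity
  · exact le_of_mul_le_mul_right h1 h0

end Gradient

/-! ### Locally Lipschitz functions on manifolds and Rademacher's theorem -/

section LocallyLipschitz

open scoped NNReal

/-- `f` is Lipschitz on some neighbourhood of `w`. -/
def LipschitzNear {E F : Type*} [PseudoMetricSpace E] [PseudoMetricSpace F] (f : E → F) (w : E) :
    Prop :=
  ∃ K : ℝ≥0, ∃ t ∈ 𝓝 w, LipschitzOnWith K f t

theorem LipschitzNear.congr {E F : Type*} [PseudoMetricSpace E] [PseudoMetricSpace F]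
    {f g : E → F} {w : E} (hf : LipschitzNear f w) (h : f =ᶠ[𝓝 w] g) : LipschitzNear g w := by
  obtain ⟨K, t, ht, hK⟩ := hf
  refine ⟨K, t ∩ {x | f x = g x}, inter_mem ht h, fun x hx y hy => ?_⟩
  rw [← hx.2, ← hy.2]
  exact hK hx.1 hy.1

theorem LipschitzNear.comp {E F G : Type*} [PseudoMetricSpace E] [PseudoMetricSpace F]
    [PseudoMetricSpace G] {g : F → G} {f : E → F} {w : E} (hg : LipschitzNear g (f w))
    (hf : LipschitzNear f w) : LipschitzNear (g ∘ f) w := by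
  obtain ⟨K, t, ht, hK⟩ := hf
  obtain ⟨L, s, hs, hL⟩ := hg
  have hc : ContinuousAt f w := hK.continuousOn.continuousAt ht
  exact ⟨L * K, t ∩ f ⁻¹' s, inter_mem ht (hc hs),
    hL.comp (hK.mono inter_subset_left) fun x hx => hx.2⟩

theorem LipschitzNear.mul {E : Type*} [PseudoMetricSpace E] {f g : E → ℝ} {w : E}
    (hf : LipschitzNear f w) (hg : LipschitzNear g w) : LipschitzNear (fun x => f x * g x) w := by
  obtain ⟨K, t, ht, hK⟩ := hf
  obtain ⟨L, s, hs, hL⟩ := hg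
  have hpair : LipschitzNear (fun x => (f x, g x)) w :=
    ⟨max K L, t ∩ s, inter_mem ht hs,
      (hK.mono inter_subset_left).prodMk (hL.mono inter_subset_right)⟩
  have hmul : LipschitzNear (fun p : ℝ × ℝ => p.1 * p.2) (f w, g w) :=
    (contDiff_mul (𝕜 := ℝ) (n := 1)).contDiffAt.exists_lipschitzOnWith
  exact LipschitzNear.comp (g := fun p : ℝ × ℝ => p.1 * p.2) (f := fun x => (f x, g x)) hmul hpair

variable {n : ℕ} {X : Type*} [TopologicalSpace X] [ChartedSpace (EuclideanSpace ℝ (Fin n)) X]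

variable (n) in
/-- A function which is locally Lipschitz in every preferred chart. -/
def LocallyLipschitzInCharts (h : X → ℝ) : Prop :=
  ∀ x₀ : X, ∀ w ∈ (extChartAt (𝓡 n) x₀).target,
    LipschitzNear (h ∘ (extChartAt (𝓡 n) x₀).symm) w

theorem LocallyLipschitz.comp_contMDiff [IsManifold (𝓡 n) ∞ X] {Y : Type*} [MetricSpace Y]
    [ChartedSpace (EuclideanSpace ℝ (Fin n)) Y] [IsManifold (𝓡 n) ∞ Y]
    [RiemannianBundle (fun y : Y => TangentSpace (𝓡 n) y)]
    [IsContMDiffRiemannianBundle (𝓡 n) ∞ (EuclideanSpace ℝ (Fin n))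
      (fun y : Y => TangentSpace (𝓡 n) y)]
    [IsRiemannianManifold (𝓡 n) Y] {g : Y → ℝ} (hg : LocallyLipschitz g) {T : X → Y}
    (hT : ContMDiff (𝓡 n) (𝓡 n) ∞ T) : LocallyLipschitzInCharts n (g ∘ T) := by
  intro x₀ w hw
  have h1 : ContMDiffAt 𝓘(ℝ, EuclideanSpace ℝ (Fin n)) (𝓡 n) 1
      (T ∘ (extChartAt (𝓡 n) x₀).symm) w :=
    (hT.contMDiffAt.comp w (extChartAt_symm_contMDiffAt x₀ hw)).of_le (by simp)
  have h2 : LipschitzNear (T ∘ (extChartAt (𝓡 n) x₀).symm) w :=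
    h1.exists_lipschitzOnWith_riemannian
  exact LipschitzNear.comp (g := g) (hg _) h2

variable [MeasurableSpace X] {μ : Measure X}

theorem ACInCharts.extChartAt (hμ : ACInCharts (n := n) μ) (x₀ : X) :
    (μ.restrict (extChartAt (𝓡 n) x₀).source).map (extChartAt (𝓡 n) x₀) ≪ volume := by
  have := hμ (chartAt (EuclideanSpace ℝ (Fin n)) x₀) (chart_mem_atlas _ x₀)
  rw [extChartAt_source]
  exact this

variable [BorelSpace X]

theorem aemeasurable_extChartAt (x₀ : X) :
    AEMeasurable (extChartAt (𝓡 n) x₀) (μ.restrict (extChartAt (𝓡 n) x₀).source) :=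
  (continuousOn_extChartAt (I := 𝓡 n) x₀).aemeasurable
    (isOpen_extChartAt_source (I := 𝓡 n) x₀).measurableSet

/-- Rademacher's theorem on a manifold. -/
theorem LocallyLipschitzInCharts.ae_mdifferentiableAt [IsManifold (𝓡 n) ∞ X]
    [SecondCountableTopology X] (hμ : ACInCharts (n := n) μ) {h : X → ℝ}
    (hh : LocallyLipschitzInCharts n h) :
    ∀ᵐ x ∂μ, MDifferentiableAt (𝓡 n) 𝓘(ℝ, ℝ) h x := by
  rw [ae_iff]
  refine measure_null_of_locally_null _ fun x₀ _ => ?_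
  have hw₀ := mem_extChartAt_target (I := 𝓡 n) x₀
  obtain ⟨K, t, ht, hK⟩ := hh x₀ _ hw₀
  -- The Euclidean theorem on t only gives differentiability within t; shrinking to the interior of
  -- t upgrades it to full differentiability.
  have hN := hK.ae_differentiableWithinAt_of_mem (μ := volume)
  have hN2 := ae_of_ae_map (aemeasurable_extChartAt (μ := μ) x₀) ((hμ.extChartAt x₀).ae_le hN)
  rw [ae_restrict_iff' (isOpen_extChartAt_source (I := 𝓡 n) x₀).measurableSet] at hN2
  have hcont := continuousAt_extChartAt (I := 𝓡 n) x₀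
  refine ⟨{x | ¬ MDifferentiableAt (𝓡 n) 𝓘(ℝ, ℝ) h x} ∩ ((extChartAt (𝓡 n) x₀).source ∩
    (extChartAt (𝓡 n) x₀) ⁻¹' interior t), inter_mem_nhdsWithin _
      (inter_mem (extChartAt_source_mem_nhds x₀) (hcont (interior_mem_nhds.2 ht))), ?_⟩
  refine measure_mono_null ?_ hN2
  rintro x ⟨hx1, hx2, hx3⟩
  simp only [mem_compl_iff, mem_ofPred_eq, Classical.not_imp] at hx1 ⊢
  refine ⟨hx2, interior_subset hx3, fun hd => hx1 ?_⟩
  rw [mdifferentiableAt_iff_comp_extChartAt_symm h x₀ hx2]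
  exact hd.differentiableAt (mem_interior_iff_mem_nhds.1 hx3)

end LocallyLipschitz

/-! ### Transfer of compactly supported functions through a chart -/

section ChartExtension

variable {n : ℕ} {X : Type*} [TopologicalSpace X]
  [ChartedSpace (EuclideanSpace ℝ (Fin n)) X]

/-- A function on the model space with compact support in the target of a chart, read on the
manifold and extended by zero. -/
noncomputable def chartPullback (x₀ : X) (u : EuclideanSpace ℝ (Fin n) → ℝ) : X → ℝ :=
  (extChartAt (𝓡 n) x₀).source.indicator (u ∘ extChartAt (𝓡 n) x₀)

/-- A function on the manifold with compact support in the source of a chart, read on the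
model space and extended by zero. -/
noncomputable def chartPushforward (x₀ : X) (k : X → ℝ) : EuclideanSpace ℝ (Fin n) → ℝ :=
  (extChartAt (𝓡 n) x₀).target.indicator (k ∘ (extChartAt (𝓡 n) x₀).symm)

theorem isCompact_symm_image_of_subset_target {x₀ : X} {Q : Set (EuclideanSpace ℝ (Fin n))}
    (hQ : IsCompact Q) (hQt : Q ⊆ (extChartAt (𝓡 n) x₀).target) :
    IsCompact ((extChartAt (𝓡 n) x₀).symm '' Q) :=
  hQ.image_of_continuousOn ((continuousOn_extChartAt_symm x₀).mono hQt)

theorem tsupport_chartPullback_subset [T2Space X] {x₀ : X} {u : EuclideanSpace ℝ (Fin n) → ℝ}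
    (hc : HasCompactSupport u) (hu : tsupport u ⊆ (extChartAt (𝓡 n) x₀).target) :
    tsupport (chartPullback x₀ u) ⊆ (extChartAt (𝓡 n) x₀).symm '' tsupport u := by
  refine closure_minimal ?_ (isCompact_symm_image_of_subset_target hc.isCompact hu).isClosed
  intro x hx
  have hx1 : x ∈ (extChartAt (𝓡 n) x₀).source := by
    by_contra hn
    exact hx (indicator_of_notMem hn _)
  refine ⟨extChartAt (𝓡 n) x₀ x, subset_tsupport u ?_, (extChartAt (𝓡 n) x₀).left_inv hx1⟩
  rwa [Function.mem_support, chartPullback, indicator_of_mem hx1] at hx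

theorem hasCompactSupport_chartPullback [T2Space X] {x₀ : X} {u : EuclideanSpace ℝ (Fin n) → ℝ}
    (hc : HasCompactSupport u) (hu : tsupport u ⊆ (extChartAt (𝓡 n) x₀).target) :
    HasCompactSupport (chartPullback x₀ u) :=
  (isCompact_symm_image_of_subset_target hc.isCompact hu).of_isClosed_subset
    (isClosed_tsupport _) (tsupport_chartPullback_subset hc hu)

theorem contMDiff_chartPullback [T2Space X] [IsManifold (𝓡 n) ∞ X] {x₀ : X}
    {u : EuclideanSpace ℝ (Fin n) → ℝ} (hus : ContDiff ℝ ∞ u)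
    (hc : HasCompactSupport u) (hu : tsupport u ⊆ (extChartAt (𝓡 n) x₀).target) :
    ContMDiff (𝓡 n) 𝓘(ℝ, ℝ) ∞ (chartPullback x₀ u) := by
  refine contMDiff_of_tsupport fun x hx => ?_
  obtain ⟨w, hw, rfl⟩ := tsupport_chartPullback_subset hc hu hx
  have hs := (extChartAt (𝓡 n) x₀).map_target (hu hw)
  refine (hus.contMDiff.contMDiffAt.comp _ (extChartAt_contMDiffAt x₀ hs)).congr_of_eventuallyEq ?_
  filter_upwards [extChartAt_source_mem_nhds' hs] with y hy
  rw [chartPullback, indicator_of_mem hy]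

theorem chartPullback_comp_symm_eventuallyEq {x₀ : X} (u : EuclideanSpace ℝ (Fin n) → ℝ)
    {w : EuclideanSpace ℝ (Fin n)} (hw : w ∈ (extChartAt (𝓡 n) x₀).target) :
    chartPullback x₀ u ∘ (extChartAt (𝓡 n) x₀).symm =ᶠ[𝓝 w] u := by
  filter_upwards [(isOpen_extChartAt_target (I := 𝓡 n) x₀).mem_nhds hw] with z hz
  rw [Function.comp_apply, chartPullback,
    indicator_of_mem ((extChartAt (𝓡 n) x₀).map_target hz), Function.comp_apply,
    (extChartAt (𝓡 n) x₀).right_inv hz]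

theorem chartPushforward_eventuallyEq {x₀ : X} (k : X → ℝ)
    {w : EuclideanSpace ℝ (Fin n)} (hw : w ∈ (extChartAt (𝓡 n) x₀).target) :
    chartPushforward x₀ k =ᶠ[𝓝 w] k ∘ (extChartAt (𝓡 n) x₀).symm := by
  filter_upwards [(isOpen_extChartAt_target (I := 𝓡 n) x₀).mem_nhds hw] with z hz
  rw [chartPushforward, indicator_of_mem hz]

theorem tsupport_chartPushforward_subset {x₀ : X} {k : X → ℝ}
    (hc : HasCompactSupport k) (hk : tsupport k ⊆ (extChartAt (𝓡 n) x₀).source) :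
    IsCompact (extChartAt (𝓡 n) x₀ '' tsupport k) ∧
      tsupport (chartPushforward (n := n) x₀ k) ⊆ extChartAt (𝓡 n) x₀ '' tsupport k := by
  have hQ : IsCompact (extChartAt (𝓡 n) x₀ '' tsupport k) :=
    hc.isCompact.image_of_continuousOn ((continuousOn_extChartAt x₀).mono hk)
  refine ⟨hQ, closure_minimal ?_ hQ.isClosed⟩
  intro w hw
  have hw1 : w ∈ (extChartAt (𝓡 n) x₀).target := by
    by_contra hn
    exact hw (indicator_of_notMem hn _)
  refine ⟨(extChartAt (𝓡 n) x₀).symm w, subset_tsupport k ?_, (extChartAt (𝓡 n) x₀).right_inv hw1⟩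
  rwa [Function.mem_support, chartPushforward, indicator_of_mem hw1] at hw

theorem locallyLipschitz_chartPushforward {x₀ : X} {k : X → ℝ}
    (hc : HasCompactSupport k) (hk : tsupport k ⊆ (extChartAt (𝓡 n) x₀).source)
    (hl : ∀ w ∈ (extChartAt (𝓡 n) x₀).target,
      LipschitzNear (k ∘ (extChartAt (𝓡 n) x₀).symm) w) :
    LocallyLipschitz (chartPushforward (n := n) x₀ k) := by
  intro w
  by_cases hw : w ∈ (extChartAt (𝓡 n) x₀).target
  · exact (hl w hw).congr (chartPushforward_eventuallyEq k hw).symm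
  · have hw' : w ∉ tsupport (chartPushforward (n := n) x₀ k) := fun h => by
      obtain ⟨x, hx, rfl⟩ := (tsupport_chartPushforward_subset hc hk).2 h
      exact hw ((extChartAt (𝓡 n) x₀).map_source (hk hx))
    refine LipschitzNear.congr (f := fun _ => 0) ⟨0, univ, univ_mem, ?_⟩
      (notMem_tsupport_iff_eventuallyEq.1 hw').symm
    exact (LipschitzWith.const 0).lipschitzOnWith

end ChartExtension

/-! ### Approximation by smooth gradients -/

section Approximation

variable {n : ℕ} {X : Type*} [TopologicalSpace X] [ChartedSpace (EuclideanSpace ℝ (Fin n)) X]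
  [RiemannianBundle (fun x : X => TangentSpace (𝓡 n) x)] [MeasurableSpace X]

variable (n) in
/-- The gradient of `k` is an `L²(μ)`-limit of gradients of compactly supported smooth functions;
the distances are bounded by measurable functions. -/
def GradApproximable (μ : Measure X) (k : X → ℝ) : Prop :=
  ∀ δ : ℝ≥0∞, 0 < δ → ∃ ψ : X → ℝ, ContMDiff (𝓡 n) 𝓘(ℝ, ℝ) ∞ ψ ∧ HasCompactSupport ψ ∧
    ∃ G : X → ℝ≥0∞, AEMeasurable G μ ∧
      (∀ᵐ x ∂μ, ‖riemGrad (n := n) k x - riemGrad (n := n) ψ x‖ₑ ^ 2 ≤ G x) ∧ ∫⁻ x, G x ∂μ < δ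

variable {μ : Measure X}

theorem GradApproximable.congr {h k : X → ℝ} (hk : GradApproximable n μ k)
    (H : ∀ᵐ x ∂μ, h =ᶠ[𝓝 x] k) : GradApproximable n μ h := by
  intro δ hδ
  obtain ⟨ψ, h1, h2, G, h3, h4, h5⟩ := hk δ hδ
  refine ⟨ψ, h1, h2, G, h3, ?_, h5⟩
  filter_upwards [h4, H] with x hx hx'
  rwa [riemGrad_congr hx']

theorem GradApproximable.zero : GradApproximable n μ (0 : X → ℝ) := by
  intro δ hδ
  exact ⟨0, contMDiff_const, HasCompactSupport.zero, 0, aemeasurable_const, by simp, by simpa⟩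

theorem ENNReal.sq_add_le (a b : ℝ≥0∞) : (a + b) ^ 2 ≤ 4 * (a ^ 2 + b ^ 2) := by
  have h1 : a + b ≤ 2 * max a b := by
    rw [two_mul]
    exact add_le_add (le_max_left _ _) (le_max_right _ _)
  calc (a + b) ^ 2 ≤ (2 * max a b) ^ 2 := by gcongr
    _ = 4 * (max a b) ^ 2 := by rw [mul_pow]; norm_num
    _ ≤ 4 * (a ^ 2 + b ^ 2) := by
      gcongr
      rcases le_total a b with h | h
      · rw [max_eq_right h]; exact le_add_self
      · rw [max_eq_left h]; exact le_self_add

theorem GradApproximable.add {h k : X → ℝ} (hh : GradApproximable n μ h)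
    (hk : GradApproximable n μ k) (hhd : ∀ᵐ x ∂μ, MDifferentiableAt (𝓡 n) 𝓘(ℝ, ℝ) h x)
    (hkd : ∀ᵐ x ∂μ, MDifferentiableAt (𝓡 n) 𝓘(ℝ, ℝ) k x) : GradApproximable n μ (h + k) := by
  intro δ hδ
  -- The constant 4 of `ENNReal.sq_add_le` times two summands.
  have hδ8 : 0 < δ / 8 := ENNReal.div_pos hδ.ne' (by norm_num)
  obtain ⟨ψ, h1, h2, G, h3, h4, h5⟩ := hh _ hδ8
  obtain ⟨ψ', h1', h2', G', h3', h4', h5'⟩ := hk _ hδ8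
  refine ⟨ψ + ψ', h1.add h1', h2.add h2', fun x => 4 * (G x + G' x),
    (h3.add h3').const_mul _, ?_, ?_⟩
  · filter_upwards [h4, h4', hhd, hkd] with x a b c d
    have e1 := (h1 x).mdifferentiableAt (by simp)
    have e2 := (h1' x).mdifferentiableAt (by simp)
    rw [riemGrad_add c d, riemGrad_add e1 e2, add_sub_add_comm]
    calc _ ≤ (‖riemGrad (n := n) h x - riemGrad (n := n) ψ x‖ₑ
          + ‖riemGrad (n := n) k x - riemGrad (n := n) ψ' x‖ₑ) ^ 2 := by
          gcongr; exact enorm_add_le _ _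
      _ ≤ _ := (ENNReal.sq_add_le _ _).trans (by gcongr)
  -- Additivity of the lower integral uses measurability of the majorant G; this is why majorants
  -- are carried along.
  · have e1 : ∫⁻ x, 4 * (G x + G' x) ∂μ = 4 * (∫⁻ x, G x ∂μ + ∫⁻ x, G' x ∂μ) := by
      rw [lintegral_const_mul' _ _ (by norm_num), lintegral_add_left' h3]
    refine e1.trans_lt ?_
    calc 4 * (∫⁻ x, G x ∂μ + ∫⁻ x, G' x ∂μ) < 4 * (δ / 8 + δ / 8) :=
by
          have h6 := ENNReal.add_lt_add h5 h5'
          gcongr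
          norm_num
      _ ≤ δ := by
        have h7 : (4 : ℝ≥0∞) * (δ / 8 + δ / 8) = 8 * (δ / 8) := by
          rw [← two_mul, ← mul_assoc]
          norm_num
        rw [h7, ENNReal.mul_div_cancel (by norm_num) (by norm_num)]

theorem GradApproximable.sum {ι : Type*} (s : Finset ι) {k : ι → X → ℝ}
    (h : ∀ i ∈ s, GradApproximable n μ (k i))
    (hd : ∀ i ∈ s, ∀ᵐ x ∂μ, MDifferentiableAt (𝓡 n) 𝓘(ℝ, ℝ) (k i) x) :
    GradApproximable n μ (∑ i ∈ s, k i) ∧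
      ∀ᵐ x ∂μ, MDifferentiableAt (𝓡 n) 𝓘(ℝ, ℝ) (∑ i ∈ s, k i) x := by
  classical
  induction s using Finset.induction_on with
  | empty =>
    simp only [Finset.sum_empty]
    exact ⟨.zero, .of_forall fun x => mdifferentiableAt_const⟩
  | insert a s ha ih =>
    obtain ⟨i1, i2⟩ := ih (fun i hi => h i (Finset.mem_insert_of_mem hi))
      fun i hi => hd i (Finset.mem_insert_of_mem hi)
    have j1 := h a (Finset.mem_insert_self _ _)
    have j2 := hd a (Finset.mem_insert_self _ _)
    rw [Finset.sum_insert ha]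
    refine ⟨j1.add i1 j2 i2, ?_⟩
    filter_upwards [j2, i2] with x a b using a.add b

variable [IsManifold (𝓡 n) ∞ X] [T2Space X] [BorelSpace X]

/-- The function is read in the chart, mollified there for the image measure, and pulled back; the
bound on `chartDeriv` costs a factor C² in the squared distance. -/
theorem gradApproximable_of_tsupport_subset [IsFiniteMeasure μ] (hμ : ACInCharts (n := n) μ)
    {k : X → ℝ} (hc : HasCompactSupport k) (x₀ : X) {U : Set X} (hUo : IsOpen U)
    (hUs : U ⊆ (extChartAt (𝓡 n) x₀).source) (hkU : tsupport k ⊆ U) {C : ℝ} (hC0 : 0 < C)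
    (hC : ∀ y ∈ U, ∀ v : TangentSpace (𝓡 n) y, ‖chartDeriv x₀ y v‖ ≤ C * ‖v‖)
    (hl : ∀ w ∈ (extChartAt (𝓡 n) x₀).target,
      LipschitzNear (k ∘ (extChartAt (𝓡 n) x₀).symm) w) : GradApproximable n μ k := by
  intro δ hδ
  set e := extChartAt (𝓡 n) x₀ with he
  have hso : IsOpen e.source := isOpen_extChartAt_source (I := 𝓡 n) x₀
  -- Confining the mollified function to the image of U makes both gradients vanish off U, so the
  -- bound C is only needed there.
  have hΩo : IsOpen (e.target ∩ e.symm ⁻¹' U) :=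
    (continuousOn_extChartAt_symm x₀).isOpen_inter_preimage
      (isOpen_extChartAt_target (I := 𝓡 n) x₀) hUo
  have hks := hkU.trans hUs
  obtain ⟨hQ, hQs⟩ := tsupport_chartPushforward_subset (n := n) hc hks
  have hul := locallyLipschitz_chartPushforward (n := n) hc hks hl
  set u := chartPushforward (n := n) x₀ k with hu
  have huc : HasCompactSupport u := hQ.of_isClosed_subset (isClosed_tsupport _) hQs
  obtain ⟨L, hL⟩ := hul.exists_lipschitzWith_of_hasCompactSupport huc
  have hC2 : ENNReal.ofReal (C ^ 2) ≠ 0 := by simpa using hC0.ne'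
  obtain ⟨ψ, hψs, hψc, hψt, hψ⟩ := exists_contDiff_fderiv_approx
    (m := (μ.restrict e.source).map e) (hμ.extChartAt x₀) hL huc hΩo (u := u) (by
      rintro w hw
      obtain ⟨x, hx, rfl⟩ := hQs hw
      refine ⟨e.map_source (hks hx), ?_⟩
      rw [mem_preimage, e.left_inv (hks hx)]
      exact hkU hx) (δ := δ / ENNReal.ofReal (C ^ 2)) (ENNReal.div_pos hδ.ne' ENNReal.ofReal_ne_top)
  have hψt' := hψt.trans inter_subset_left
  have hts : tsupport (chartPullback x₀ ψ) ⊆ U := by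
    intro x hx
    obtain ⟨w, hw, rfl⟩ := tsupport_chartPullback_subset hψc hψt' hx
    exact (hψt hw).2
  have hF : Measurable fun w => ENNReal.ofReal (C ^ 2) * ‖fderiv ℝ u w - fderiv ℝ ψ w‖ₑ ^ 2 :=
    ((((measurable_fderiv ℝ u).sub (measurable_fderiv ℝ ψ)).enorm).pow_const 2).const_mul _
  refine ⟨chartPullback x₀ ψ, contMDiff_chartPullback hψs hψc hψt',
    hasCompactSupport_chartPullback hψc hψt', e.source.indicator
      (fun x => ENNReal.ofReal (C ^ 2) * ‖fderiv ℝ u (e x) - fderiv ℝ ψ (e x)‖ₑ ^ 2), ?_, ?_, ?_⟩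
  · rw [aemeasurable_indicator_iff hso.measurableSet]
    exact hF.comp_aemeasurable (aemeasurable_extChartAt x₀)
  · refine .of_forall fun x => ?_
    by_cases hx : x ∈ U
    · rw [indicator_of_mem (hUs hx)]
      have h1 := norm_riemGrad_sub_le k (chartPullback x₀ ψ) x₀ (hUs hx) hC0.le (hC x hx)
      have hxt := e.map_source (hUs hx)
      rw [(chartPullback_comp_symm_eventuallyEq ψ hxt).fderiv_eq,
        ← (chartPushforward_eventuallyEq k hxt).fderiv_eq] at h1
      have h2 : ‖riemGrad (n := n) k x - riemGrad (n := n) (chartPullback x₀ ψ) x‖ₑ ≤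
          ENNReal.ofReal C * ‖fderiv ℝ u (e x) - fderiv ℝ ψ (e x)‖ₑ := by
        rw [← ofReal_norm, ← ofReal_norm, ← ENNReal.ofReal_mul hC0.le]
        exact ENNReal.ofReal_le_ofReal h1
      rw [ENNReal.ofReal_pow hC0.le, ← mul_pow]
      gcongr
    · rw [riemGrad_of_notMem_tsupport fun h => hx (hkU h),
        riemGrad_of_notMem_tsupport fun h => hx (hts h)]
      simp
  · rw [lintegral_indicator hso.measurableSet]
    have := lintegral_map' (hF.aemeasurable) (aemeasurable_extChartAt (n := n) (μ := μ) x₀)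
    rw [← this, lintegral_const_mul' _ _ ENNReal.ofReal_ne_top]
    rwa [ENNReal.lt_div_iff_mul_lt (.inl hC2) (.inl ENNReal.ofReal_ne_top), mul_comm] at hψ

theorem LocallyLipschitzInCharts.gradApproximable [SecondCountableTopology X]
    [IsContMDiffRiemannianBundle (𝓡 n) ∞ (EuclideanSpace ℝ (Fin n))
      (fun x : X => TangentSpace (𝓡 n) x)] [IsFiniteMeasure μ] (hμ : ACInCharts (n := n) μ)
    {K : Set X} (hK : IsCompact K) (hμK : μ Kᶜ = 0) {h : X → ℝ}
    (hh : LocallyLipschitzInCharts n h) : GradApproximable n μ h := by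
  have : LocallyCompactSpace X := ChartedSpace.locallyCompactSpace (EuclideanSpace ℝ (Fin n)) X
  have hgood : ∀ x₀ : X, ∃ V C, IsOpen V ∧ x₀ ∈ V ∧ V ⊆ (extChartAt (𝓡 n) x₀).source ∧ 0 < C ∧
      ∀ y ∈ V, ∀ v : TangentSpace (𝓡 n) y, ‖chartDeriv x₀ y v‖ ≤ C * ‖v‖ := by
    intro x₀
    obtain ⟨C, hC0, hC⟩ := exists_norm_chartDeriv_le (n := n) x₀
    obtain ⟨V, hV, hVo, hx₀⟩ := mem_nhds_iff.1
      (inter_mem hC (extChartAt_source_mem_nhds (I := 𝓡 n) x₀))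
    exact ⟨V, C, hVo, hx₀, fun y hy => (hV hy).2, hC0, fun y hy => (hV hy).1⟩
  choose V C hVo hxV hVs hC0 hC using hgood
  have hcpt : ∀ x₀ : X, ∃ Q, IsCompact Q ∧ x₀ ∈ interior Q ∧ Q ⊆ V x₀ := fun x₀ =>
    exists_compact_subset (hVo x₀) (hxV x₀)
  choose Q hQ hxQ hQV using hcpt
  obtain ⟨p, hp⟩ := SmoothPartitionOfUnity.exists_isSubordinate (𝓡 n) isClosed_univ
    (fun x₀ => interior (Q x₀)) (fun _ => isOpen_interior)
    (fun x _ => mem_iUnion.2 ⟨x, hxQ x⟩)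
  have hlf : LocallyFinite fun i => tsupport (p i) := p.locallyFinite.closure
  have hJ := hlf.finite_nonempty_inter_compact hK
  set J := hJ.toFinset with hJdef
  have hpc : ∀ i, HasCompactSupport (fun x => p i x * h x) := fun i =>
    (HasCompactSupport.of_support_subset_isCompact (hQ i) ((subset_tsupport _).trans
      ((hp i).trans interior_subset))).mul_right
  have hps : ∀ i, tsupport (fun x => p i x * h x) ⊆ V i := fun i =>
    (tsupport_mul_subset_left (f := p i) (g := h)).trans
      ((hp i).trans (interior_subset.trans (hQV i)))
  have hpl : ∀ i, LocallyLipschitzInCharts n fun x => p i x * h x := by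
    intro i x₀ w hw
    have h1 : ContMDiffAt 𝓘(ℝ, EuclideanSpace ℝ (Fin n)) 𝓘(ℝ, ℝ) 1
        (p i ∘ (extChartAt (𝓡 n) x₀).symm) w :=
      ((p i).contMDiff.contMDiffAt.comp w (extChartAt_symm_contMDiffAt x₀ hw)).of_le (by simp)
    exact LipschitzNear.mul h1.contDiffAt.exists_lipschitzOnWith (hh x₀ w hw)
  have hsum := (GradApproximable.sum J (k := fun i x => p i x * h x) (fun i _ =>
    gradApproximable_of_tsupport_subset hμ (hpc i) i (hVo i) (hVs i) (hps i) (hC0 i) (hC i)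
      (hpl i i)) fun i _ => (hpl i).ae_mdifferentiableAt hμ).1
  refine hsum.congr ?_
  filter_upwards [measure_eq_zero_iff_ae_notMem.1 hμK] with x hxK
  rw [mem_compl_iff, not_not] at hxK
  -- Gradients depend on germs, so the finite sum must equal h on a neighbourhood of x. Local
  -- finiteness makes the union of the other supports closed, and it misses x ∈ K.
  have hclosed : IsClosed (⋃ i : {i // i ∉ J}, tsupport (p i)) :=
    (hlf.comp_injective Subtype.val_injective).isClosed_iUnion fun i => isClosed_tsupport _
  have hxn : x ∉ ⋃ i : {i // i ∉ J}, tsupport (p i) := by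
    intro hx
    obtain ⟨⟨i, hi⟩, hxi⟩ := mem_iUnion.1 hx
    exact hi (hJ.mem_toFinset.2 ⟨x, hxi, hxK⟩)
  filter_upwards [hclosed.isOpen_compl.mem_nhds hxn] with y hy
  have h1 : ∑ᶠ i, p i y = ∑ i ∈ J, p i y := by
    refine finsum_eq_sum_of_support_subset _ fun i hi => ?_
    by_contra hiJ
    exact hy (mem_iUnion.2 ⟨⟨i, hiJ⟩, subset_tsupport _ hi⟩)
  rw [Finset.sum_apply, ← Finset.sum_mul, ← h1, p.sum_eq_one (mem_univ y), one_mul]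

end Approximation

/-! ### Measurability of the gradient field -/

section Measurability

variable {n : ℕ} {X : Type*} [TopologicalSpace X] [ChartedSpace (EuclideanSpace ℝ (Fin n)) X]
  [IsManifold (𝓡 n) ∞ X]

theorem chartDeriv_symmL (x₀ : X) {x : X} (hx : x ∈ (extChartAt (𝓡 n) x₀).source)
    (a : EuclideanSpace ℝ (Fin n)) :
    chartDeriv x₀ x ((trivializationAt (EuclideanSpace ℝ (Fin n)) (TangentSpace (𝓡 n)) x₀).symmL
      ℝ x a) = a := by
  have : IsManifold (𝓡 n) 1 X := IsManifold.of_le (n := ∞) (by simp)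
  rw [extChartAt_source] at hx
  have h := TangentBundle.continuousLinearMapAt_trivializationAt (I := 𝓡 n) hx
  unfold chartDeriv
  rw [← h]
  exact Trivialization.continuousLinearMapAt_symmL _ hx a

theorem symmL_chartDeriv (x₀ : X) {x : X} (hx : x ∈ (extChartAt (𝓡 n) x₀).source)
    (v : TangentSpace (𝓡 n) x) :
    (trivializationAt (EuclideanSpace ℝ (Fin n)) (TangentSpace (𝓡 n)) x₀).symmL
      ℝ x (chartDeriv x₀ x v) = v := by
  have : IsManifold (𝓡 n) 1 X := IsManifold.of_le (n := ∞) (by simp)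
  rw [extChartAt_source] at hx
  have h := TangentBundle.continuousLinearMapAt_trivializationAt (I := 𝓡 n) hx
  unfold chartDeriv
  rw [← h]
  exact Trivialization.symmL_continuousLinearMapAt _ hx v

variable [RiemannianBundle (fun x : X => TangentSpace (𝓡 n) x)]

/-- The Riemannian metric read in the preferred chart at `x₀`. -/
noncomputable def chartMetric (x₀ x : X) :
    EuclideanSpace ℝ (Fin n) →L[ℝ] EuclideanSpace ℝ (Fin n) →L[ℝ] ℝ :=
  (innerSL ℝ : TangentSpace (𝓡 n) x →L[ℝ] TangentSpace (𝓡 n) x →L[ℝ] ℝ).bilinearComp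
    ((trivializationAt (EuclideanSpace ℝ (Fin n)) (TangentSpace (𝓡 n)) x₀).symmL ℝ x)
    ((trivializationAt (EuclideanSpace ℝ (Fin n)) (TangentSpace (𝓡 n)) x₀).symmL ℝ x)

theorem chartMetric_apply (x₀ x : X) (a b : EuclideanSpace ℝ (Fin n)) :
    chartMetric x₀ x a b = inner ℝ
      ((trivializationAt (EuclideanSpace ℝ (Fin n)) (TangentSpace (𝓡 n)) x₀).symmL ℝ x a)
      ((trivializationAt (EuclideanSpace ℝ (Fin n)) (TangentSpace (𝓡 n)) x₀).symmL ℝ x b) :=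
  rfl

/-- Positive definiteness gives injectivity, and a finite-dimensional space and its dual have equal
dimension. -/
theorem exists_equiv_chartMetric (x₀ : X) {x : X} (hx : x ∈ (extChartAt (𝓡 n) x₀).source) :
    ∃ L : EuclideanSpace ℝ (Fin n) ≃L[ℝ] (EuclideanSpace ℝ (Fin n) →L[ℝ] ℝ),
      (L : EuclideanSpace ℝ (Fin n) →L[ℝ] EuclideanSpace ℝ (Fin n) →L[ℝ] ℝ) =
        chartMetric x₀ x := by
  have hinj : Function.Injective (chartMetric (n := n) x₀ x) := by
    rw [injective_iff_map_eq_zero]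
    intro a ha
    have h1 : chartMetric x₀ x a a = 0 := by rw [ha]; rfl
    rw [chartMetric_apply, inner_self_eq_zero] at h1
    rw [← chartDeriv_symmL x₀ hx a, h1, map_zero]
  have hfin : Module.finrank ℝ (EuclideanSpace ℝ (Fin n)) =
      Module.finrank ℝ (EuclideanSpace ℝ (Fin n) →L[ℝ] ℝ) :=
    (InnerProductSpace.toDual ℝ (EuclideanSpace ℝ (Fin n))).toLinearEquiv.finrank_eq
  refine ⟨(LinearMap.linearEquivOfInjective (chartMetric (n := n) x₀ x : _ →ₗ[ℝ] _) hinj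
    hfin).toContinuousLinearEquiv, ?_⟩
  ext a b
  rfl

/-- The coordinate formula for the gradient, inverse metric applied to the differential. It reduces
measurability to continuity of the inverse metric and measurability of `fderiv`, which holds for
arbitrary h. -/
theorem chartDeriv_riemGrad (h : X → ℝ) (x₀ : X) {x : X}
    (hx : x ∈ (extChartAt (𝓡 n) x₀).source) :
    chartDeriv x₀ x (riemGrad (n := n) h x) = (chartMetric x₀ x).inverse
      (fderiv ℝ (h ∘ (extChartAt (𝓡 n) x₀).symm) (extChartAt (𝓡 n) x₀ x)) := by
  obtain ⟨L, hL⟩ := exists_equiv_chartMetric (n := n) x₀ hx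
  have h1 : fderiv ℝ (h ∘ (extChartAt (𝓡 n) x₀).symm) (extChartAt (𝓡 n) x₀ x) =
      chartMetric x₀ x (chartDeriv x₀ x (riemGrad (n := n) h x)) := by
    ext b
    rw [chartMetric_apply, symmL_chartDeriv x₀ hx, inner_riemGrad,
      mfderiv_eq_fderiv_comp_extChartAt h x₀ hx, chartDeriv_symmL x₀ hx]
  rw [h1, ← hL, ContinuousLinearMap.inverse_equiv]
  exact (L.symm_apply_apply _).symm

variable [IsContMDiffRiemannianBundle (𝓡 n) ∞ (EuclideanSpace ℝ (Fin n))
  (fun x : X => TangentSpace (𝓡 n) x)]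

theorem continuousOn_chartMetric (x₀ : X) :
    ContinuousOn (chartMetric (n := n) x₀) (extChartAt (𝓡 n) x₀).source := by
  have := isContinuousRiemannianBundle_tangentSpace n X
  have hs : ∀ a : EuclideanSpace ℝ (Fin n), ContinuousOn (fun x => TotalSpace.mk'
      (EuclideanSpace ℝ (Fin n)) (E := fun x : X => TangentSpace (𝓡 n) x) x
      ((trivializationAt (EuclideanSpace ℝ (Fin n)) (TangentSpace (𝓡 n)) x₀).symmL ℝ x a))
      (extChartAt (𝓡 n) x₀).source := by
    intro a
    refine ((Trivialization.continuousOn_symm (trivializationAt (EuclideanSpace ℝ (Fin n))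
      (TangentSpace (𝓡 n)) x₀)).comp (f := fun x => (x, a))
      (continuous_id.prodMk continuous_const).continuousOn ?_).congr ?_
    · intro x hx
      rw [extChartAt_source] at hx
      exact ⟨hx, mem_univ _⟩
    · intro x hx
      rw [extChartAt_source] at hx
      exact congrArg _ (Trivialization.symmL_apply _ hx a)
  rw [continuousOn_clm_apply]
  intro a
  rw [continuousOn_clm_apply]
  intro b
  exact (hs a).inner_bundle (hs b)

theorem continuousOn_inverse_chartMetric (x₀ : X) :
    ContinuousOn (fun x => (chartMetric (n := n) x₀ x).inverse) (extChartAt (𝓡 n) x₀).source := by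
  intro x hx
  obtain ⟨L, hL⟩ := exists_equiv_chartMetric (n := n) x₀ hx
  have h1 := (contDiffAt_map_inverse (𝕜 := ℝ) (n := 0) L).continuousAt
  rw [hL] at h1
  exact h1.comp_continuousWithinAt (continuousOn_chartMetric x₀ x hx)

variable [SecondCountableTopology X] [MeasurableSpace X] [BorelSpace X]

theorem aemeasurable_riemGrad (μ : Measure X) (h : X → ℝ) :
    @AEMeasurable X (TangentBundle (𝓡 n) X) (borel _) _ (fun x => ⟨x, riemGrad (n := n) h x⟩) μ := by
  let _ : MeasurableSpace (TangentBundle (𝓡 n) X) := borel _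
  have : BorelSpace (TangentBundle (𝓡 n) X) := ⟨rfl⟩
  obtain ⟨s, hs, hsU⟩ := TopologicalSpace.countable_cover_nhds
    fun x₀ : X => extChartAt_source_mem_nhds (I := 𝓡 n) x₀
  have := hs.to_subtype
  rw [← Measure.restrict_univ (μ := μ), ← hsU, biUnion_eq_iUnion]
  refine aemeasurable_iUnion_iff.2 fun ⟨x₀, _⟩ => ?_
  have hso : MeasurableSet (extChartAt (𝓡 n) x₀).source :=
    (isOpen_extChartAt_source (I := 𝓡 n) x₀).measurableSet
  set m := μ.restrict (extChartAt (𝓡 n) x₀).source with hm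
  have h1 : AEMeasurable (fun x => (chartMetric (n := n) x₀ x).inverse) m :=
    (continuousOn_inverse_chartMetric x₀).aemeasurable hso
  have h2 : AEMeasurable (fun x =>
      fderiv ℝ (h ∘ (extChartAt (𝓡 n) x₀).symm) (extChartAt (𝓡 n) x₀ x)) m :=
    (measurable_fderiv ℝ _).comp_aemeasurable (aemeasurable_extChartAt x₀)
  have h3 : AEMeasurable (fun x => (x, (chartMetric (n := n) x₀ x).inverse
      (fderiv ℝ (h ∘ (extChartAt (𝓡 n) x₀).symm) (extChartAt (𝓡 n) x₀ x)))) m := by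
    refine aemeasurable_id.prodMk ?_
    exact (show Continuous fun p : ((EuclideanSpace ℝ (Fin n) →L[ℝ] ℝ) →L[ℝ]
      EuclideanSpace ℝ (Fin n)) × (EuclideanSpace ℝ (Fin n) →L[ℝ] ℝ) => p.1 p.2 by
        fun_prop).measurable.comp_aemeasurable (h1.prodMk h2)
  have hΦ := Trivialization.continuousOn_symm (trivializationAt (EuclideanSpace ℝ (Fin n))
      (TangentSpace (𝓡 n)) x₀)
  have hS : MeasurableSet ((trivializationAt (EuclideanSpace ℝ (Fin n))
      (TangentSpace (𝓡 n)) x₀).baseSet ×ˢ (univ : Set (EuclideanSpace ℝ (Fin n)))) :=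
    (Trivialization.open_baseSet _).measurableSet.prod MeasurableSet.univ
  have hmem : ∀ᵐ x ∂m, x ∈ (extChartAt (𝓡 n) x₀).source := ae_restrict_mem hso
  have h4 := hΦ.aemeasurable hS (μ := m.map fun x => (x, (chartMetric (n := n) x₀ x).inverse
      (fderiv ℝ (h ∘ (extChartAt (𝓡 n) x₀).symm) (extChartAt (𝓡 n) x₀ x))))
  -- The inverse trivialisation is controlled only over its base set, which carries the image
  -- measure.
  rw [Measure.restrict_eq_self_of_ae_mem] at h4
  · refine (h4.comp_aemeasurable h3).congr ?_
    filter_upwards [hmem] with x hx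
    rw [Function.comp_apply, ← chartDeriv_riemGrad h x₀ hx]
    refine congrArg _ (Eq.trans (Trivialization.symmL_apply (R := ℝ) _ ?_ _).symm
      (symmL_chartDeriv x₀ hx _))
    rwa [extChartAt_source] at hx
  · refine (ae_map_iff h3 hS).2 ?_
    filter_upwards [hmem] with x hx
    rw [extChartAt_source] at hx
    exact ⟨hx, mem_univ _⟩

end Measurability

/-! ### Derivatives from quadratic errors and under the integral -/

section RealDerivatives

theorem HasDerivWithinAt.of_abs_sub_le_sq {F G : ℝ → ℝ} {d C r x : ℝ} {S : Set ℝ}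
    (hG : HasDerivWithinAt G d S x) (hx : x ∈ S) (hr : 0 < r)
    (h : ∀ s ∈ S, |s - x| ≤ r → |F s - F x - (G s - G x)| ≤ C * (s - x) ^ 2) :
    HasDerivWithinAt F d S x := by
  have hO : (fun s => F s - F x - (G s - G x)) =O[𝓝[S] x] fun s => ‖s - x‖ ^ 2 := by
    refine Asymptotics.IsBigO.of_bound C ?_
    filter_upwards [self_mem_nhdsWithin,
      mem_nhdsWithin_of_mem_nhds (Metric.closedBall_mem_nhds x hr)] with s hs hs'
    rw [Metric.mem_closedBall, Real.dist_eq] at hs'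
    simpa using h s hs hs'
  have h1 : HasDerivWithinAt (fun s => F s - F x - (G s - G x)) 0 S x := by
    rw [hasDerivWithinAt_iff_hasFDerivWithinAt]
    simpa using hO.hasFDerivWithinAt hx (by norm_num)
  have h2 := (h1.add hG).add_const (F x - G x)
  rw [zero_add] at h2
  refine h2.congr_of_mem (fun s _ => ?_) hx
  simp only [Pi.add_apply]
  ring

/-- Differentiation under the integral sign at a single point. -/
theorem hasDerivAt_integral_of_lip {Z : Type*} [MeasurableSpace Z] {μ : Measure Z}
    [IsFiniteMeasure μ] {F : ℝ → Z → ℝ} {d : Z → ℝ} {C r : ℝ} (hr : 0 < r)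
    (hF : ∀ t, AEStronglyMeasurable (F t) μ) (hint : Integrable (F 0) μ)
    (hlip : ∀ᵐ z ∂μ, ∀ t, |t| ≤ r → |F t z - F 0 z| ≤ C * |t|)
    (hd : ∀ᵐ z ∂μ, HasDerivAt (fun t => F t z) (d z) 0) :
    HasDerivAt (fun t => ∫ z, F t z ∂μ) (∫ z, d z ∂μ) 0 := by
  -- The derivative is an almost everywhere limit of difference quotients along 1/(k + 1).
  have hdm : AEStronglyMeasurable d μ := by
    refine aestronglyMeasurable_of_tendsto_ae atTop
      (f := fun (k : ℕ) z => ((k : ℝ) + 1) * (F (1 / ((k : ℝ) + 1)) z - F 0 z))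
      (fun k => ((hF _).sub (hF _)).const_mul _) ?_
    filter_upwards [hd] with z hz
    have h1 := hz.tendsto_slope_zero
    have h2 : Tendsto (fun k : ℕ => 1 / ((k : ℝ) + 1)) atTop (𝓝[≠] 0) :=
      tendsto_nhdsWithin_iff.2 ⟨tendsto_one_div_add_atTop_nhds_zero_nat,
        .of_forall fun k => by simp only [mem_compl_iff, mem_singleton_iff]; positivity⟩
    refine (h1.comp h2).congr fun k => ?_
    simp
  have hL : Continuous (ContinuousLinearMap.toSpanSingletonCLE (𝕜 := ℝ) (E := ℝ)) :=
    (ContinuousLinearMap.toSpanSingletonCLE (𝕜 := ℝ) (E := ℝ)).continuous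
  obtain ⟨h1, h2⟩ := hasFDerivAt_integral_of_dominated_loc_of_lip' (𝕜 := ℝ) (μ := μ) (F := F)
    (x₀ := (0 : ℝ)) (bound := fun _ => C) (s := Metric.closedBall 0 r)
    (F' := fun z => ContinuousLinearMap.toSpanSingleton ℝ (d z))
    (Metric.closedBall_mem_nhds _ hr) (fun t _ => hF t) hint
    (hL.comp_aestronglyMeasurable hdm) (by
      filter_upwards [hlip] with z hz t ht
      rw [sub_zero]
      exact hz t (by simpa using ht)) (integrable_const C) hd
  have h3 := h2.hasDerivAt
  rw [ContinuousLinearMap.integral_apply h1] at h3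
  simpa using h3

end RealDerivatives

/-! ### Deformations of the identity -/

section Deformation

variable {n : ℕ} {X : Type*} [TopologicalSpace X] [ChartedSpace (EuclideanSpace ℝ (Fin n)) X]

theorem IsDeformation.continuous {φ : ℝ → X → X} (hφ : IsDeformation (n := n) φ) :
    Continuous fun p : ℝ × X => φ p.1 p.2 :=
  hφ.contMDiff.continuous

theorem IsDeformation.hasDerivAt_comp {φ : ℝ → X → X} (hφ : IsDeformation (n := n) φ) {h : X → ℝ}
    {x : X} (hx : MDifferentiableAt (𝓡 n) 𝓘(ℝ, ℝ) h x) :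
    HasDerivAt (fun t => h (φ t x))
      (mfderiv (𝓡 n) 𝓘(ℝ, ℝ) h x (initialVelocity (n := n) φ x) : ℝ) 0 := by
  have hγ : MDifferentiableAt 𝓘(ℝ, ℝ) (𝓡 n) (fun t => φ t x) 0 := by
    have h1 : ContMDiff 𝓘(ℝ, ℝ) (𝓘(ℝ, ℝ).prod (𝓡 n)) ∞ (fun t : ℝ => (t, x)) :=
      contMDiff_id.prodMk contMDiff_const
    exact ((hφ.contMDiff.comp h1) 0).mdifferentiableAt (by simp)
  have hx' : MDifferentiableAt (𝓡 n) 𝓘(ℝ, ℝ) h (φ 0 x) := by rwa [hφ.map_zero]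
  have key0 := hx'.hasMFDerivAt.comp (0 : ℝ) hγ.hasMFDerivAt
  have key := HasFDerivAt.hasDerivAt (𝕜 := ℝ) (F := ℝ) (hasMFDerivAt_iff_hasFDerivAt.1 key0)
  -- The chain rule yields the differential at φ 0 x, which equals x only propositionally; the
  -- velocity is moved across as a vector of the model space.
  have e : ∀ y, y = x → ∀ v : EuclideanSpace ℝ (Fin n),
      (mfderiv (𝓡 n) 𝓘(ℝ, ℝ) h y v : ℝ) = (mfderiv (𝓡 n) 𝓘(ℝ, ℝ) h x v : ℝ) := by
    rintro y rfl v
    rfl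
  exact (e (φ 0 x) (hφ.map_zero x) _) ▸ key

variable [IsManifold (𝓡 n) ∞ X] {Y : Type*} [MetricSpace Y]
    [ChartedSpace (EuclideanSpace ℝ (Fin n)) Y] [IsManifold (𝓡 n) ∞ Y]
    [RiemannianBundle (fun y : Y => TangentSpace (𝓡 n) y)]
    [IsContMDiffRiemannianBundle (𝓡 n) ∞ (EuclideanSpace ℝ (Fin n))
      (fun y : Y => TangentSpace (𝓡 n) y)]
    [IsRiemannianManifold (𝓡 n) Y]

/-- In a chart of X the map is C¹ in time and position jointly, hence locally Lipschitz for the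
geodesic distance; compactness of K makes the constants uniform. -/
theorem exists_dist_le_mul_abs_of_contMDiff {Ψ : ℝ × X → Y}
    (hΨ : ContMDiff (𝓘(ℝ, ℝ).prod (𝓡 n)) (𝓡 n) ∞ Ψ) {K : Set X} (hK : IsCompact K) :
    ∃ C r : ℝ, 0 ≤ C ∧ 0 < r ∧ ∀ x ∈ K, ∀ t, |t| ≤ r → dist (Ψ (0, x)) (Ψ (t, x)) ≤ C * |t| := by
  refine hK.induction_on (p := fun K => ∃ C r : ℝ, 0 ≤ C ∧ 0 < r ∧ ∀ x ∈ K, ∀ t, |t| ≤ r →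
    dist (Ψ (0, x)) (Ψ (t, x)) ≤ C * |t|) ?_ ?_ ?_ ?_
  · exact ⟨0, 1, le_rfl, one_pos, fun x hx => hx.elim⟩
  · intro s t hst ht
    obtain ⟨C, r, hC, hr, h⟩ := ht
    exact ⟨C, r, hC, hr, fun x hx => h x (hst hx)⟩
  · intro s t hs ht
    obtain ⟨C, r, hC, hr, h⟩ := hs
    obtain ⟨C', r', hC', hr', h'⟩ := ht
    refine ⟨max C C', min r r', le_max_of_le_left hC, lt_min hr hr', ?_⟩
    rintro x (hx | hx) t ht
    · refine (h x hx t (ht.trans (min_le_left _ _))).trans ?_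
      gcongr
      exact le_max_left _ _
    · refine (h' x hx t (ht.trans (min_le_right _ _))).trans ?_
      gcongr
      exact le_max_right _ _
  · intro x₀ _
    have hw := mem_extChartAt_target (I := 𝓡 n) x₀
    set e := extChartAt (𝓡 n) x₀ with he
    have h1 : ContMDiffAt 𝓘(ℝ, ℝ × EuclideanSpace ℝ (Fin n)) (𝓡 n) 1
        (fun p : ℝ × EuclideanSpace ℝ (Fin n) => Ψ (p.1, e.symm p.2)) (0, e x₀) := by
      have h2 : ContMDiffAt 𝓘(ℝ, ℝ × EuclideanSpace ℝ (Fin n)) (𝓘(ℝ, ℝ).prod (𝓡 n)) ∞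
          (fun p : ℝ × EuclideanSpace ℝ (Fin n) => (p.1, e.symm p.2)) (0, e x₀) :=
        contDiff_fst.contMDiff.contMDiffAt.prodMk
          ((extChartAt_symm_contMDiffAt x₀ hw).comp (0, e x₀) contDiff_snd.contMDiff.contMDiffAt)
      exact ((hΨ _).comp (0, e x₀) h2).of_le (by simp)
    obtain ⟨L, t, ht, hL⟩ := h1.exists_lipschitzOnWith_riemannian
    rw [nhds_prod_eq] at ht
    obtain ⟨a, ha, b, hb, hab⟩ := mem_prod_iff.1 ht
    obtain ⟨r, hr, hra⟩ := Metric.nhds_basis_closedBall.mem_iff.1 ha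
    refine ⟨e.source ∩ e ⁻¹' b, mem_nhdsWithin_of_mem_nhds (inter_mem (extChartAt_source_mem_nhds x₀)
      (continuousAt_extChartAt (I := 𝓡 n) x₀ hb)), L, r, L.2, hr, fun x hx s hs => ?_⟩
    have hm : ∀ s : ℝ, |s| ≤ r → (s, e x) ∈ t := fun s hs =>
      hab ⟨hra (by simpa using hs), hx.2⟩
    have h3 := hL.dist_le_mul _ (hm 0 (by simpa using hr.le)) _ (hm s hs)
    simp only [e.left_inv hx.1] at h3
    refine h3.trans (le_of_eq ?_)
    rw [Prod.dist_eq]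
    simp

end Deformation

/-! ### The first variation -/

section FirstVariation

/-- Dirac masses are admissible test measures and recover a first variation pointwise up to its
μ-mean, as one-sided derivatives on a half-line are unique. -/
theorem IsFirstVariation.eq_add_const {X : Type*} [TopologicalSpace X] [MeasurableSpace X]
    [MeasurableSingletonClass X] {F : Measure X → ℝ}
    {μ : Measure X} {h k : X → ℝ} (hh : IsFirstVariation F μ h) (hk : IsFirstVariation F μ k) :
    ∃ a : ℝ, ∀ x, h x = k x + a := by
  refine ⟨∫ x, h x ∂μ - ∫ x, k x ∂μ, fun x => ?_⟩
  have hc : CompactlySupported (Measure.dirac x) := ⟨{x}, isCompact_singleton, by simp⟩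
  obtain ⟨-, -, h1⟩ := hh (Measure.dirac x) inferInstance hc
  obtain ⟨-, -, h2⟩ := hk (Measure.dirac x) inferInstance hc
  have h3 := (uniqueDiffOn_Ici (0 : ℝ) 0 self_mem_Ici).eq_deriv _ h1 h2
  rw [integral_dirac, integral_dirac] at h3
  linarith

variable {X : Type*} [TopologicalSpace X] [MeasurableSpace X] [BorelSpace X]
  {Y : Type*} [MetricSpace Y] [MeasurableSpace Y] [BorelSpace Y]

theorem map_compl_image_eq_zero {χ : Measure X} {T : X → Y} (hT : Continuous T) {K : Set X}
    (hK : IsCompact K) (hχ : χ Kᶜ = 0) : χ.map T (T '' K)ᶜ = 0 := by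
  rw [Measure.map_apply hT.measurable (hK.image hT).isClosed.measurableSet.compl]
  exact measure_mono_null (fun x hx hxK => hx (mem_image_of_mem T hxK)) hχ

theorem IsSinkhornPair.isFirstVariation [SecondCountableTopology Y] {ε : ℝ} (hε : 0 < ε)
    {ν : Measure Y} [IsProbabilityMeasure ν] (hν : CompactlySupported ν)
    {μ : Measure X} [IsProbabilityMeasure μ] (hμ : CompactlySupported μ) {T : X → Y}
    (hT : Continuous T) {f g : Y → ℝ} (h : IsSinkhornPair ε ν (μ.map T) f g) :
    IsFirstVariation (pushforwardEnergy ε ν T) μ (g ∘ T) := by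
  intro χ hχ hχc
  obtain ⟨Kν, hKν, hν0⟩ := hν
  obtain ⟨Kμ, hKμ, hμ0⟩ := hμ
  obtain ⟨Kχ, hKχ, hχ0⟩ := hχc
  have hg := h.continuous_right
  have hnull : ∀ {m : Measure Y} {A B : Set Y}, m Aᶜ = 0 → A ⊆ B → m Bᶜ = 0 :=
    fun h1 h2 => measure_mono_null (compl_subset_compl.2 h2) h1
  set K := Kν ∪ (T '' Kμ ∪ T '' Kχ) with hKdef
  have hK : IsCompact K := hKν.union ((hKμ.image hT).union (hKχ.image hT))
  have : IsProbabilityMeasure (μ.map T) :=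
    Measure.isProbabilityMeasure_map hT.measurable.aemeasurable
  have : IsProbabilityMeasure (χ.map T) :=
    Measure.isProbabilityMeasure_map hT.measurable.aemeasurable
  have hρK : μ.map T Kᶜ = 0 := hnull (map_compl_image_eq_zero hT hKμ hμ0)
    (subset_union_left.trans subset_union_right)
  have hσK : χ.map T Kᶜ = 0 := hnull (map_compl_image_eq_zero hT hKχ hχ0)
    (subset_union_right.trans subset_union_right)
  have hint : ∀ m : Measure X, IsProbabilityMeasure m → m.map T Kᶜ = 0 →
      Integrable (g ∘ T) m ∧ ∫ x, (g ∘ T) x ∂m = ∫ y, g y ∂(m.map T) := by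
    intro m _ hm
    have : IsProbabilityMeasure (m.map T) :=
      Measure.isProbabilityMeasure_map hT.measurable.aemeasurable
    exact ⟨(hg.integrable_of_compl_null hK hm).comp_aemeasurable hT.measurable.aemeasurable,
      (integral_map hT.measurable.aemeasurable
        hg.measurable.aestronglyMeasurable).symm⟩
  obtain ⟨i1, i2⟩ := hint μ inferInstance hρK
  obtain ⟨j1, j2⟩ := hint χ hχ hσK
  refine ⟨i1, j1, ?_⟩
  rw [i2, j2]
  obtain ⟨C, s₀, hs₀, hC⟩ := h.segment_expansion hε hK (hnull hν0 subset_union_left) hρK hσK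
  have hlin : HasDerivWithinAt (fun s : ℝ => s * (∫ y, g y ∂χ.map T - ∫ y, g y ∂μ.map T))
      (∫ y, g y ∂χ.map T - ∫ y, g y ∂μ.map T) (Ici 0) 0 := by
    simpa using ((hasDerivAt_id (0 : ℝ)).mul_const
      (∫ y, g y ∂χ.map T - ∫ y, g y ∂μ.map T)).hasDerivWithinAt (s := Ici 0)
  refine hlin.of_abs_sub_le_sq self_mem_Ici hs₀ (C := C) fun s hs hs' => ?_
  rw [sub_zero, abs_of_nonneg hs] at hs'
  have := hC s hs hs'
  simpa [pushforwardEnergy, Measure.map_add _ _ hT.measurable, Measure.map_smul] using this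

end FirstVariation

/-! ### Derivative along deformations and the main theorem -/

section WassersteinGradient

variable {n : ℕ} {X : Type*} [TopologicalSpace X] [T2Space X]
    [ChartedSpace (EuclideanSpace ℝ (Fin n)) X]
    [IsManifold (𝓡 n) ∞ X] [RiemannianBundle (fun x : X => TangentSpace (𝓡 n) x)]
    [MeasurableSpace X] [BorelSpace X]
    {Y : Type*} [MetricSpace Y] [SecondCountableTopology Y]
    [ChartedSpace (EuclideanSpace ℝ (Fin n)) Y] [IsManifold (𝓡 n) ∞ Y]
    [RiemannianBundle (fun y : Y => TangentSpace (𝓡 n) y)]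
    [IsContMDiffRiemannianBundle (𝓡 n) ∞ (EuclideanSpace ℝ (Fin n))
      (fun y : Y => TangentSpace (𝓡 n) y)]
    [IsRiemannianManifold (𝓡 n) Y]
    [MeasurableSpace Y] [BorelSpace Y]

theorem IsSinkhornPair.hasDerivAt_deformation {ε : ℝ} (hε : 0 < ε)
    {ν : Measure Y} [IsProbabilityMeasure ν] (hν : CompactlySupported ν)
    {μ : Measure X} [IsProbabilityMeasure μ] (hμ : CompactlySupported μ) {T : X → Y}
    (hT : ContMDiff (𝓡 n) (𝓡 n) ∞ T) {f g : Y → ℝ} (h : IsSinkhornPair ε ν (μ.map T) f g)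
    (hd : ∀ᵐ x ∂μ, MDifferentiableAt (𝓡 n) 𝓘(ℝ, ℝ) (g ∘ T) x)
    {φ : ℝ → X → X} (hφ : IsDeformation (n := n) φ) :
    HasDerivAt (fun t => pushforwardEnergy ε ν T (μ.map (φ t)))
      (∫ x, inner ℝ (riemGrad (n := n) (g ∘ T) x) (initialVelocity (n := n) φ x) ∂μ) 0 := by
  obtain ⟨Kν, hKν, hν0⟩ := hν
  obtain ⟨Kμ, hKμ, hμ0⟩ := hμ
  have hg := h.continuous_right
  have hTc := hT.continuous
  have hφt : ∀ t, Continuous (φ t) := fun t =>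
    hφ.continuous.comp (continuous_const.prodMk continuous_id)
  have hb : ∀ t, Continuous (T ∘ φ t) := fun t => hTc.comp (hφt t)
  have hΨ : ContMDiff (𝓘(ℝ, ℝ).prod (𝓡 n)) (𝓡 n) ∞ fun p : ℝ × X => T (φ p.1 p.2) :=
    hT.comp hφ.contMDiff
  obtain ⟨L, r₀, hL0, hr₀, hL⟩ := exists_dist_le_mul_abs_of_contMDiff hΨ hKμ
  simp only [hφ.map_zero] at hL
  -- One compact set must carry ν and all the push-forwards for |t| ≤ 1, since the expansion
  -- constants depend on it.
  set K := Kν ∪ (fun p : ℝ × X => T (φ p.1 p.2)) '' (Icc (-1) 1 ×ˢ Kμ) with hKdef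
  have hK : IsCompact K := hKν.union ((isCompact_Icc.prod hKμ).image hΨ.continuous)
  have hνK : ν Kᶜ = 0 := measure_mono_null (compl_subset_compl.2 subset_union_left) hν0
  have hbK : ∀ t, |t| ≤ 1 → ∀ x ∈ Kμ, T (φ t x) ∈ K := fun t ht x hx =>
    .inr ⟨(t, x), ⟨abs_le.1 ht, hx⟩, rfl⟩
  have hTK : ∀ x ∈ Kμ, T x ∈ K := fun x hx => by
    simpa only [hφ.map_zero] using hbK 0 (by simp) x hx
  have haeK : ∀ᵐ x ∂μ, x ∈ Kμ := mem_ae_iff.2 hμ0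
  obtain ⟨C, D₀, hC0, hD₀, hC⟩ := h.map_expansion hTc.measurable hε hK hνK
    (haeK.mono hTK)
  obtain ⟨R, hR0, hR⟩ := exists_dist_le hK
  have hgR : ∀ y ∈ K, ∀ y' ∈ K, |g y - g y'| ≤ R * dist y y' := fun y hy y' hy' => by
    rw [h.eq_transform_right]
    exact abs_sinkhornTransform_sub_le hε hK hνK h.continuous_left
      (fun x hx => hR x hx y hy) fun x hx => hR x hx y' hy'
  have hgb : ∀ t, Continuous fun x => g (T (φ t x)) := fun t => hg.comp (hb t)
  have hI : HasDerivAt (fun t => ∫ x, g (T (φ t x)) ∂μ)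
      (∫ x, inner ℝ (riemGrad (n := n) (g ∘ T) x) (initialVelocity (n := n) φ x) ∂μ) 0 := by
    simp only [inner_riemGrad]
    refine hasDerivAt_integral_of_lip (r := min r₀ 1) (C := R * L) (lt_min hr₀ one_pos)
      (fun t => (hgb t).measurable.aestronglyMeasurable)
      ((hgb 0).integrable_of_compl_null hKμ hμ0) ?_ (hd.mono fun x hx => hφ.hasDerivAt_comp hx)
    filter_upwards [haeK] with x hx t ht
    rw [hφ.map_zero, mul_assoc]
    refine (hgR _ (hbK t (ht.trans (min_le_right _ _)) x hx) _ (hTK x hx)).trans ?_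
    rw [dist_comm]
    gcongr
    exact hL x hx t (ht.trans (min_le_left _ _))
  rw [← hasDerivWithinAt_univ] at hI ⊢
  have hφ0 : φ 0 = id := funext hφ.map_zero
  -- The energy and ∫ g ∘ T ∘ φ_t dμ have increments differing by O(t²): the expansion is applied
  -- with D = L |t|, and the radius ensures D ≤ D₀.
  refine hI.of_abs_sub_le_sq (mem_univ _) (r := min (min r₀ 1) (D₀ / (L + 1))) (C := C * L ^ 2)
    (lt_min (lt_min hr₀ one_pos) (by positivity)) fun t _ ht => ?_
  rw [sub_zero] at ht ⊢
  have ht1 := ht.trans (min_le_left _ _)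
  have htD : L * |t| ≤ D₀ := by
    have h1 := (le_div_iff₀ (by positivity)).1 (ht.trans (min_le_right _ _))
    nlinarith [abs_nonneg t]
  have key := hC (L * |t|) (by positivity) htD (T ∘ φ t) (hb t).measurable
    (haeK.mono fun x hx => hbK t (ht1.trans (min_le_right _ _)) x hx)
    (haeK.mono fun x hx => hL x hx t (ht1.trans (min_le_left _ _)))
  rw [mul_pow, sq_abs, ← mul_assoc] at key
  simpa only [pushforwardEnergy, hφ0, Measure.map_id, id,
    Measure.map_map hTc.measurable (hφt t).measurable, Function.comp_apply] using key

end WassersteinGradient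

theorem lemma1 {n : ℕ}
    -- the source, a Riemannian manifold without boundary
    {X : Type*} [TopologicalSpace X] [T2Space X] [SecondCountableTopology X]
    [ChartedSpace (EuclideanSpace ℝ (Fin n)) X] [IsManifold (𝓡 n) ∞ X]
    [RiemannianBundle (fun x : X => TangentSpace (𝓡 n) x)]
    [IsContMDiffRiemannianBundle (𝓡 n) ∞ (EuclideanSpace ℝ (Fin n))
      (fun x : X => TangentSpace (𝓡 n) x)]
    [MeasurableSpace X] [BorelSpace X]
    -- the target, a Riemannian manifold without boundary with its geodesic distance
    {Y : Type*} [MetricSpace Y] [SecondCountableTopology Y]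
    [ChartedSpace (EuclideanSpace ℝ (Fin n)) Y] [IsManifold (𝓡 n) ∞ Y]
    [RiemannianBundle (fun y : Y => TangentSpace (𝓡 n) y)]
    [IsContMDiffRiemannianBundle (𝓡 n) ∞ (EuclideanSpace ℝ (Fin n))
      (fun y : Y => TangentSpace (𝓡 n) y)]
    [IsRiemannianManifold (𝓡 n) Y]
    [MeasurableSpace Y] [BorelSpace Y]
    (T : Diffeomorph (𝓡 n) (𝓡 n) X Y ∞)
    (ε : ℝ) (hε : 0 < ε)
    (ν : Measure Y) [IsProbabilityMeasure ν] (hν : CompactlySupported ν)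
    (μ : Measure X) [IsProbabilityMeasure μ] (hμ : CompactlySupported μ)
    (hμ_ac : ACInCharts (n := n) μ) :
    -- Sinkhorn potentials exist
    (∃ f g : Y → ℝ, IsSinkhornPair ε ν (μ.map T) f g) ∧
    ∀ f g : Y → ℝ, IsSinkhornPair ε ν (μ.map T) f g →
      -- they are unique up to an additive constant
      (∀ f' g' : Y → ℝ, IsSinkhornPair ε ν (μ.map T) f' g' →
        ∃ a : ℝ, (∀ y, f' y = f y + a) ∧ ∀ y, g' y = g y - a) ∧
      -- they are optimal in the dual problem, whose value is `F_ε(μ)`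
      entropicDual ε ν (μ.map T) f g = pushforwardEnergy ε ν T μ ∧
      (∀ f' g' : Y → ℝ, Continuous f' → Continuous g' →
        entropicDual ε ν (μ.map T) f' g' ≤ pushforwardEnergy ε ν T μ) ∧
      -- the first variation of `F_ε` at `μ` is `g ∘ T`, up to an additive constant
      IsFirstVariation (pushforwardEnergy ε ν T) μ (g ∘ T) ∧
      (∀ h : X → ℝ, IsFirstVariation (pushforwardEnergy ε ν T) μ h →
        ∃ a : ℝ, ∀ x, h x = g (T x) + a) ∧
      -- the Wasserstein gradient of `F_ε` at `μ` is the gradient of the first variation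
      (∀ᵐ x ∂μ, MDifferentiableAt (𝓡 n) 𝓘(ℝ, ℝ) (g ∘ T) x) ∧
      IsWassersteinGradient (pushforwardEnergy ε ν T) μ (riemGrad (n := n) (g ∘ T)) := by
  obtain ⟨Kν, hKν, hν0⟩ := id hν
  obtain ⟨Kμ, hKμ, hμ0⟩ := id hμ
  have hTs : ContMDiff (𝓡 n) (𝓡 n) ∞ T := T.contMDiff
  have hTc : Continuous T := hTs.continuous
  have : IsProbabilityMeasure (μ.map T) :=
    Measure.isProbabilityMeasure_map hTc.measurable.aemeasurable
  have hK : IsCompact (Kν ∪ T '' Kμ) := hKν.union (hKμ.image hTc)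
  have hνK : ν (Kν ∪ T '' Kμ)ᶜ = 0 :=
    measure_mono_null (compl_subset_compl.2 subset_union_left) hν0
  have hρK : μ.map T (Kν ∪ T '' Kμ)ᶜ = 0 :=
    measure_mono_null (compl_subset_compl.2 subset_union_right)
      (map_compl_image_eq_zero hTc hKμ hμ0)
  refine ⟨exists_isSinkhornPair_of_compl_null hε hK ν _ hνK hρK, fun f g h => ?_⟩
  obtain ⟨hval, hmax⟩ := h.entropicW2Sq_eq hε hK hνK hρK
  have hfv := h.isFirstVariation hε hν hμ hTc
  have hlip : LocallyLipschitzInCharts n (g ∘ T) := by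
    rw [h.eq_transform_right]
    exact (locallyLipschitz_sinkhornTransform hε hKν hν0 h.continuous_left).comp_contMDiff hTs
  have hd := hlip.ae_mdifferentiableAt hμ_ac
  refine ⟨fun f' g' h' => h.unique hε hK hνK hρK h', hval.symm, hmax, hfv,
    fun k hk => hk.eq_add_const hfv, hd, ⟨aemeasurable_riemGrad μ _, fun δ hδ => ?_⟩,
    fun φ hφ => h.hasDerivAt_deformation hε hν hμ hTs hd hφ⟩
  obtain ⟨ψ, h1, h2, G, -, h3, h4⟩ := hlip.gradApproximable hμ_ac hKμ hμ0 δ hδ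
  exact ⟨ψ, h1, h2, (lintegral_mono_ae h3).trans_lt h4⟩
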